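/- **Conventions.** A tracial von Neumann algebra is a von Neumann algebra $A$ together with a faithful normal tracial state $\tau$; write $\|x\|_2=\tau(x^*x)^{1/2}$. It is regarded as a metric structure in the many-sorted continuous language $L$ of tracial von Neumann algebras: for each $n\in\mathbb N$ there is a sort $D_n$, interpreted as the operator-norm ball of radius $n$ with the metric $\|x-y\|_2$; the function symbols are the constants $0,1\in D_1$, the inclusions $D_m\to D_n$ ($m\le n$), addition $D_m\times D_n\to D_{m+n}$, multiplication $D_m\times D_n\to D_{mn}$, the adjoint $D_n\to D_n$, and multiplication by each scalar $\lambda\in\mathbb Q(i)$ as a map $D_m\to D_n$ whenever $|\lambda|m\le n$; the predicate symbols are the real and imaginary parts of the trace on each $D_n$. Each symbol carries an evident modulus of uniform continuity and, for predicates, a bound. An $L$-structure interprets the sorts as nonempty complete metric spaces (with $D_n$ of diameter at most $2n$) and the symbols as maps obeying these moduli and bounds. Fix a sequence $(u_k)$ of continuous functions $\mathbb R^{j}\to\mathbb R$ ($j$ varying with $k$) that contains $x+y$, $xy$, $\max(x-y,0)$, the unary functions $x\mapsto qx$ ($q\in\mathbb Q$), $x\mapsto 0$, $x\mapsto 1$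 and $x\mapsto x/2$. Restricted $L$-sentences are the $L$-sentences built from the predicates and the metric applied to terms using the $u_k$ as connectives and $\sup$, $\inf$ over the sorts as quantifiers; they are coded by natural numbers in the standard way. A set $T$ of restricted $L$-sentences is effectively enumerable if the set of codes of its elements is recursively enumerable. For an $L$-structure $M$, the full theory of $M$ is the set of restricted sentences $\sigma$ with $\sigma^M=0$, and $N\models T$ means that $\sigma^N=0$ for all $\sigma\in T$. An embedding of $L$-structures is a family of isometric maps between the sorts respecting all symbols, and $M^{\mathcal U}$ denotes the metric ultrapower. For an $L$-structure $M$, the $M$EP has a positive solution if there is an effectively enumerable subset $T$ of the full theory of $M$ such that every $L$-structure $N$ with $N\models T$ embeds into an ultrapower of $M$. A tracial von Neumann algebra $\mathcal S$ is locally universal if every tracial von Neumann algebra embeds into an ultrapower of $\mathcal S$. **Theorem.** If $\mathcal S$ is a locally universal tracial von Neumann algebra, then the $\mathcal S$EP has a positive solution. -/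

import Mathlib

open Filter Topology

universe w

noncomputable section

namespace ContLogic

/-! ### Many-sorted continuous first-order languages and metric structures -/

/-- A many-sorted continuous (metric) language: sorts with bounds on their diameters, function
symbols and real-valued predicate symbols with moduli of uniform continuity, bounds for the
predicates, and numberings of the symbols (used to code formulas by natural numbers). -/
structure Language where
  Sorts : Type
  Fn : Type
  Rel : Type
  /-- bound on the diameter of a sort -/
  diam : Sorts → ℝ
  fnDom : Fn → List Sorts
  fnCod : Fn → Sorts
  fnMod : Fn → ℝ → ℝ
  fnMod_pos : ∀ f ε, 0 < ε → 0 < fnMod f ε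
  relDom : Rel → List Sorts
  relMod : Rel → ℝ → ℝ
  relMod_pos : ∀ R ε, 0 < ε → 0 < relMod R ε
  /-- a predicate symbol `R` takes its values in `[-relBound R, relBound R]` -/
  relBound : Rel → ℝ
  sortCode : Sorts → ℕ
  sortCode_injective : Function.Injective sortCode
  fnCode : Fn → ℕ
  fnCode_injective : Function.Injective fnCode
  relCode : Rel → ℕ
  relCode_injective : Function.Injective relCode

section General

variable {L : Language}

/-- Tuples in a family of types, of the sorts given by a list. -/
abbrev Tuple {S : Type} (X : S → Type w) (l : List S) : Type w :=
  ∀ i : Fin l.length, X (l.get i)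

/-- The data of an `L`-structure, except that the sorts need not be complete. -/
structure Prestructure (L : Language) where
  carrier : L.Sorts → Type w
  [metric : ∀ s, MetricSpace (carrier s)]
  nonempty : ∀ s, Nonempty (carrier s)
  dist_le : ∀ s (x y : carrier s), dist x y ≤ L.diam s
  fnMap : ∀ f : L.Fn, Tuple carrier (L.fnDom f) → carrier (L.fnCod f)
  fn_mod : ∀ (f : L.Fn) (ε : ℝ), 0 < ε → ∀ x y : Tuple carrier (L.fnDom f),
    (∀ i, dist (x i) (y i) < L.fnMod f ε) → dist (fnMap f x) (fnMap f y) ≤ ε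
  relMap : ∀ R : L.Rel, Tuple carrier (L.relDom R) → ℝ
  rel_bound : ∀ (R : L.Rel) (x : Tuple carrier (L.relDom R)), |relMap R x| ≤ L.relBound R
  rel_mod : ∀ (R : L.Rel) (ε : ℝ), 0 < ε → ∀ x y : Tuple carrier (L.relDom R),
    (∀ i, dist (x i) (y i) < L.relMod R ε) → |relMap R x - relMap R y| ≤ ε

attribute [instance] Prestructure.metric

/-- An `L`-structure: every sort is a complete metric space. -/
structure Structure (L : Language) extends Prestructure.{w} L where
  complete : ∀ s, CompleteSpace (carrier s)

/-- An embedding: sort-wise isometric maps that respect all symbols of the language. -/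
structure Embedding (N M : Prestructure.{w} L) where
  toFun : ∀ s, N.carrier s → M.carrier s
  isometry : ∀ s, Isometry (toFun s)
  map_fn : ∀ (f : L.Fn) (x : Tuple N.carrier (L.fnDom f)),
    toFun _ (N.fnMap f x) = M.fnMap f (fun i => toFun _ (x i))
  map_rel : ∀ (R : L.Rel) (x : Tuple N.carrier (L.relDom R)),
    M.relMap R (fun i => toFun _ (x i)) = N.relMap R x

/-! ### Ultrapowers -/

/-- The limit of a family of reals along an ultrafilter (meaningful for bounded families). -/
def ulim {ι : Type w} (U : Ultrafilter ι) (f : ι → ℝ) : ℝ := limUnder (U : Filter ι) f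

theorem tendsto_ulim {ι : Type w} (U : Ultrafilter ι) {f : ι → ℝ} {C : ℝ}
    (h : ∀ i, |f i| ≤ C) : Tendsto f U (𝓝 (ulim U f)) := by
  have hU : ((U.map f : Ultrafilter ℝ) : Filter ℝ) ≤ 𝓟 (Set.Icc (-C) C) := by
    rw [Ultrafilter.coe_map, le_principal_iff, mem_map]
    exact Filter.univ_mem' fun i => abs_le.1 (h i)
  obtain ⟨x, -, hx⟩ := isCompact_Icc.ultrafilter_le_nhds _ hU
  exact tendsto_nhds_limUnder ⟨x, hx⟩

namespace Ultrapower

variable (M : Prestructure.{w} L) {ι : Type w} (U : Ultrafilter ι)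

/-- Representatives of elements of the ultrapower: families indexed by `ι`. -/
structure Rep (M : Prestructure.{w} L) {ι : Type w} (U : Ultrafilter ι) (s : L.Sorts) where
  val : ι → M.carrier s

variable {M U}

theorem tendsto_dist {s : L.Sorts} (x y : Rep M U s) :
    Tendsto (fun i => dist (x.val i) (y.val i)) U
      (𝓝 (ulim U fun i => dist (x.val i) (y.val i))) :=
  tendsto_ulim U (C := L.diam s) fun i => by
    rw [abs_of_nonneg dist_nonneg]; exact M.dist_le s _ _

instance (s : L.Sorts) : PseudoMetricSpace (Rep M U s) where
  dist x y := ulim U fun i => dist (x.val i) (y.val i)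
  dist_self x := by
    refine tendsto_nhds_unique (tendsto_dist x x) ?_
    simp
  dist_comm x y := by simp only [dist_comm]
  dist_triangle x y z :=
    le_of_tendsto_of_tendsto' (tendsto_dist x z) ((tendsto_dist x y).add (tendsto_dist y z))
      fun i => dist_triangle _ _ _

theorem rep_dist_def {s : L.Sorts} (x y : Rep M U s) :
    dist x y = ulim U fun i => dist (x.val i) (y.val i) := rfl

/-- A sort of the ultrapower: families modulo `lim_U d(x_i, y_i) = 0`. -/
abbrev Carrier (M : Prestructure.{w} L) {ι : Type w} (U : Ultrafilter ι) (s : L.Sorts) : Type w :=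
  SeparationQuotient (Rep M U s)

/-- The class of a family. -/
def mk {s : L.Sorts} (x : ι → M.carrier s) : Carrier M U s := SeparationQuotient.mk ⟨x⟩

/-- A family representing an element of the ultrapower. -/
def out {s : L.Sorts} (x : Carrier M U s) : ι → M.carrier s :=
  (Function.surjInv SeparationQuotient.surjective_mk x).val

theorem mk_out {s : L.Sorts} (x : Carrier M U s) : mk (out x) = x :=
  Function.surjInv_eq SeparationQuotient.surjective_mk x

theorem tendsto_dist_mk {s : L.Sorts} (x y : ι → M.carrier s) :
    Tendsto (fun i => dist (x i) (y i)) U (𝓝 (dist (mk x : Carrier M U s) (mk y))) := by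
  have := tendsto_dist (U := U) (⟨x⟩ : Rep M U s) ⟨y⟩
  rwa [← rep_dist_def, ← SeparationQuotient.dist_mk] at this

theorem tendsto_dist_out {s : L.Sorts} (x y : Carrier M U s) :
    Tendsto (fun i => dist (out x i) (out y i)) U (𝓝 (dist x y)) := by
  have := tendsto_dist_mk (U := U) (out x) (out y)
  rwa [mk_out, mk_out] at this

theorem eventually_dist_lt {l : List L.Sorts} {x y : Tuple (Carrier M U) l} {δ : ℝ}
    (h : ∀ i, dist (x i) (y i) < δ) :
    ∀ᶠ j in (U : Filter ι), ∀ i, dist (out (x i) j) (out (y i) j) < δ :=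
  eventually_all.2 fun i => (tendsto_dist_out (x i) (y i)).eventually_lt_const (h i)

end Ultrapower

open Ultrapower in
/-- The ultrapower `M^U` of a metric structure. Function and predicate symbols are evaluated
coordinatewise on representing families; by uniform continuity the choice of representatives
does not matter (see `ultrapower_fnMap_mk`, `ultrapower_relMap_mk`). -/
def ultrapower (M : Prestructure.{w} L) {ι : Type w} (U : Ultrafilter ι) : Prestructure.{w} L where
  carrier := Carrier M U
  nonempty s := ⟨mk fun _ => (M.nonempty s).some⟩
  dist_le s x y := le_of_tendsto' (tendsto_dist_out x y) fun _ => M.dist_le s _ _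
  fnMap f x := mk fun j => M.fnMap f fun i => out (x i) j
  fn_mod f ε hε x y h := le_of_tendsto (tendsto_dist_mk _ _) <| by
    filter_upwards [eventually_dist_lt h] with j hj
    exact M.fn_mod f ε hε _ _ hj
  relMap R x := ulim U fun j => M.relMap R fun i => out (x i) j
  rel_bound R x := by
    refine le_of_tendsto' (tendsto_ulim U (C := L.relBound R) fun j => ?_).abs fun j => ?_ <;>
    exact M.rel_bound R _
  rel_mod R ε hε x y h := by
    refine le_of_tendsto (((tendsto_ulim U (C := L.relBound R) fun j => ?_).sub
      (tendsto_ulim U (C := L.relBound R) fun j => ?_)).abs) ?_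
    · exact M.rel_bound R _
    · exact M.rel_bound R _
    · filter_upwards [eventually_dist_lt h] with j hj
      exact M.rel_mod R ε hε _ _ hj

namespace Ultrapower

variable {M : Prestructure.{w} L} {ι : Type w} {U : Ultrafilter ι}

theorem eventually_out_mk {l : List L.Sorts} (a : ι → Tuple M.carrier l) {δ : ℝ} (hδ : 0 < δ) :
    ∀ᶠ j in (U : Filter ι), ∀ i,
      dist (out (mk (U := U) fun j' => a j' i) j) (a j i) < δ := by
  refine eventually_all.2 fun i => ?_
  have h := tendsto_dist_mk (U := U) (out (mk (U := U) fun j' => a j' i)) fun j' => a j' i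
  rw [mk_out, dist_self] at h
  exact h.eventually_lt_const hδ

theorem ultrapower_fnMap_mk (f : L.Fn) (a : ι → Tuple M.carrier (L.fnDom f)) :
    (ultrapower M U).fnMap f (fun i => mk fun j => a j i) = mk fun j => M.fnMap f (a j) := by
  refine eq_of_forall_dist_le fun ε hε => le_of_tendsto (tendsto_dist_mk (U := U) _ _) ?_
  filter_upwards [eventually_out_mk a (L.fnMod_pos f ε hε)] with j hj
  exact M.fn_mod f ε hε _ _ hj

theorem ultrapower_relMap_mk (R : L.Rel) (a : ι → Tuple M.carrier (L.relDom R)) :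
    (ultrapower M U).relMap R (fun i => mk fun j => a j i) = ulim U fun j => M.relMap R (a j) := by
  refine eq_of_forall_dist_le fun ε hε => ?_
  rw [Real.dist_eq]
  refine le_of_tendsto (((tendsto_ulim U (C := L.relBound R) fun j => ?_).sub
      (tendsto_ulim U (C := L.relBound R) fun j => ?_)).abs) ?_
  · exact M.rel_bound R _
  · exact M.rel_bound R _
  · filter_upwards [eventually_out_mk a (L.relMod_pos R ε hε)] with j hj
    exact M.rel_mod R ε hε _ _ hj

end Ultrapower

/-- `N` embeds into some ultrapower of `M`. -/
def EmbedsInUltrapower (N M : Prestructure.{w} L) : Prop :=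
  ∃ (ι : Type w) (U : Ultrafilter ι), Nonempty (Embedding N (ultrapower M U))

/-! ### Restricted formulas and their values -/

/-- A countable family `u₀, u₁, …` of continuous functions `ℝᵏ → ℝ` (with `k` varying), among them
`+`, `·`, rational multiples, `∸`, the unary constants `0`, `1`, and halving. A formula is
*restricted* if all its connectives belong to the family. -/
structure Connectives where
  arity : ℕ → ℕ
  fn : ∀ n, C(Fin (arity n) → ℝ, ℝ)
  has_add : ∃ n, ∃ h : 2 = arity n, ∀ x : Fin 2 → ℝ, fn n (x ∘ Fin.cast h.symm) = x 0 + x 1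
  has_mul : ∃ n, ∃ h : 2 = arity n, ∀ x : Fin 2 → ℝ, fn n (x ∘ Fin.cast h.symm) = x 0 * x 1
  has_smul : ∀ q : ℚ, ∃ n, ∃ h : 1 = arity n, ∀ x : Fin 1 → ℝ,
    fn n (x ∘ Fin.cast h.symm) = (q : ℝ) * x 0
  has_dotminus : ∃ n, ∃ h : 2 = arity n, ∀ x : Fin 2 → ℝ,
    fn n (x ∘ Fin.cast h.symm) = max (x 0 - x 1) 0
  has_zero : ∃ n, ∃ h : 1 = arity n, ∀ x : Fin 1 → ℝ, fn n (x ∘ Fin.cast h.symm) = 0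
  has_one : ∃ n, ∃ h : 1 = arity n, ∀ x : Fin 1 → ℝ, fn n (x ∘ Fin.cast h.symm) = 1
  has_half : ∃ n, ∃ h : 1 = arity n, ∀ x : Fin 1 → ℝ, fn n (x ∘ Fin.cast h.symm) = x 0 / 2

/-- Terms of each sort whose variables are declared by the context `Γ` (the `i`-th variable has
sort `Γ.get i`). -/
inductive Term (L : Language) (Γ : List L.Sorts) : L.Sorts → Type
  | var (i : Fin Γ.length) : Term L Γ (Γ.get i)
  | app (f : L.Fn) (ts : ∀ i : Fin (L.fnDom f).length, Term L Γ ((L.fnDom f).get i)) :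
      Term L Γ (L.fnCod f)

/-- Restricted `L`-formulas in context `Γ`; quantifiers bind the variable with index `0`. -/
inductive Formula (L : Language) (u : Connectives) : List L.Sorts → Type
  | rel {Γ : List L.Sorts} (R : L.Rel)
      (ts : ∀ i : Fin (L.relDom R).length, Term L Γ ((L.relDom R).get i)) : Formula L u Γ
  | dist {Γ : List L.Sorts} {s : L.Sorts} (t₁ t₂ : Term L Γ s) : Formula L u Γ
  | conn {Γ : List L.Sorts} (n : ℕ) (φ : Fin (u.arity n) → Formula L u Γ) : Formula L u Γ
  | sup {Γ : List L.Sorts} (s : L.Sorts) (φ : Formula L u (s :: Γ)) : Formula L u Γ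
  | inf {Γ : List L.Sorts} (s : L.Sorts) (φ : Formula L u (s :: Γ)) : Formula L u Γ

/-- Restricted `L`-sentences: formulas without free variables. -/
abbrev Sentence (L : Language) (u : Connectives) : Type := Formula L u []

/-- Extend an assignment by a value for the new variable `0`. -/
def Tuple.cons {S : Type} {X : S → Type w} {s : S} {l : List S} (a : X s) (v : Tuple X l) :
    Tuple X (s :: l) :=
  Fin.cons (α := fun i : Fin (l.length + 1) => X ((s :: l).get i)) a v

/-- The value of a term under an assignment. -/
def Term.eval (M : Prestructure.{w} L) {Γ : List L.Sorts} (v : Tuple M.carrier Γ) :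
    {s : L.Sorts} → Term L Γ s → M.carrier s
  | _, .var i => v i
  | _, .app f ts => M.fnMap f fun i => (ts i).eval M v

/-- The value of a formula under an assignment. -/
def Formula.eval {u : Connectives} (M : Prestructure.{w} L) :
    {Γ : List L.Sorts} → Formula L u Γ → Tuple M.carrier Γ → ℝ
  | _, .rel R ts, v => M.relMap R fun i => (ts i).eval M v
  | _, .dist t₁ t₂, v => Dist.dist (t₁.eval M v) (t₂.eval M v)
  | _, .conn n φ, v => u.fn n fun i => (φ i).eval M v
  | _, .sup s φ, v => ⨆ a : M.carrier s, φ.eval M (Tuple.cons a v)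
  | _, .inf s φ, v => ⨅ a : M.carrier s, φ.eval M (Tuple.cons a v)

/-- The value `σ^M` of a sentence. -/
def Sentence.value {u : Connectives} (M : Prestructure.{w} L) (σ : Sentence L u) : ℝ :=
  Formula.eval M σ fun i => i.elim0

/-- `M ⊨ T`: every sentence of `T` has value `0` in `M`. -/
def Prestructure.Models {u : Connectives} (M : Prestructure.{w} L) (T : Set (Sentence L u)) :
    Prop :=
  ∀ σ ∈ T, Sentence.value M σ = 0

/-- The full (restricted) theory of `M`, as a set of sentences. -/
def Prestructure.theory (M : Prestructure.{w} L) (u : Connectives) : Set (Sentence L u) :=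
  {σ | Sentence.value M σ = 0}

/-! ### Effective enumerability -/

/-- Coding of terms by natural numbers. -/
def Term.code {Γ : List L.Sorts} : {s : L.Sorts} → Term L Γ s → ℕ
  | _, .var i => Nat.pair 0 i
  | _, .app f ts => Nat.pair 1 (Nat.pair (L.fnCode f)
      (Encodable.encode (List.ofFn fun i => (ts i).code)))

/-- Coding of restricted formulas by natural numbers. -/
def Formula.code {u : Connectives} : {Γ : List L.Sorts} → Formula L u Γ → ℕ
  | _, .rel R ts => Nat.pair 0 (Nat.pair (L.relCode R)
      (Encodable.encode (List.ofFn fun i => (ts i).code)))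
  | _, .dist t₁ t₂ => Nat.pair 1 (Nat.pair t₁.code t₂.code)
  | _, .conn n φ => Nat.pair 2 (Nat.pair n (Encodable.encode (List.ofFn fun i => (φ i).code)))
  | _, .sup s φ => Nat.pair 3 (Nat.pair (L.sortCode s) φ.code)
  | _, .inf s φ => Nat.pair 4 (Nat.pair (L.sortCode s) φ.code)

theorem Term.code_injective {Γ : List L.Sorts} {s s' : L.Sorts} (t : Term L Γ s)
    (t' : Term L Γ s') (h : t.code = t'.code) : s = s' ∧ HEq t t' := by
  induction t generalizing s' with
  | var i =>
    cases t' with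
    | var j =>
      simp only [Term.code, Nat.pair_eq_pair, true_and] at h
      obtain rfl := Fin.ext h
      exact ⟨rfl, HEq.rfl⟩
    | app f ts => simp [Term.code, Nat.pair_eq_pair] at h
  | app f ts ih =>
    cases t' with
    | var j => simp [Term.code, Nat.pair_eq_pair] at h
    | app g ts' =>
      simp only [Term.code, Nat.pair_eq_pair, true_and] at h
      obtain rfl := L.fnCode_injective h.1
      have h2 := List.ofFn_injective (Encodable.encode_injective h.2)
      have : ts = ts' := funext fun i => eq_of_heq (ih i (ts' i) (congrFun h2 i)).2
      subst this
      exact ⟨rfl, HEq.rfl⟩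

theorem Formula.code_injective {u : Connectives} {Γ : List L.Sorts} :
    Function.Injective (Formula.code : Formula L u Γ → ℕ) := by
  intro φ
  induction φ with
  | rel R ts =>
    rintro (⟨R', ts'⟩ | ⟨t₁, t₂⟩ | ⟨n, ψ⟩ | ⟨s, ψ⟩ | ⟨s, ψ⟩) h <;>
      simp only [Formula.code, Nat.pair_eq_pair, true_and] at h <;> try omega
    obtain rfl := L.relCode_injective h.1
    have h2 := List.ofFn_injective (Encodable.encode_injective h.2)
    have : ts = ts' := funext fun i => eq_of_heq (Term.code_injective _ _ (congrFun h2 i)).2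
    rw [this]
  | dist t₁ t₂ =>
    rintro (⟨R', ts'⟩ | ⟨t₁', t₂'⟩ | ⟨n, ψ⟩ | ⟨s, ψ⟩ | ⟨s, ψ⟩) h <;>
      simp only [Formula.code, Nat.pair_eq_pair, true_and] at h <;> try omega
    obtain ⟨rfl, h1⟩ := Term.code_injective _ _ h.1
    rw [eq_of_heq h1, eq_of_heq (Term.code_injective _ _ h.2).2]
  | conn n φ ih =>
    rintro (⟨R', ts'⟩ | ⟨t₁', t₂'⟩ | ⟨n', ψ⟩ | ⟨s, ψ⟩ | ⟨s, ψ⟩) h <;>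
      simp only [Formula.code, Nat.pair_eq_pair, true_and] at h <;> try omega
    obtain ⟨rfl, h2⟩ := h
    have h2 := List.ofFn_injective (Encodable.encode_injective h2)
    rw [show φ = ψ from funext fun i => ih i (congrFun h2 i)]
  | sup s φ ih =>
    rintro (⟨R', ts'⟩ | ⟨t₁', t₂'⟩ | ⟨n', ψ⟩ | ⟨s', ψ⟩ | ⟨s', ψ⟩) h <;>
      simp only [Formula.code, Nat.pair_eq_pair, true_and] at h <;> try omega
    obtain rfl := L.sortCode_injective h.1
    rw [ih h.2]
  | inf s φ ih =>
    rintro (⟨R', ts'⟩ | ⟨t₁', t₂'⟩ | ⟨n', ψ⟩ | ⟨s', ψ⟩ | ⟨s', ψ⟩) h <;>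
      simp only [Formula.code, Nat.pair_eq_pair, true_and] at h <;> try omega
    obtain rfl := L.sortCode_injective h.1
    rw [ih h.2]

/-- A set of restricted sentences is effectively enumerable: the set of codes of its elements is
recursively enumerable. -/
def EffectivelyEnumerable {u : Connectives} (T : Set (Sentence L u)) : Prop :=
  REPred fun n : ℕ => ∃ σ ∈ T, Formula.code σ = n

/-- The embedding problem of `M` has a positive solution: there is an effectively enumerable subset
`T` of the full theory of `M` such that every `L`-structure modelling `T` embeds into an ultrapower
of `M`. -/
def EmbeddingProblem (u : Connectives) (M : Prestructure.{w} L) : Prop :=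
  ∃ T : Set (Sentence L u), EffectivelyEnumerable T ∧ T ⊆ M.theory u ∧
    ∀ N : Structure.{w} L, N.toPrestructure.Models T → EmbedsInUltrapower N.toPrestructure M

end General

/-! ### Tracial von Neumann algebras -/

section Tracial

open scoped ComplexOrder

/-- A tracial von Neumann algebra: a von Neumann algebra (acting on some Hilbert space) together
with a faithful normal tracial state. -/
structure TracialVonNeumannAlgebra where
  H : Type w
  [normedAddCommGroup : NormedAddCommGroup H]
  [innerProductSpace : InnerProductSpace ℂ H]
  [completeSpace : CompleteSpace H]
  alg : VonNeumannAlgebra H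
  trace : alg.toStarSubalgebra →ₗ[ℂ] ℂ
  trace_nonneg : ∀ x : alg.toStarSubalgebra, 0 ≤ (x : H →L[ℂ] H) → 0 ≤ trace x
  trace_one : trace 1 = 1
  trace_mul_comm : ∀ x y, trace (x * y) = trace (y * x)
  faithful : ∀ x, trace (star x * x) = 0 → x = 0
  /-- normality: the trace preserves suprema of bounded increasing nets of positive elements -/
  normal : ∀ (D : Set alg.toStarSubalgebra) (x : alg.toStarSubalgebra), D.Nonempty →
    DirectedOn (· ≤ ·) D → (∀ y ∈ D, 0 ≤ y) → IsLUB D x →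
    IsLUB ((fun y => (trace y).re) '' D) (trace x).re

namespace TracialVonNeumannAlgebra

attribute [instance] normedAddCommGroup innerProductSpace completeSpace

variable (A : TracialVonNeumannAlgebra.{w})

/-- The underlying algebra. -/
abbrev Elem : Type w := A.alg.toStarSubalgebra

/-- The norm `‖x‖₂ = τ(x* x)^{1/2}`. -/
def norm₂ (x : A.Elem) : ℝ := √(A.trace (star x * x)).re

theorem trace_star_mul_self_nonneg (x : A.Elem) : 0 ≤ A.trace (star x * x) :=
  A.trace_nonneg _ (star_mul_self_nonneg (x : A.H →L[ℂ] A.H))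

theorem trace_isSelfAdjoint {x : A.Elem} (hx : IsSelfAdjoint x) : (A.trace x).im = 0 := by
  have h1 := (Complex.nonneg_iff.1 (A.trace_star_mul_self_nonneg (x + 1))).2
  have h2 := (Complex.nonneg_iff.1 (A.trace_star_mul_self_nonneg x)).2
  have h3 : star (x + 1) * (x + 1) = star x * x + (x + x) + 1 := by
    rw [star_add, hx.star_eq, star_one]; noncomm_ring
  rw [h3] at h1
  simp only [map_add, A.trace_one, Complex.add_im, Complex.one_im] at h1
  linarith

theorem trace_star (x : A.Elem) : A.trace (star x) = star (A.trace x) := by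
  have h1 := A.trace_isSelfAdjoint (IsSelfAdjoint.add_star_self x)
  have h2 := A.trace_isSelfAdjoint (x := Complex.I • (x - star x)) (by
    rw [isSelfAdjoint_iff, star_smul, star_sub, star_star, Complex.star_def, Complex.conj_I,
      neg_smul, ← smul_neg, neg_sub])
  simp only [map_add, map_smul, map_sub, smul_eq_mul, Complex.add_im, Complex.mul_im,
    Complex.sub_re, Complex.sub_im, Complex.I_re, Complex.I_im] at h1 h2
  apply Complex.ext <;> simp <;> linarith

/-- The inner product `⟨x, y⟩ = τ(x* y)`. -/
abbrev core : InnerProductSpace.Core ℂ A.Elem where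
  inner x y := A.trace (star x * y)
  conj_inner_symm x y := by
    change star (A.trace (star y * x)) = _
    rw [← A.trace_star, star_mul, star_star]
  re_inner_nonneg x := (Complex.nonneg_iff.1 (A.trace_star_mul_self_nonneg x)).1
  add_left x y z := by simp [add_mul]
  smul_left x y r := by simp [star_smul]
  definite x h := A.faithful x h

theorem norm₂_sub_comm (x y : A.Elem) : A.norm₂ (x - y) = A.norm₂ (y - x) := by
  rw [norm₂, norm₂, ← neg_sub y x, star_neg, neg_mul_neg]

theorem norm₂_add_le (x y : A.Elem) : A.norm₂ (x + y) ≤ A.norm₂ x + A.norm₂ y :=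
  @norm_add_le A.Elem (@InnerProductSpace.Core.toNormedAddCommGroup ℂ A.Elem _ _ _
    A.core).toSeminormedAddCommGroup.toSeminormedAddGroup x y

theorem norm_trace_star_mul_le (x y : A.Elem) :
    ‖A.trace (star x * y)‖ ≤ A.norm₂ x * A.norm₂ y :=
  @InnerProductSpace.Core.norm_inner_le_norm ℂ A.Elem _ _ _ A.core.toCore x y

theorem norm₂_zero : A.norm₂ 0 = 0 := by simp [norm₂]

theorem norm₂_one : A.norm₂ 1 = 1 := by simp [norm₂, A.trace_one]

theorem norm₂_nonneg (x : A.Elem) : 0 ≤ A.norm₂ x := Real.sqrt_nonneg _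

theorem eq_zero_of_norm₂ {x : A.Elem} (h : A.norm₂ x = 0) : x = 0 := by
  obtain ⟨h1, h2⟩ := Complex.nonneg_iff.1 (A.trace_star_mul_self_nonneg x)
  refine A.faithful x (Complex.ext ?_ h2.symm)
  exact (Real.sqrt_eq_zero h1).1 h

theorem norm₂_star (x : A.Elem) : A.norm₂ (star x) = A.norm₂ x := by
  rw [norm₂, norm₂, star_star, A.trace_mul_comm]

theorem norm₂_mul_le (x y : A.Elem) : A.norm₂ (x * y) ≤ ‖x‖ * A.norm₂ y := by
  have h : star (x * y : A.H →L[ℂ] A.H) * (x * y) ≤ ((‖x‖ ^ 2 : ℝ) : ℂ) • (star (y : A.H →L[ℂ] A.H) * y) := by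
    have h1 : star (x : A.H →L[ℂ] A.H) * x ≤ ((‖x‖ ^ 2 : ℝ) : ℂ) • 1 := by
      rw [Complex.coe_smul, ← Algebra.algebraMap_eq_smul_one]
      exact CStarAlgebra.star_mul_le_algebraMap_norm_sq
    have h2 := star_left_conjugate_le_conjugate h1 (y : A.H →L[ℂ] A.H)
    simpa [mul_assoc] using h2
  have h' := A.trace_nonneg (((‖x‖ ^ 2 : ℝ) : ℂ) • (star y * y) - star (x * y) * (x * y))
    (sub_nonneg.2 h)
  rw [map_sub, map_smul, sub_nonneg] at h'
  have h'' := (Complex.le_def.1 h').1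
  rw [smul_eq_mul, Complex.re_ofReal_mul] at h''
  refine (Real.sqrt_le_sqrt h'').trans_eq ?_
  rw [Real.sqrt_mul (by positivity), Real.sqrt_sq (norm_nonneg _), norm₂]

theorem norm₂_mul_le' (x y : A.Elem) : A.norm₂ (x * y) ≤ A.norm₂ x * ‖y‖ := by
  rw [← norm₂_star, star_mul]
  refine (A.norm₂_mul_le _ _).trans_eq ?_
  rw [norm₂_star, norm_star, mul_comm]

theorem norm₂_le_norm (x : A.Elem) : A.norm₂ x ≤ ‖x‖ := by
  simpa [norm₂_one] using A.norm₂_mul_le x 1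

theorem norm_trace_le (x : A.Elem) : ‖A.trace x‖ ≤ A.norm₂ x := by
  simpa [norm₂_one] using A.norm_trace_star_mul_le 1 x

/-- The operator-norm ball of radius `n`. -/
@[ext]
structure Ball (n : ℕ) where
  val : A.Elem
  norm_le : ‖val‖ ≤ n

/-- Operator-norm balls carry the metric `‖x - y‖₂`. -/
instance instMetricSpaceBall (n : ℕ) : MetricSpace (A.Ball n) where
  dist x y := A.norm₂ (x.val - y.val)
  dist_self x := by simp [norm₂_zero]
  dist_comm x y := A.norm₂_sub_comm _ _
  dist_triangle x y z := by simpa using A.norm₂_add_le (x.val - y.val) (y.val - z.val)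
  eq_of_dist_eq_zero h := Ball.ext (sub_eq_zero.1 (A.eq_zero_of_norm₂ h))

theorem Ball.dist_def {n : ℕ} (x y : A.Ball n) : dist x y = A.norm₂ (x.val - y.val) := rfl

end TracialVonNeumannAlgebra

end Tracial

/-! ### The language of tracial von Neumann algebras -/

/-- Function symbols of the language of tracial von Neumann algebras; the sort `n` stands for the
operator-norm ball of radius `n`. -/
inductive TracialFn
  | zero
  | one
  | incl (m n : ℕ) (h : m ≤ n)
  | add (m n : ℕ)
  | mul (m n : ℕ)
  | star (n : ℕ)
  /-- multiplication by `a + b i`, from the ball of radius `m` to the ball of radius `n` -/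
  | smul (a b : ℚ) (m n : ℕ) (h : (a ^ 2 + b ^ 2) * (m : ℚ) ^ 2 ≤ (n : ℚ) ^ 2)

/-- Predicate symbols: the real and imaginary parts of the trace on the ball of radius `n`. -/
inductive TracialRel
  | trRe (n : ℕ)
  | trIm (n : ℕ)

namespace TracialFn

abbrev dom : TracialFn → List ℕ
  | zero => []
  | one => []
  | incl m _ _ => [m]
  | add m n => [m, n]
  | mul m n => [m, n]
  | star n => [n]
  | smul _ _ m _ _ => [m]

abbrev cod : TracialFn → ℕ
  | zero => 1
  | one => 1
  | incl _ n _ => n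
  | add m n => m + n
  | mul m n => m * n
  | star n => n
  | smul _ _ _ n _ => n

/-- The modulus of uniform continuity: `d(xᵢ, yᵢ) < mod f ε` for all `i` implies
`d(f x, f y) ≤ ε`. -/
def mod : TracialFn → ℝ → ℝ
  | zero, ε => ε
  | one, ε => ε
  | incl _ _ _, ε => ε
  | add _ _, ε => ε / 2
  | mul m n, ε => ε / (m + n + 1)
  | star _, ε => ε
  | smul a b _ _ _, ε => ε / (|(a : ℝ)| + |(b : ℝ)| + 1)

def code : TracialFn → ℕ
  | zero => Nat.pair 0 0
  | one => Nat.pair 1 0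
  | incl m n _ => Nat.pair 2 (Nat.pair m n)
  | add m n => Nat.pair 3 (Nat.pair m n)
  | mul m n => Nat.pair 4 (Nat.pair m n)
  | star n => Nat.pair 5 n
  | smul a b m n _ => Nat.pair 6 (Nat.pair (Nat.pair (Encodable.encode a.num) a.den)
      (Nat.pair (Nat.pair (Encodable.encode b.num) b.den) (Nat.pair m n)))

theorem code_injective : Function.Injective code := by
  intro f g h
  cases f <;> cases g <;> simp [code, Nat.pair_eq_pair] at h ⊢
  all_goals try exact h
  obtain ⟨⟨h1, h2⟩, ⟨h3, h4⟩, h5, h6⟩ := h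
  exact ⟨Rat.ext h1 h2, Rat.ext h3 h4, h5, h6⟩

end TracialFn

namespace TracialRel

/-- The sort on which a predicate symbol lives. -/
abbrev radius : TracialRel → ℕ
  | trRe n => n
  | trIm n => n

def code : TracialRel → ℕ
  | trRe n => Nat.pair 0 n
  | trIm n => Nat.pair 1 n

theorem code_injective : Function.Injective code := by
  intro f g h
  cases f <;> cases g <;> simp [code, Nat.pair_eq_pair] at h ⊢
  all_goals exact h

end TracialRel

/-- The language of tracial von Neumann algebras, with scalars from `ℚ(i)`. -/
def tracialLanguage : Language where
  Sorts := ℕ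
  Fn := TracialFn
  Rel := TracialRel
  diam n := 2 * n
  fnDom := TracialFn.dom
  fnCod := TracialFn.cod
  fnMod := TracialFn.mod
  fnMod_pos f ε hε := by cases f <;> simp only [TracialFn.mod] <;> positivity
  relDom R := [R.radius]
  relMod _ ε := ε
  relMod_pos _ _ hε := hε
  relBound R := R.radius
  sortCode := id
  sortCode_injective := Function.injective_id
  fnCode := TracialFn.code
  fnCode_injective := TracialFn.code_injective
  relCode := TracialRel.code
  relCode_injective := TracialRel.code_injective

namespace TracialVonNeumannAlgebra

variable (A : TracialVonNeumannAlgebra.{w})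

theorem norm_ratComplex_smul_le {a b : ℚ} {m n : ℕ}
    (h : (a ^ 2 + b ^ 2) * (m : ℚ) ^ 2 ≤ (n : ℚ) ^ 2) (x : A.Ball m) :
    ‖(⟨a, b⟩ : ℂ) • x.val‖ ≤ n := by
  have h' : ((a : ℝ) ^ 2 + (b : ℝ) ^ 2) * (m : ℝ) ^ 2 ≤ (n : ℝ) ^ 2 := by exact_mod_cast h
  have hc : ‖(⟨a, b⟩ : ℂ)‖ ^ 2 = (a : ℝ) ^ 2 + (b : ℝ) ^ 2 := by
    rw [Complex.sq_norm, Complex.normSq_mk]; ring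
  rw [norm_smul]
  refine (mul_le_mul_of_nonneg_left x.norm_le (norm_nonneg _)).trans ?_
  refine abs_le_of_sq_le_sq' ?_ (Nat.cast_nonneg n) |>.2
  rw [mul_pow, hc]
  exact h'

theorem norm_one_le' : ‖(1 : A.Elem)‖ ≤ 1 :=
  ContinuousLinearMap.norm_id_le

theorem norm₂_smul (c : ℂ) (x : A.Elem) : A.norm₂ (c • x) = ‖c‖ * A.norm₂ x := by
  have h : star (c • x) * (c • x) = ((‖c‖ ^ 2 : ℝ) : ℂ) • (star x * x) := by
    rw [star_smul, smul_mul_smul_comm, Complex.star_def, Complex.conj_mul']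
    push_cast
    rfl
  rw [norm₂, h, map_smul, smul_eq_mul, Complex.re_ofReal_mul, Real.sqrt_mul (by positivity),
    Real.sqrt_sq (norm_nonneg _), norm₂]

namespace Ball

variable {A} {m n : ℕ}

/-- Inclusion of balls. -/
def incl (h : m ≤ n) (x : A.Ball m) : A.Ball n := ⟨x.val, x.norm_le.trans (Nat.cast_le.2 h)⟩

/-- Addition. -/
def add (x : A.Ball m) (y : A.Ball n) : A.Ball (m + n) :=
  ⟨x.val + y.val, (norm_add_le _ _).trans <| by
    simpa using add_le_add x.norm_le y.norm_le⟩

/-- Multiplication. -/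
def mul (x : A.Ball m) (y : A.Ball n) : A.Ball (m * n) :=
  ⟨x.val * y.val, (norm_mul_le _ _).trans <| by
    simpa using mul_le_mul x.norm_le y.norm_le (norm_nonneg _) (Nat.cast_nonneg _)⟩

/-- The adjoint. -/
def adj (x : A.Ball n) : A.Ball n := ⟨star x.val, by rw [norm_star]; exact x.norm_le⟩

/-- Multiplication by the scalar `a + b i`. -/
def smul {a b : ℚ} (h : (a ^ 2 + b ^ 2) * (m : ℚ) ^ 2 ≤ (n : ℚ) ^ 2) (x : A.Ball m) : A.Ball n :=
  ⟨(⟨a, b⟩ : ℂ) • x.val, A.norm_ratComplex_smul_le h x⟩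

theorem dist_add_le (x x' : A.Ball m) (y y' : A.Ball n) :
    dist (x.add y) (x'.add y') ≤ dist x x' + dist y y' := by
  simp only [dist_def, add]
  rw [add_sub_add_comm]
  exact A.norm₂_add_le _ _

theorem dist_mul_le (x x' : A.Ball m) (y y' : A.Ball n) :
    dist (x.mul y) (x'.mul y') ≤ m * dist y y' + dist x x' * n := by
  simp only [dist_def, mul]
  have e : x.val * y.val - x'.val * y'.val
      = x.val * (y.val - y'.val) + (x.val - x'.val) * y'.val := by noncomm_ring
  rw [e]
  exact (A.norm₂_add_le _ _).trans <| add_le_add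
    ((A.norm₂_mul_le _ _).trans (mul_le_mul_of_nonneg_right x.norm_le (A.norm₂_nonneg _)))
    ((A.norm₂_mul_le' _ _).trans (mul_le_mul_of_nonneg_left y'.norm_le (A.norm₂_nonneg _)))

theorem dist_adj (x y : A.Ball n) : dist x.adj y.adj = dist x y := by
  simp only [dist_def, adj]
  rw [← star_sub, norm₂_star]

theorem dist_smul {a b : ℚ} (h : (a ^ 2 + b ^ 2) * (m : ℚ) ^ 2 ≤ (n : ℚ) ^ 2) (x y : A.Ball m) :
    dist (x.smul h) (y.smul h) = ‖(⟨a, b⟩ : ℂ)‖ * dist x y := by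
  simp only [dist_def, smul]
  rw [← smul_sub, norm₂_smul]

end Ball

/-- Interpretation of the function symbols in a tracial von Neumann algebra. -/
def fnMap : ∀ f : TracialFn, Tuple A.Ball f.dom → A.Ball f.cod
  | .zero, _ => ⟨0, by simp⟩
  | .one, _ => ⟨1, by simpa using A.norm_one_le'⟩
  | .incl _ _ h, x => Ball.incl h (x (0 : Fin 1))
  | .add m n, x => Ball.add (m := m) (n := n) (x (0 : Fin 2)) (x (1 : Fin 2))
  | .mul m n, x => Ball.mul (m := m) (n := n) (x (0 : Fin 2)) (x (1 : Fin 2))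
  | .star n, x => Ball.adj (n := n) (x (0 : Fin 1))
  | .smul _ _ _ _ h, x => Ball.smul h (x (0 : Fin 1))

/-- Interpretation of the predicate symbols in a tracial von Neumann algebra. -/
def relMap : ∀ R : TracialRel, Tuple A.Ball [R.radius] → ℝ
  | .trRe _, x => (A.trace (x (0 : Fin 1)).val).re
  | .trIm _, x => (A.trace (x (0 : Fin 1)).val).im

theorem fn_mod : ∀ (f : TracialFn) (ε : ℝ), 0 < ε → ∀ x y : Tuple A.Ball f.dom,
    (∀ i, dist (x i) (y i) < f.mod ε) → dist (A.fnMap f x) (A.fnMap f y) ≤ ε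
  | .zero, ε, hε, _, _, _ => by simpa [fnMap] using hε.le
  | .one, ε, hε, _, _, _ => by simpa [fnMap] using hε.le
  | .incl _ _ _, _, _, _, _, h => (h (0 : Fin 1)).le
  | .add m n, ε, _, x, y, h => by
    have h0 := h (0 : Fin 2)
    have h1 := h (1 : Fin 2)
    refine (Ball.dist_add_le (m := m) (n := n) (x (0 : Fin 2)) (y (0 : Fin 2))
      (x (1 : Fin 2)) (y (1 : Fin 2))).trans ?_
    exact (add_le_add h0.le h1.le).trans_eq (add_halves ε)
  | .mul m n, ε, hε, x, y, h => by
    have h0 := h (0 : Fin 2)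
    have h1 := h (1 : Fin 2)
    refine (Ball.dist_mul_le (m := m) (n := n) (x (0 : Fin 2)) (y (0 : Fin 2))
      (x (1 : Fin 2)) (y (1 : Fin 2))).trans ?_
    refine (add_le_add (mul_le_mul_of_nonneg_left h1.le (Nat.cast_nonneg m))
      (mul_le_mul_of_nonneg_right h0.le (Nat.cast_nonneg n))).trans ?_
    have : (m : ℝ) * (ε / (m + n + 1)) + ε / (m + n + 1) * n = ε * ((m + n) / (m + n + 1)) := by
      ring
    refine this.trans_le (mul_le_of_le_one_right hε.le ?_)
    rw [div_le_one (by positivity)]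
    linarith
  | .star n, _, _, x, y, h =>
    (Ball.dist_adj (n := n) (x (0 : Fin 1)) (y (0 : Fin 1))).trans_le (h (0 : Fin 1)).le
  | .smul p q m n hpq, ε, hε, x, y, h => by
    refine (Ball.dist_smul (n := n) hpq (x (0 : Fin 1)) (y (0 : Fin 1))).trans_le ?_
    have hc : ‖(⟨p, q⟩ : ℂ)‖ ≤ |(p : ℝ)| + |(q : ℝ)| + 1 :=
      (Complex.norm_le_abs_re_add_abs_im ⟨p, q⟩).trans (le_add_of_nonneg_right zero_le_one)
    refine (mul_le_mul hc (h (0 : Fin 1)).le dist_nonneg (by positivity)).trans_eq ?_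
    exact mul_div_cancel₀ ε (by positivity)

theorem rel_bound : ∀ (R : TracialRel) (x : Tuple A.Ball [R.radius]), |A.relMap R x| ≤ R.radius
  | .trRe _, x => (Complex.abs_re_le_norm _).trans <| (A.norm_trace_le _).trans <|
      (A.norm₂_le_norm _).trans (x (0 : Fin 1)).norm_le
  | .trIm _, x => (Complex.abs_im_le_norm _).trans <| (A.norm_trace_le _).trans <|
      (A.norm₂_le_norm _).trans (x (0 : Fin 1)).norm_le

theorem rel_mod (R : TracialRel) (ε : ℝ) (x y : Tuple A.Ball [R.radius])
    (h : ∀ i, dist (x i) (y i) < ε) : |A.relMap R x - A.relMap R y| ≤ ε := by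
  have h0 := (A.norm_trace_le _).trans (h (0 : Fin 1)).le
  rw [map_sub] at h0
  cases R with
  | trRe n => exact (Complex.abs_re_le_norm _).trans h0
  | trIm n => exact (Complex.abs_im_le_norm _).trans h0

/-- A tracial von Neumann algebra as a structure in the language of tracial von Neumann algebras:
the sort `n` is the operator-norm ball of radius `n` with the metric `‖x - y‖₂`. -/
def toPrestructure : Prestructure.{w} tracialLanguage where
  carrier n := A.Ball n
  metric n := A.instMetricSpaceBall n
  nonempty n := ⟨⟨0, by simpa using Nat.cast_nonneg (α := ℝ) n⟩⟩
  dist_le n x y := by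
    refine (A.norm₂_le_norm _).trans ((norm_sub_le _ _).trans ?_)
    have := add_le_add x.norm_le y.norm_le
    exact this.trans_eq (two_mul _).symm
  fnMap := A.fnMap
  fn_mod := A.fn_mod
  relMap := A.relMap
  rel_bound := A.rel_bound
  rel_mod R ε _ x y h := A.rel_mod R ε x y h

/-- `S` is locally universal: every tracial von Neumann algebra embeds into an ultrapower
of `S`. -/
def IsLocallyUniversal (S : TracialVonNeumannAlgebra.{w}) : Prop :=
  ∀ A : TracialVonNeumannAlgebra.{w}, EmbedsInUltrapower A.toPrestructure S.toPrestructure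

end TracialVonNeumannAlgebra

end ContLogic

end

/-! The theory `T` need not axiomatize tracial von Neumann algebras. It is enough that every model
of `T` embeds in one of them: local universality of `S` then embeds that algebra in an ultrapower of
`S`, and embeddings compose. So `T` can consist of universal conditions, namely identities and
inequalities between traces of terms, that hold in every tracial von Neumann algebra (hence in `S`)
and suffice for a GNS construction. Each condition has the form "`F ∸ G` vanishes identically",
expressed by suprema over the variables. The conditions fall into finitely many families whose codes
are primitive recursive in the sorts and scalars involved, so `T` is effectively enumerable.

Algebraic laws are imposed only under the trace, as `τ(w* t) = τ(w* t')` for all `w`; the GNS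
representation turns them into equalities of operators. For a model `N`, all sorts together form a
set `X` with kernel `K x y = τ(x* y)`. The main point is that `K` is positive semidefinite although
only `0 ≤ K x x` is assumed. Since the columns of `K` are closed under addition and multiplication
by `i`, every Gaussian-integer combination of columns is again a column, and general coefficients
follow by rounding and a limit (`kernelForm_self_nonneg`). The same criterion, applied to `r² K x y
- K (a x) (a y)`, bounds multiplication operators by the radius `r` of the sort of `a`.

The von Neumann algebra is the commutant of the right multiplications, and its state is the vector
state of the vacuum `Ω`. It is faithful because `Ω` is separating (`apply_vec`), tracial by a
symmetric bilinear form that replaces the modular conjugation (`inner_star_vac_comm`), and normal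
because suprema of bounded directed sets of positive operators stay in a commutant
(`exists_directed_sup`). -/

noncomputable section

namespace ContLogic

/-! ### Hilbert spaces from positive kernels -/

section Kernel

open ComplexConjugate

variable {X : Type w}

/-- The sesquilinear form on finitely supported functions given by a kernel. -/
def kernelForm (K : X → X → ℂ) (f g : X →₀ ℂ) : ℂ :=
  f.sum fun x a => g.sum fun y b => conj a * b * K x y

/-- The form depends on `f` only through the combination of columns it defines, so `f` may be
exchanged for the point mass at `z`, once in each argument. This needs hermitian symmetry but no
positivity. -/
theorem kernelForm_self_of_linearCombination {K : X → X → ℂ} (herm : ∀ x y, K y x = conj (K x y))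
    {f : X →₀ ℂ} {z : X} (h : f.sum (fun x a => a • fun y => K y x) = fun y => K y z) :
    kernelForm K f f = K z z := by
  have h' : ∀ y, f.sum (fun x a => a * K y x) = K y z := fun y => by
    have := congrFun h y
    rw [Finsupp.sum, Finset.sum_apply] at this
    exact this
  have h1 : kernelForm K f f = f.sum fun x a => conj a * K x z := by
    refine Finsupp.sum_congr fun x _ => ?_
    rw [← h' x, Finsupp.mul_sum]
    exact Finsupp.sum_congr fun y _ => mul_assoc _ _ _
  rw [h1, herm z z, ← h' z, map_finsuppSum]
  refine Finsupp.sum_congr fun x _ => ?_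
  rw [map_mul, ← herm]

/-- The integer part of `n z`, coordinatewise. -/
def gaussFloor (n : ℕ) (z : ℂ) : ℂ := (⌊n * z.re⌋ : ℂ) + (⌊n * z.im⌋ : ℂ) * Complex.I

/-- Addition and multiplication by `i` give only Gaussian-integer coefficients; after division by
`n` these approximate arbitrary complex ones. -/
theorem tendsto_gaussFloor_div (z : ℂ) :
    Tendsto (fun n : ℕ => gaussFloor n z / n) atTop (𝓝 z) := by
  have key : ∀ r : ℝ, Tendsto (fun n : ℕ => (⌊n * r⌋ : ℝ) / n) atTop (𝓝 r) := by
    intro r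
    have h0 : Tendsto (fun n : ℕ => r - 1 / (n : ℝ)) atTop (𝓝 r) := by
      simpa using tendsto_const_nhds.sub (tendsto_const_div_atTop_nhds_zero_nat (1 : ℝ))
    refine tendsto_of_tendsto_of_tendsto_of_le_of_le' h0 tendsto_const_nhds ?_ ?_
    · filter_upwards [eventually_gt_atTop 0] with n hn
      have hn : (0 : ℝ) < n := Nat.cast_pos.2 hn
      rw [le_div_iff₀ hn, sub_mul, one_div_mul_cancel hn.ne']
      linarith [Int.lt_floor_add_one (n * r)]
    · filter_upwards [eventually_gt_atTop 0] with n hn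
      have hn : (0 : ℝ) < n := Nat.cast_pos.2 hn
      rw [div_le_iff₀ hn]
      linarith [Int.floor_le (n * r)]
  have h1 := (Complex.continuous_ofReal.tendsto _).comp (key z.re)
  have h2 := (Complex.continuous_ofReal.tendsto _).comp (key z.im)
  have h3 := h1.add (h2.mul_const Complex.I)
  rw [Complex.re_add_im] at h3
  refine h3.congr fun n => ?_
  simp only [Function.comp, gaussFloor]
  push_cast
  ring

theorem gaussFloor_zero (n : ℕ) : gaussFloor n 0 = 0 := by simp [gaussFloor]

/-- A hermitian kernel that is nonnegative on the diagonal is positive semidefinite if the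
functions `K · z` are closed under addition and multiplication by `i`. -/
theorem kernelForm_self_nonneg {K : X → X → ℂ} (herm : ∀ x y, K y x = conj (K x y))
    (hadd : ∀ x x', ∃ z, ∀ y, K y z = K y x + K y x')
    (hI : ∀ x, ∃ z, ∀ y, K y z = Complex.I * K y x) (hpos : ∀ x, 0 ≤ (K x x).re) (f : X →₀ ℂ) :
    0 ≤ (kernelForm K f f).re := by
  rcases isEmpty_or_nonempty X with hX | ⟨⟨x₀⟩⟩
  · rw [Subsingleton.elim f 0]; simp [kernelForm]
  -- Negatives come from `i² = -1`, applying `hI` twice.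
  have hneg : ∀ x, ∃ z, ∀ y, K y z = - K y x := fun x => by
    obtain ⟨z, hz⟩ := hI x
    obtain ⟨z', hz'⟩ := hI z
    exact ⟨z', fun y => by rw [hz', hz, ← mul_assoc, Complex.I_mul_I, neg_one_mul]⟩
  -- The columns form an additive group, so Gaussian-integer combinations of columns are columns.
  let R : AddSubgroup (X → ℂ) :=
    { carrier := Set.range fun z y => K y z
      add_mem' := by
        rintro _ _ ⟨x, rfl⟩ ⟨x', rfl⟩
        obtain ⟨z, hz⟩ := hadd x x'
        exact ⟨z, funext hz⟩
      zero_mem' := by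
        obtain ⟨z, hz⟩ := hneg x₀
        obtain ⟨z', hz'⟩ := hadd x₀ z
        exact ⟨z', funext fun y => (hz' y).trans (by rw [hz]; exact add_neg_cancel _)⟩
      neg_mem' := by
        rintro _ ⟨x, rfl⟩
        obtain ⟨z, hz⟩ := hneg x
        exact ⟨z, funext hz⟩ }
  have hR : ∀ (n : ℕ) (c : ℂ) (x : X), (gaussFloor n c • fun y => K y x) ∈ R := fun n c x => by
    obtain ⟨z, hz⟩ := hI x
    have h1 : (fun y => K y x) ∈ R := ⟨x, rfl⟩
    have h2 : (fun y => K y z) ∈ R := ⟨z, rfl⟩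
    convert R.add_mem (R.zsmul_mem h1 ⌊n * c.re⌋) (R.zsmul_mem h2 ⌊n * c.im⌋) using 1
    funext y
    rw [Pi.smul_apply, Pi.add_apply, Pi.smul_apply, Pi.smul_apply, smul_eq_mul, zsmul_eq_mul,
      zsmul_eq_mul, hz, gaussFloor]
    ring
  -- After rounding, the value of the form is a single diagonal entry `K z z`.
  have hn : ∀ n : ℕ, 0 ≤ (∑ x ∈ f.support, ∑ y ∈ f.support,
      conj (gaussFloor n (f x)) * gaussFloor n (f y) * K x y).re := fun n => by
    let g := f.mapRange (gaussFloor n) (gaussFloor_zero n)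
    have hg : ∀ h : X → ℂ → ℂ, (∀ x, h x 0 = 0) →
        g.sum h = ∑ x ∈ f.support, h x (gaussFloor n (f x)) := fun h h0 =>
      Finsupp.sum_mapRange_index h0
    have hmem : g.sum (fun x a => a • fun y => K y x) ∈ R := by
      have : g.sum (fun x a => a • fun y => K y x)
          = ∑ x ∈ f.support, gaussFloor n (f x) • fun y => K y x :=
        Finsupp.sum_mapRange_index fun x => zero_smul ℂ _
      rw [this]
      exact R.sum_mem fun x _ => hR n _ x
    obtain ⟨z, hz⟩ := hmem
    have := kernelForm_self_of_linearCombination herm hz.symm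
    have e : kernelForm K g g = ∑ x ∈ f.support, ∑ y ∈ f.support,
        conj (gaussFloor n (f x)) * gaussFloor n (f y) * K x y := by
      refine (hg _ fun x => by simp).trans (Finset.sum_congr rfl fun x _ => hg _ fun y => by simp)
    rw [← e, this]
    exact hpos z
  have hlim : Tendsto (fun n : ℕ => (∑ x ∈ f.support, ∑ y ∈ f.support,
      conj (gaussFloor n (f x) / n) * (gaussFloor n (f y) / n) * K x y).re) atTop
      (𝓝 (kernelForm K f f).re) := by
    refine (Complex.continuous_re.tendsto _).comp ?_
    refine tendsto_finsetSum _ fun x _ => tendsto_finsetSum _ fun y _ => ?_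
    exact (((Complex.continuous_conj.tendsto _).comp (tendsto_gaussFloor_div (f x))).mul
      (tendsto_gaussFloor_div (f y))).mul_const _
  refine ge_of_tendsto' hlim fun n => ?_
  -- This also holds at `n = 0`, where division by zero makes both sides vanish.
  have e : (∑ x ∈ f.support, ∑ y ∈ f.support,
      conj (gaussFloor n (f x) / n) * (gaussFloor n (f y) / n) * K x y)
      = ((((n : ℝ) ^ 2)⁻¹ : ℝ) : ℂ) * ∑ x ∈ f.support, ∑ y ∈ f.support,
      conj (gaussFloor n (f x)) * gaussFloor n (f y) * K x y := by
    simp_rw [Finset.mul_sum]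
    refine Finset.sum_congr rfl fun x _ => Finset.sum_congr rfl fun y _ => ?_
    rw [map_div₀, Complex.conj_natCast]
    push_cast
    ring
  rw [e, Complex.re_ofReal_mul]
  exact mul_nonneg (by positivity) (hn n)

/-- The free vector space on `X`, to be equipped with the form given by a kernel. -/
@[nolint unusedArguments]
def KernelPre (_K : X → X → ℂ) : Type w := X →₀ ℂ

instance (K : X → X → ℂ) : AddCommGroup (KernelPre K) := inferInstanceAs (AddCommGroup (X →₀ ℂ))

instance (K : X → X → ℂ) : Module ℂ (KernelPre K) := inferInstanceAs (Module ℂ (X →₀ ℂ))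

/-- A positive semidefinite hermitian kernel. -/
class PosKernel (K : X → X → ℂ) : Prop where
  herm : ∀ x y, K y x = conj (K x y)
  nonneg : ∀ f, 0 ≤ (kernelForm K f f).re

theorem kernelForm_add_left (K : X → X → ℂ) (f g h : X →₀ ℂ) :
    kernelForm K (f + g) h = kernelForm K f h + kernelForm K g h := by
  refine Finsupp.sum_add_index' (fun x => by simp) fun x a b => ?_
  rw [← Finsupp.sum_add]
  refine Finsupp.sum_congr fun y _ => ?_
  rw [map_add]; ring

theorem kernelForm_smul_left (K : X → X → ℂ) (f g : X →₀ ℂ) (r : ℂ) :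
    kernelForm K (r • f) g = conj r * kernelForm K f g := by
  refine (Finsupp.sum_smul_index (fun x => by simp)).trans ?_
  rw [kernelForm, Finsupp.mul_sum]
  refine Finsupp.sum_congr fun x _ => ?_
  rw [Finsupp.mul_sum]
  refine Finsupp.sum_congr fun y _ => ?_
  rw [map_mul]; ring

theorem conj_kernelForm {K : X → X → ℂ} (herm : ∀ x y, K y x = conj (K x y)) (f g : X →₀ ℂ) :
    conj (kernelForm K g f) = kernelForm K f g := by
  rw [kernelForm, kernelForm, Finsupp.sum_comm]
  simp only [map_finsuppSum]
  refine Finsupp.sum_congr fun x _ => Finsupp.sum_congr fun y _ => ?_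
  simp only [map_mul, Complex.conj_conj]
  rw [← herm, mul_comm (g _)]

/-- The positive semidefinite form given by a positive kernel. -/
abbrev kernelCore (K : X → X → ℂ) [hK : PosKernel K] :
    PreInnerProductSpace.Core ℂ (KernelPre K) where
  inner := kernelForm K
  conj_inner_symm := conj_kernelForm hK.herm
  add_left := kernelForm_add_left K
  smul_left := kernelForm_smul_left K
  re_inner_nonneg f := hK.nonneg f

instance (K : X → X → ℂ) [PosKernel K] : SeminormedAddCommGroup (KernelPre K) :=
  @InnerProductSpace.Core.toSeminormedAddCommGroup ℂ _ _ _ _ (kernelCore K)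

instance (K : X → X → ℂ) [PosKernel K] : InnerProductSpace ℂ (KernelPre K) :=
  InnerProductSpace.ofCore (kernelCore K)

/-- The Hilbert space spanned by vectors `kernelVec K x` with Gram matrix `K`. -/
abbrev KernelSpace (K : X → X → ℂ) [PosKernel K] : Type w :=
  UniformSpace.Completion (KernelPre K)

variable (K : X → X → ℂ) [PosKernel K]

/-- The canonical map to the Hilbert space of a kernel. -/
def kernelComb : (X →₀ ℂ) →ₗ[ℂ] KernelSpace K :=
  (UniformSpace.Completion.toComplL (𝕜 := ℂ) (E := KernelPre K)).toLinearMap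

/-- The vector of the Hilbert space of a kernel given by a point. -/
def kernelVec (x : X) : KernelSpace K := kernelComb K (Finsupp.single x 1)

theorem inner_kernelVec (x y : X) : inner ℂ (kernelVec K x) (kernelVec K y) = K x y := by
  refine (UniformSpace.Completion.inner_coe (𝕜 := ℂ) (E := KernelPre K) _ _).trans ?_
  change kernelForm K (Finsupp.single x 1) (Finsupp.single y 1) = K x y
  simp [kernelForm]

theorem kernelComb_eq_sum (f : X →₀ ℂ) : kernelComb K f = f.sum fun x a => a • kernelVec K x := by
  have : kernelComb K = Finsupp.linearCombination ℂ (kernelVec K) := by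
    refine Finsupp.lhom_ext' fun x => LinearMap.ext_ring ?_
    simp [kernelVec]
  rw [this, Finsupp.linearCombination_apply]

theorem denseRange_kernelComb : DenseRange (kernelComb K) :=
  UniformSpace.Completion.denseRange_coe (α := KernelPre K)

-- Finite combinations of the `kernelVec K x` are dense. Through this lemma, identities known only
-- under the trace become equalities of vectors.
variable {K} in
theorem eq_of_inner_kernelVec {ξ η : KernelSpace K}
    (h : ∀ x, inner ℂ (kernelVec K x) ξ = inner ℂ (kernelVec K x) η) : ξ = η := by
  refine (denseRange_kernelComb K).eq_of_inner_right ℂ fun f => ?_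
  rw [kernelComb_eq_sum, Finsupp.sum_inner, Finsupp.sum_inner]
  simp only [inner_smul_left, h]

variable {K} in
theorem ext_kernelVec {E : Type*} [NormedAddCommGroup E] [NormedSpace ℂ E] {σ : ℂ →+* ℂ}
    {S T : KernelSpace K →SL[σ] E}
    (h : ∀ x, S (kernelVec K x) = T (kernelVec K x)) : S = T := by
  refine ContinuousLinearMap.coeFn_injective
    ((denseRange_kernelComb K).equalizer S.continuous T.continuous (funext fun f => ?_))
  simp [kernelComb_eq_sum, Finsupp.sum, h]

end Kernel

/-! ### Bounded operators prescribed on the vectors of a kernel -/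

section Kernel

open ComplexConjugate

variable {X : Type w}

theorem norm_finsuppSum_smul_sq {E : Type*} [NormedAddCommGroup E] [InnerProductSpace ℂ E]
    (v : X → E) (f : X →₀ ℂ) :
    ‖f.sum fun x a => a • v x‖ ^ 2 = (kernelForm (fun x y => inner ℂ (v x) (v y)) f f).re := by
  rw [← inner_self_eq_norm_sq (𝕜 := ℂ), Finsupp.sum_inner]
  change Complex.re _ = _
  congr 1
  refine Finsupp.sum_congr fun x _ => ?_
  rw [inner_smul_left, Finsupp.inner_sum, Finsupp.mul_sum]
  refine Finsupp.sum_congr fun y _ => ?_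
  rw [inner_smul_right, mul_assoc]

variable (K : X → X → ℂ) [PosKernel K]

theorem norm_kernelComb_sq (f : X →₀ ℂ) : ‖kernelComb K f‖ ^ 2 = (kernelForm K f f).re := by
  rw [kernelComb_eq_sum, norm_finsuppSum_smul_sq]
  simp only [inner_kernelVec]

/-- The norm bound on finite combinations gives both well-definedness, since null combinations go to
`0`, and continuity; the operator is the extension by density. -/
theorem exists_clm_kernelVec {E : Type*} [NormedAddCommGroup E] [NormedSpace ℂ E]
    [CompleteSpace E] (g : X → E) (C : ℝ)
    (h : ∀ f : X →₀ ℂ, ‖f.sum fun x a => a • g x‖ ≤ C * ‖kernelComb K f‖) :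
    ∃ T : KernelSpace K →L[ℂ] E, (∀ x, T (kernelVec K x) = g x) ∧ ∀ ξ, ‖T ξ‖ ≤ C * ‖ξ‖ := by
  have h' : ∀ f : X →₀ ℂ, ‖Finsupp.linearCombination ℂ g f‖ ≤ C * ‖kernelComb K f‖ := h
  refine ⟨(Finsupp.linearCombination ℂ g).extendOfNorm (kernelComb K), fun x => ?_,
    LinearMap.norm_extendOfNorm_apply_le (denseRange_kernelComb K) C h'⟩
  rw [kernelVec, LinearMap.extendOfNorm_eq (denseRange_kernelComb K) ⟨C, h'⟩]
  simp

/-- The hypothesis is `T* T ≤ C²` tested on finite combinations. As a positivity statement about a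
kernel, it is within reach of `kernelForm_self_nonneg`. -/
theorem exists_clm_kernelVec_map (φ : X → X) {C : ℝ} (hC : 0 ≤ C)
    (h : ∀ f, 0 ≤ (kernelForm (fun x y => ((C ^ 2 : ℝ) : ℂ) * K x y - K (φ x) (φ y)) f f).re) :
    ∃ T : KernelSpace K →L[ℂ] KernelSpace K,
      (∀ x, T (kernelVec K x) = kernelVec K (φ x)) ∧ ∀ ξ, ‖T ξ‖ ≤ C * ‖ξ‖ := by
  refine exists_clm_kernelVec K (fun x => kernelVec K (φ x)) C fun f => ?_
  refine abs_le_of_sq_le_sq' ?_ (by positivity) |>.2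
  rw [norm_finsuppSum_smul_sq, mul_pow, norm_kernelComb_sq, ← sub_nonneg]
  refine (h f).trans_eq ?_
  rw [← Complex.re_ofReal_mul, ← Complex.sub_re]
  congr 1
  simp only [kernelForm, inner_kernelVec]
  rw [Finsupp.mul_sum, ← Finsupp.sum_sub]
  refine Finsupp.sum_congr fun x _ => ?_
  rw [Finsupp.mul_sum, ← Finsupp.sum_sub]
  refine Finsupp.sum_congr fun y _ => ?_
  ring

end Kernel

/-! ### Suprema of bounded directed sets of positive operators -/

section Sup

variable {H : Type w} [NormedAddCommGroup H] [InnerProductSpace ℂ H] [CompleteSpace H]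

-- The sesquilinear forms of the members of `D` are uniformly bounded, so they converge pointwise
-- along an ultrafilter finer than the order filter, and the limit form defines `S`. Commutation
-- survives a weak limit because `T` can be moved to the other side of the inner product as its
-- adjoint.
open ContinuousLinearMap in
theorem exists_directed_sup {D : Set (H →L[ℂ] H)} (hne : D.Nonempty)
    (hD : DirectedOn (· ≤ ·) D) (hpos : ∀ y ∈ D, 0 ≤ y) {x : H →L[ℂ] H} (hx : ∀ y ∈ D, y ≤ x) :
    ∃ S : H →L[ℂ] H, (∀ y ∈ D, y ≤ S) ∧
      (∀ (ξ : H) (c : ℝ), (∀ y ∈ D, (inner ℂ (y ξ) ξ : ℂ).re ≤ c) → (inner ℂ (S ξ) ξ : ℂ).re ≤ c) ∧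
      ∀ T : H →L[ℂ] H, (∀ y ∈ D, Commute T y) → Commute T S := by
  have : Nonempty D := hne.to_subtype
  have : IsDirected D (· ≤ ·) := ⟨fun a b => by
    obtain ⟨c, hc, h1, h2⟩ := hD a a.2 b b.2
    exact ⟨⟨c, hc⟩, h1, h2⟩⟩
  have hat : (atTop : Filter D).NeBot := inferInstance
  let U : Ultrafilter D := Ultrafilter.of atTop
  have hU : (U : Filter D) ≤ atTop := Ultrafilter.of_le _
  have hnorm : ∀ y : D, ‖y.1‖ ≤ ‖x‖ := fun y =>
    CStarAlgebra.norm_le_norm_of_nonneg_of_le (hpos _ y.2) (hx _ y.2)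
  have hb : ∀ (ξ η : H) (y : D), ‖(inner ℂ (y.1 ξ) η : ℂ)‖ ≤ ‖x‖ * ‖ξ‖ * ‖η‖ := fun ξ η y =>
    (norm_inner_le_norm _ _).trans (mul_le_mul_of_nonneg_right
      ((y.1.le_opNorm ξ).trans (mul_le_mul_of_nonneg_right (hnorm y) (norm_nonneg _)))
      (norm_nonneg _))
  have hlim : ∀ ξ η : H, ∃ z : ℂ, Tendsto (fun y : D => (inner ℂ (y.1 ξ) η : ℂ)) U (𝓝 z) := by
    intro ξ η
    have hU : ((U.map fun y : D => (inner ℂ (y.1 ξ) η : ℂ)) : Filter ℂ)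
        ≤ 𝓟 (Metric.closedBall 0 (‖x‖ * ‖ξ‖ * ‖η‖)) := by
      rw [Ultrafilter.coe_map, le_principal_iff, mem_map]
      exact Filter.univ_mem' fun y => mem_closedBall_zero_iff.2 (hb ξ η y)
    obtain ⟨z, -, hz⟩ := (isCompact_closedBall _ _).ultrafilter_le_nhds _ hU
    exact ⟨z, hz⟩
  choose B hB using hlim
  let B₁ : H →ₗ⋆[ℂ] H →ₗ[ℂ] ℂ := LinearMap.mk₂'ₛₗ _ _ B
    (fun ξ ξ' η => tendsto_nhds_unique (hB _ _) (by
      simpa only [map_add, inner_add_left] using (hB ξ η).add (hB ξ' η)))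
    (fun c ξ η => tendsto_nhds_unique (hB _ _) (by
      simpa only [map_smul, inner_smul_left] using! (hB ξ η).const_mul _))
    (fun ξ η η' => tendsto_nhds_unique (hB _ _) (by
      simpa only [inner_add_right] using (hB ξ η).add (hB ξ η')))
    (fun c ξ η => tendsto_nhds_unique (hB _ _) (by
      simpa only [inner_smul_right] using! (hB ξ η).const_mul _))
  let B₂ : H →L⋆[ℂ] H →L[ℂ] ℂ := B₁.mkContinuous₂ ‖x‖ fun ξ η =>
    le_of_tendsto' (hB ξ η).norm (hb ξ η)
  let S := InnerProductSpace.continuousLinearMapOfBilin B₂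
  have hS : ∀ ξ η, Tendsto (fun y : D => (inner ℂ (y.1 ξ) η : ℂ)) U (𝓝 (inner ℂ (S ξ) η)) :=
    fun ξ η => by
      rw [InnerProductSpace.continuousLinearMapOfBilin_apply]; exact hB ξ η
  refine ⟨S, fun y hy => ?_, fun ξ c hc => ?_, fun T hT => ?_⟩
  · rw [ContinuousLinearMap.le_def, ContinuousLinearMap.isPositive_iff_complex]
    intro ξ
    have h1 : Tendsto (fun z : D => (inner ℂ ((z.1 - y) ξ) ξ : ℂ)) U
        (𝓝 (inner ℂ ((S - y) ξ) ξ)) := by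
      simp only [sub_apply, inner_sub_left]
      exact (hS ξ ξ).sub_const _
    -- Complex positivity is reality plus nonnegativity; both hold for all `z` above `y` and pass to
    -- the limit.
    have h2 : ∀ᶠ z : D in U, ((inner ℂ ((z.1 - y) ξ) ξ : ℂ).re : ℂ) = inner ℂ ((z.1 - y) ξ) ξ ∧
        0 ≤ (inner ℂ ((z.1 - y) ξ) ξ : ℂ).re := by
      filter_upwards [hU (eventually_ge_atTop (⟨y, hy⟩ : D))] with z hz
      exact (ContinuousLinearMap.isPositive_iff_complex _).1 hz ξ
    exact ⟨tendsto_nhds_unique ((Complex.continuous_ofReal.comp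
        Complex.continuous_re).continuousAt.tendsto.comp h1 |>.congr' <|
          h2.mono fun z hz => hz.1) h1,
      ge_of_tendsto (Complex.continuous_re.continuousAt.tendsto.comp h1) (h2.mono fun z hz => hz.2)⟩
  · exact le_of_tendsto' (Complex.continuous_re.continuousAt.tendsto.comp (hS ξ ξ))
      fun y => hc y y.2
  · refine ContinuousLinearMap.ext fun ξ => ext_inner_right ℂ fun η => ?_
    have h1 := hS ξ (adjoint T η)
    have h2 := hS (T ξ) η
    have h3 : (inner ℂ (T (S ξ)) η : ℂ) = inner ℂ (S ξ) (adjoint T η) :=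
      (T.adjoint_inner_right (S ξ) η).symm
    refine h3.trans (tendsto_nhds_unique h1 (h2.congr fun y => ?_))
    rw [T.adjoint_inner_right]
    exact congrArg (fun A : H →L[ℂ] H => (inner ℂ (A ξ) η : ℂ)) (hT y y.2).symm

end Sup

open ComplexConjugate

/-! ### The GNS construction for algebras known up to their trace -/

/-- A type with the operations of a `*`-algebra over the Gaussian integers and a trace, in which the
laws of a tracial `*`-algebra with bounded left and right multiplications hold under the trace. -/
structure PretracialAlgebra (X : Type w) where
  one : X
  add : X → X → X
  mul : X → X → X
  adj : X → X
  /-- multiplication by `i` -/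
  imul : X → X
  trace : X → ℂ
  radius : X → ℝ
  radius_nonneg : ∀ x, 0 ≤ radius x
  adj_mul_add : ∀ w x y,
    trace (mul (adj w) (add x y)) = trace (mul (adj w) x) + trace (mul (adj w) y)
  adj_mul_imul : ∀ w x, trace (mul (adj w) (imul x)) = Complex.I * trace (mul (adj w) x)
  hermitian : ∀ x y, trace (mul (adj y) x) = conj (trace (mul (adj x) y))
  nonneg : ∀ x, 0 ≤ (trace (mul (adj x) x)).re
  trace_one : trace one = 1
  trace_eq : ∀ x, trace (mul (adj one) x) = trace x
  mul_left_adjoint : ∀ x y z, trace (mul (adj (mul x y)) z) = trace (mul (adj y) (mul (adj x) z))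
  mul_right_adjoint : ∀ x y z,
    trace (mul (adj (mul x y)) z) = trace (mul (adj x) (mul z (adj y)))
  trace_assoc : ∀ w x y z,
    trace (mul (adj w) (mul (mul x y) z)) = trace (mul (adj w) (mul x (mul y z)))
  trace_mul_one : ∀ w x, trace (mul (adj w) (mul x one)) = trace (mul (adj w) x)
  trace_one_mul : ∀ w x, trace (mul (adj w) (mul one x)) = trace (mul (adj w) x)
  adj_adj : ∀ x y, trace (mul (adj (adj x)) (adj y)) = trace (mul (adj y) x)
  adj_adj_comm : ∀ x y, trace (mul (adj (adj x)) y) = trace (mul (adj (adj y)) x)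
  mul_left_bound : ∀ x y, (trace (mul (adj (mul x y)) (mul x y))).re
    ≤ radius x ^ 2 * (trace (mul (adj y) y)).re
  mul_right_bound : ∀ x y, (trace (mul (adj (mul x y)) (mul x y))).re
    ≤ radius y ^ 2 * (trace (mul (adj x) x)).re

namespace PretracialAlgebra

variable {X : Type w} (G : PretracialAlgebra X)

/-- The kernel `τ(x* y)`. -/
def kernel (x y : X) : ℂ := G.trace (G.mul (G.adj x) y)

theorem kernel_add (w x y : X) : G.kernel w (G.add x y) = G.kernel w x + G.kernel w y :=
  G.adj_mul_add w x y

theorem kernel_imul (w x : X) : G.kernel w (G.imul x) = Complex.I * G.kernel w x :=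
  G.adj_mul_imul w x

theorem kernel_comm (x y : X) : G.kernel y x = conj (G.kernel x y) := G.hermitian x y

theorem kernel_mul_left (x y z : X) : G.kernel (G.mul x y) z = G.kernel y (G.mul (G.adj x) z) :=
  G.mul_left_adjoint x y z

theorem kernel_mul_right (x y z : X) : G.kernel (G.mul x y) z = G.kernel x (G.mul z (G.adj y)) :=
  G.mul_right_adjoint x y z

theorem kernel_mul_left' (x y z : X) : G.kernel z (G.mul x y) = G.kernel (G.mul (G.adj x) z) y := by
  rw [G.kernel_comm, kernel_mul_left, ← G.kernel_comm]

theorem kernel_mul_right' (x y z : X) :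
    G.kernel z (G.mul x y) = G.kernel (G.mul z (G.adj y)) x := by
  rw [G.kernel_comm, kernel_mul_right, ← G.kernel_comm]

instance : PosKernel G.kernel where
  herm := G.kernel_comm
  nonneg := kernelForm_self_nonneg G.kernel_comm
    (fun x x' => ⟨G.add x x', fun y => G.kernel_add y x x'⟩)
    (fun x => ⟨G.imul x, fun y => G.kernel_imul y x⟩) G.nonneg

/-- The Hilbert space of the GNS construction. -/
abbrev Space : Type w := KernelSpace G.kernel

/-- The vector of an element. -/
abbrev vec (x : X) : G.Space := kernelVec G.kernel x

theorem inner_vec (x y : X) : inner ℂ (G.vec x) (G.vec y) = G.kernel x y := inner_kernelVec _ x y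

/-- The kernel `r² K y z - K (x y) (x z)`, with `r` the radius of `x`, is hermitian and its columns
are again closed under `add` and `imul`, since `x` can be moved across by its adjoint. Positivity
therefore reduces to the diagonal, which is `mul_left_bound`. -/
theorem exists_leftMul (x : X) : ∃ T : G.Space →L[ℂ] G.Space,
    (∀ y, T (G.vec y) = G.vec (G.mul x y)) ∧ ∀ ξ, ‖T ξ‖ ≤ G.radius x * ‖ξ‖ := by
  refine exists_clm_kernelVec_map G.kernel (G.mul x) (G.radius_nonneg x)
    (kernelForm_self_nonneg (fun y z => ?_) (fun y z => ⟨G.add y z, fun v => ?_⟩)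
    (fun y => ⟨G.imul y, fun v => ?_⟩) fun y => ?_)
  · rw [map_sub, map_mul, Complex.conj_ofReal, ← G.kernel_comm, ← G.kernel_comm]
  · rw [G.kernel_mul_left', kernel_add, kernel_add, G.kernel_mul_left' x y, G.kernel_mul_left' x z]
    ring
  · rw [G.kernel_mul_left', kernel_imul, kernel_imul, G.kernel_mul_left' x y]
    ring
  · rw [Complex.sub_re, Complex.re_ofReal_mul, sub_nonneg]
    exact G.mul_left_bound x y

theorem exists_rightMul (x : X) : ∃ T : G.Space →L[ℂ] G.Space,
    (∀ y, T (G.vec y) = G.vec (G.mul y x)) ∧ ∀ ξ, ‖T ξ‖ ≤ G.radius x * ‖ξ‖ := by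
  refine exists_clm_kernelVec_map G.kernel (fun y => G.mul y x) (G.radius_nonneg x)
    (kernelForm_self_nonneg (fun y z => ?_) (fun y z => ⟨G.add y z, fun v => ?_⟩)
    (fun y => ⟨G.imul y, fun v => ?_⟩) fun y => ?_)
  · rw [map_sub, map_mul, Complex.conj_ofReal, ← G.kernel_comm, ← G.kernel_comm]
  · rw [G.kernel_mul_right', kernel_add, kernel_add, G.kernel_mul_right' y, G.kernel_mul_right' z]
    ring
  · rw [G.kernel_mul_right', kernel_imul, kernel_imul, G.kernel_mul_right' y]
    ring
  · rw [Complex.sub_re, Complex.re_ofReal_mul, sub_nonneg]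
    exact G.mul_right_bound y x

/-- Left multiplication on the Hilbert space. -/
def leftMul (x : X) : G.Space →L[ℂ] G.Space := (G.exists_leftMul x).choose

/-- Right multiplication on the Hilbert space. -/
def rightMul (x : X) : G.Space →L[ℂ] G.Space := (G.exists_rightMul x).choose

theorem leftMul_vec (x y : X) : G.leftMul x (G.vec y) = G.vec (G.mul x y) :=
  (G.exists_leftMul x).choose_spec.1 y

theorem rightMul_vec (x y : X) : G.rightMul x (G.vec y) = G.vec (G.mul y x) :=
  (G.exists_rightMul x).choose_spec.1 y

theorem norm_leftMul_le (x : X) : ‖G.leftMul x‖ ≤ G.radius x :=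
  ContinuousLinearMap.opNorm_le_bound _ (G.radius_nonneg x) (G.exists_leftMul x).choose_spec.2

theorem vec_congr {x y : X} (h : ∀ w, G.kernel w x = G.kernel w y) : G.vec x = G.vec y :=
  eq_of_inner_kernelVec fun w => by rw [inner_kernelVec, inner_kernelVec, h]

/-- The vacuum vector. -/
abbrev vac : G.Space := G.vec G.one

theorem leftMul_vac (x : X) : G.leftMul x G.vac = G.vec x := by
  rw [leftMul_vec]; exact G.vec_congr fun w => G.trace_mul_one w x

theorem rightMul_vac (x : X) : G.rightMul x G.vac = G.vec x := by
  rw [rightMul_vec]; exact G.vec_congr fun w => G.trace_one_mul w x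

theorem star_leftMul (x : X) : star (G.leftMul x) = G.leftMul (G.adj x) := by
  rw [ContinuousLinearMap.star_eq_adjoint]
  refine ext_kernelVec fun y => eq_of_inner_kernelVec fun z => ?_
  rw [ContinuousLinearMap.adjoint_inner_right, leftMul_vec, leftMul_vec, inner_vec, inner_vec,
    kernel_mul_left]

theorem star_rightMul (x : X) : star (G.rightMul x) = G.rightMul (G.adj x) := by
  rw [ContinuousLinearMap.star_eq_adjoint]
  refine ext_kernelVec fun y => eq_of_inner_kernelVec fun z => ?_
  rw [ContinuousLinearMap.adjoint_inner_right, rightMul_vec, rightMul_vec, inner_vec, inner_vec,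
    kernel_mul_right]

theorem commute_rightMul_leftMul (x y : X) : Commute (G.rightMul y) (G.leftMul x) := by
  refine ext_kernelVec fun z => ?_
  change G.rightMul y (G.leftMul x (G.vec z)) = G.leftMul x (G.rightMul y (G.vec z))
  rw [leftMul_vec, rightMul_vec, rightMul_vec, leftMul_vec]
  exact G.vec_congr fun w => G.trace_assoc w x z y

/-- The von Neumann algebra generated by the left multiplications, as the commutant of the right
multiplications. -/
def vonNeumannAlgebra : VonNeumannAlgebra G.Space where
  toStarSubalgebra := StarSubalgebra.centralizer ℂ (Set.range G.rightMul)
  centralizer_centralizer' := by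
    change Set.centralizer (Set.centralizer
      (StarSubalgebra.centralizer ℂ (Set.range G.rightMul) : Set (G.Space →L[ℂ] G.Space))) =
      (StarSubalgebra.centralizer ℂ (Set.range G.rightMul) : Set (G.Space →L[ℂ] G.Space))
    rw [StarSubalgebra.coe_centralizer, Set.centralizer_centralizer_centralizer]

theorem mem_vonNeumannAlgebra {a : G.Space →L[ℂ] G.Space} :
    a ∈ G.vonNeumannAlgebra.toStarSubalgebra ↔ ∀ x, Commute (G.rightMul x) a := by
  change a ∈ StarSubalgebra.centralizer ℂ (Set.range G.rightMul) ↔ _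
  rw [StarSubalgebra.mem_centralizer_iff]
  constructor
  · exact fun h x => (h _ ⟨x, rfl⟩).1
  · rintro h _ ⟨x, rfl⟩
    exact ⟨h x, by rw [star_rightMul]; exact h _⟩

theorem leftMul_mem (x : X) : G.leftMul x ∈ G.vonNeumannAlgebra.toStarSubalgebra :=
  G.mem_vonNeumannAlgebra.2 fun y => G.commute_rightMul_leftMul x y

-- The vector of `x` is `R_x Ω`, and `a` commutes with `R_x`. Hence `Ω` is separating for the
-- commutant of the right multiplications.
variable {G} in
theorem apply_vec {a : G.Space →L[ℂ] G.Space} (ha : a ∈ G.vonNeumannAlgebra.toStarSubalgebra)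
    (x : X) : a (G.vec x) = G.rightMul x (a G.vac) := by
  rw [← rightMul_vac]
  exact (congrArg (fun T : G.Space →L[ℂ] G.Space => T G.vac)
    (G.mem_vonNeumannAlgebra.1 ha x)).symm

variable {G} in
theorem eq_of_apply_vac {a b : G.Space →L[ℂ] G.Space}
    (ha : a ∈ G.vonNeumannAlgebra.toStarSubalgebra)
    (hb : b ∈ G.vonNeumannAlgebra.toStarSubalgebra) (h : a G.vac = b G.vac) : a = b :=
  ext_kernelVec fun x => by rw [apply_vec ha, apply_vec hb, h]

/-- The conjugation `x ↦ x*` is isometric by `adj_adj`. Composing it with the inner product cancels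
the two conjugate-linearities and leaves a bounded bilinear form, to which the linear extension
lemma applies. -/
theorem exists_conjForm : ∃ B : G.Space →L[ℂ] G.Space →L[ℂ] ℂ,
    ∀ x, B (G.vec x) = innerSL ℂ (G.vec (G.adj x)) := by
  suffices h : ∀ f : X →₀ ℂ, ‖f.sum fun x a => a • innerSL ℂ (G.vec (G.adj x))‖
      ≤ 1 * ‖kernelComb G.kernel f‖ by
    obtain ⟨T, hT, -⟩ := exists_clm_kernelVec G.kernel _ 1 h
    exact ⟨T, hT⟩
  intro f
  have e : (f.sum fun x a => a • innerSL ℂ (G.vec (G.adj x)))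
      = innerSL ℂ (f.sum fun x a => conj a • G.vec (G.adj x)) := by
    rw [map_finsuppSum]
    exact Finsupp.sum_congr fun x _ => by rw [map_smulₛₗ, Complex.conj_conj]
  rw [e, innerSL_apply_norm, one_mul]
  refine abs_le_of_sq_le_sq' (le_of_eq ?_) (norm_nonneg _) |>.2
  rw [norm_kernelComb_sq, ← inner_self_eq_norm_sq (𝕜 := ℂ), Finsupp.sum_inner]
  change Complex.re _ = _
  rw [kernelForm, Finsupp.sum_comm]
  congr 1
  refine Finsupp.sum_congr fun x _ => ?_
  rw [inner_smul_left, Finsupp.inner_sum, Finsupp.mul_sum]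
  refine Finsupp.sum_congr fun y _ => ?_
  rw [inner_smul_right, inner_vec, Complex.conj_conj]
  have : G.kernel (G.adj x) (G.adj y) = G.kernel y x := G.adj_adj x y
  rw [this]
  ring

-- The trace property must hold on the whole commutant, not only on left multiplications. By `key`,
-- `⟨a*Ω, bΩ⟩ = B(bΩ, aΩ)` for every `a`, `b` in the commutant, and `B` is symmetric because it is
-- so on generators. No commutation theorem is needed.
variable {G} in
theorem inner_star_vac_comm {a b : G.Space →L[ℂ] G.Space}
    (ha : a ∈ G.vonNeumannAlgebra.toStarSubalgebra)
    (hb : b ∈ G.vonNeumannAlgebra.toStarSubalgebra) :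
    (inner ℂ (star a G.vac) (b G.vac) : ℂ) = inner ℂ (star b G.vac) (a G.vac) := by
  obtain ⟨B, hB⟩ := G.exists_conjForm
  have key : ∀ {a : G.Space →L[ℂ] G.Space}, a ∈ G.vonNeumannAlgebra.toStarSubalgebra →
      B.flip (a G.vac) = innerSL ℂ (star a G.vac) := by
    intro a ha
    refine ext_kernelVec fun y => ?_
    rw [ContinuousLinearMap.flip_apply, hB, innerSL_apply_apply, innerSL_apply_apply,
      ContinuousLinearMap.star_eq_adjoint, ContinuousLinearMap.adjoint_inner_left]
    change _ = inner ℂ G.vac (a (G.vec y))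
    rw [apply_vec ha y, ← ContinuousLinearMap.adjoint_inner_left (G.rightMul y),
      ← ContinuousLinearMap.star_eq_adjoint (G.rightMul y), star_rightMul, rightMul_vac]
  have symm : B.flip = B := by
    refine ext_kernelVec fun x => ext_kernelVec fun y => ?_
    change B (G.vec y) (G.vec x) = B (G.vec x) (G.vec y)
    rw [hB, hB, innerSL_apply_apply, innerSL_apply_apply, inner_vec, inner_vec]
    exact G.adj_adj_comm y x
  have h1 := congrArg (fun f => f (b G.vac)) (key ha)
  have h2 := congrArg (fun f => f (a G.vac)) (key hb)
  simp only [innerSL_apply_apply, ContinuousLinearMap.flip_apply] at h1 h2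
  rw [← h1, ← h2]
  conv_lhs => rw [← symm, ContinuousLinearMap.flip_apply]

/-- The vector state of the vacuum. -/
def vacState : G.vonNeumannAlgebra.toStarSubalgebra →ₗ[ℂ] ℂ where
  toFun a := inner ℂ G.vac (a.1 G.vac)
  map_add' a b := inner_add_right G.vac (a.1 G.vac) (b.1 G.vac)
  map_smul' c a := inner_smul_right G.vac (a.1 G.vac) c

theorem re_vacState (a : G.vonNeumannAlgebra.toStarSubalgebra) :
    (G.vacState a).re = (inner ℂ (a.1 G.vac) G.vac : ℂ).re :=
  inner_re_symm (𝕜 := ℂ) G.vac (a.1 G.vac)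

theorem vacState_mul (a b : G.vonNeumannAlgebra.toStarSubalgebra) :
    G.vacState (a * b) = inner ℂ (star a.1 G.vac) (b.1 G.vac) := by
  rw [ContinuousLinearMap.star_eq_adjoint, ContinuousLinearMap.adjoint_inner_left]
  rfl

theorem re_inner_le_of_le {a b : G.Space →L[ℂ] G.Space} (h : a ≤ b) (ξ : G.Space) :
    (inner ℂ (a ξ) ξ : ℂ).re ≤ (inner ℂ (b ξ) ξ : ℂ).re := by
  have h2 := ((ContinuousLinearMap.isPositive_iff_complex _).1
    ((ContinuousLinearMap.le_def _ _).1 h) ξ).2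
  rw [sub_apply, inner_sub_left, map_sub] at h2
  exact sub_nonneg.1 h2

/-- The operator `S` from `exists_directed_sup` commutes with the right multiplications, so it lies
in the algebra and dominates the least upper bound `x` taken there. Any bound for the vacuum state
on `D` bounds it at `S`, hence at `x`. -/
theorem vacState_normal (D : Set G.vonNeumannAlgebra.toStarSubalgebra)
    (x : G.vonNeumannAlgebra.toStarSubalgebra) (hne : D.Nonempty) (hD : DirectedOn (· ≤ ·) D)
    (hpos : ∀ y ∈ D, 0 ≤ y) (hx : IsLUB D x) :
    IsLUB ((fun y => (G.vacState y).re) '' D) (G.vacState x).re := by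
  refine ⟨?_, fun c hc => ?_⟩
  · rintro _ ⟨y, hy, rfl⟩
    have h1 : y.1 ≤ x.1 := hx.1 hy
    simp only [re_vacState]
    exact G.re_inner_le_of_le h1 _
  · obtain ⟨S, hS1, hS2, hS3⟩ := exists_directed_sup (D := Subtype.val '' D) (x := x.1)
      (hne.image _)
      (by
        rintro _ ⟨y, hy, rfl⟩ _ ⟨z, hz, rfl⟩
        obtain ⟨v, hv, h1, h2⟩ := hD y hy z hz
        exact ⟨_, ⟨v, hv, rfl⟩, h1, h2⟩)
      (by
        rintro _ ⟨y, hy, rfl⟩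
        exact hpos y hy)
      (by
        rintro _ ⟨y, hy, rfl⟩
        exact hx.1 hy)
    have hS : S ∈ G.vonNeumannAlgebra.toStarSubalgebra := G.mem_vonNeumannAlgebra.2 fun z =>
      hS3 _ <| by
        rintro _ ⟨y, -, rfl⟩
        exact G.mem_vonNeumannAlgebra.1 y.2 z
    have hxS : x ≤ ⟨S, hS⟩ := hx.2 fun y hy => hS1 _ ⟨y, hy, rfl⟩
    have h1 : x.1 ≤ S := hxS
    rw [re_vacState]
    refine (G.re_inner_le_of_le h1 _).trans (hS2 _ _ ?_)
    rintro _ ⟨y, hy, rfl⟩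
    rw [← re_vacState]
    exact hc ⟨y, hy, rfl⟩

open scoped ComplexOrder in
/-- The tracial von Neumann algebra of the GNS construction. -/
def toTracial : TracialVonNeumannAlgebra.{w} where
  H := G.Space
  alg := G.vonNeumannAlgebra
  trace := G.vacState
  trace_nonneg a ha := by
    have := (ContinuousLinearMap.nonneg_iff_isPositive _).1 ha
    exact this.inner_nonneg_right G.vac
  trace_one := by
    change (inner ℂ G.vac G.vac : ℂ) = 1
    rw [inner_vec]
    exact (G.trace_eq _).trans G.trace_one
  trace_mul_comm a b := by
    rw [vacState_mul, vacState_mul]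
    exact inner_star_vac_comm a.2 b.2
  faithful a h := by
    rw [vacState_mul] at h
    have e : star (star a : G.vonNeumannAlgebra.toStarSubalgebra).1 = a.1 := star_star a.1
    rw [e] at h
    exact Subtype.ext (eq_of_apply_vac a.2 (zero_mem _) (inner_self_eq_zero.1 h))
  normal := G.vacState_normal

/-- The image of an element in the von Neumann algebra. -/
def toElem (x : X) : G.toTracial.Elem := ⟨G.leftMul x, G.leftMul_mem x⟩

theorem norm_toElem_le (x : X) : ‖G.toElem x‖ ≤ G.radius x := G.norm_leftMul_le x

theorem elem_ext {a b : G.toTracial.Elem} (h : a.1 G.vac = b.1 G.vac) : a = b :=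
  Subtype.ext (eq_of_apply_vac a.2 b.2 h)

/-- A law tested against all `w` under the trace is a law for vectors, and since `Ω` is separating
also for operators. -/
theorem toElem_eq_smul {x y : X} {c : ℂ} (h : ∀ w, G.kernel w x = c * G.kernel w y) :
    G.toElem x = c • G.toElem y :=
  G.elem_ext <| by
    change G.leftMul x G.vac = c • G.leftMul y G.vac
    rw [leftMul_vac, leftMul_vac]
    refine eq_of_inner_kernelVec fun w => ?_
    rw [inner_smul_right, inner_vec, inner_vec, h]

theorem toElem_congr {x y : X} (h : ∀ w, G.kernel w x = G.kernel w y) :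
    G.toElem x = G.toElem y := by
  rw [G.toElem_eq_smul (c := 1) fun w => (h w).trans (one_mul _).symm, one_smul]

theorem toElem_one : G.toElem G.one = 1 := G.elem_ext (G.leftMul_vac _)

theorem toElem_add (x y : X) : G.toElem (G.add x y) = G.toElem x + G.toElem y :=
  G.elem_ext <| by
    change G.leftMul (G.add x y) G.vac = G.leftMul x G.vac + G.leftMul y G.vac
    rw [leftMul_vac, leftMul_vac, leftMul_vac]
    refine eq_of_inner_kernelVec fun w => ?_
    rw [inner_add_right, inner_vec, inner_vec, inner_vec, kernel_add]

theorem toElem_imul (x : X) : G.toElem (G.imul x) = Complex.I • G.toElem x :=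
  G.toElem_eq_smul fun w => G.kernel_imul w x

theorem toElem_mul (x y : X) : G.toElem (G.mul x y) = G.toElem x * G.toElem y :=
  G.elem_ext <| by
    change G.leftMul (G.mul x y) G.vac = G.leftMul x (G.leftMul y G.vac)
    rw [leftMul_vac, leftMul_vac, leftMul_vec]

theorem toElem_star (x : X) : G.toElem (G.adj x) = star (G.toElem x) :=
  Subtype.ext (G.star_leftMul x).symm

theorem trace_toElem (x : X) : G.toTracial.trace (G.toElem x) = G.trace x := by
  change (inner ℂ G.vac (G.leftMul x G.vac) : ℂ) = G.trace x
  rw [leftMul_vac, inner_vec]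
  exact G.trace_eq x

end PretracialAlgebra

/-! ### Axiomatizable properties -/

section Axiomatizable

variable {L : Language} {u : Connectives}

/-- A real supremum has its intended value only on bounded families. For connectives the bound comes
from continuity on a compact box. -/
theorem Formula.exists_bound (M : Prestructure.{w} L) {Γ : List L.Sorts} (φ : Formula L u Γ) :
    ∃ C, ∀ v, |φ.eval M v| ≤ C := by
  have hsup : ∀ {s : L.Sorts} {g : M.carrier s → ℝ} {C : ℝ}, (∀ a, |g a| ≤ C) →
      |⨆ a, g a| ≤ C ∧ |⨅ a, g a| ≤ C := by
    intro s g C h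
    have := M.nonempty s
    have h1 : BddAbove (Set.range g) := ⟨C, by rintro _ ⟨a, rfl⟩; exact (abs_le.1 (h a)).2⟩
    have h2 : BddBelow (Set.range g) := ⟨-C, by rintro _ ⟨a, rfl⟩; exact (abs_le.1 (h a)).1⟩
    have a := Classical.arbitrary (M.carrier s)
    exact ⟨abs_le.2 ⟨(abs_le.1 (h a)).1.trans (le_ciSup h1 a),
      ciSup_le fun a => (abs_le.1 (h a)).2⟩,
      abs_le.2 ⟨le_ciInf fun a => (abs_le.1 (h a)).1, (ciInf_le h2 a).trans (abs_le.1 (h a)).2⟩⟩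
  induction φ with
  | rel R ts => exact ⟨_, fun v => M.rel_bound R _⟩
  | @dist Γ s t₁ t₂ =>
    exact ⟨L.diam s, fun v => (abs_of_nonneg dist_nonneg).trans_le (M.dist_le _ _ _)⟩
  | conn n φ ih =>
    choose C hC using ih
    have hc : IsCompact (Set.univ.pi fun i => Set.Icc (-C i) (C i)) :=
      isCompact_univ_pi fun i => isCompact_Icc
    obtain ⟨D, hD⟩ := hc.exists_bound_of_continuousOn (u.fn n).continuous.continuousOn
    exact ⟨D, fun v => hD _ fun i _ => abs_le.1 (hC i v)⟩
  | sup s φ ih =>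
    obtain ⟨C, hC⟩ := ih
    exact ⟨C, fun v => (hsup fun a => hC _).1⟩
  | inf s φ ih =>
    obtain ⟨C, hC⟩ := ih
    exact ⟨C, fun v => (hsup fun a => hC _).2⟩

/-- Quantify all free variables by suprema. -/
def Formula.supClose : ∀ {Γ : List L.Sorts}, Formula L u Γ → Sentence L u
  | [], φ => φ
  | s :: _, φ => supClose (.sup s φ)

/-- A supremum of nonnegative bounded values is `0` exactly when all values are; the variables are
removed one at a time. -/
theorem value_supClose_eq_zero_iff (M : Prestructure.{w} L) :
    ∀ {Γ : List L.Sorts} {φ : Formula L u Γ}, (∀ v, 0 ≤ φ.eval M v) →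
      (Sentence.value M φ.supClose = 0 ↔ ∀ v, φ.eval M v = 0)
  | [], φ, _ => ⟨fun h v => by
    rw [← h, show v = fun i => i.elim0 from funext fun i => i.elim0]; rfl, fun h => h _⟩
  | s :: Γ, φ, h0 => by
    obtain ⟨C, hC⟩ := φ.exists_bound M
    have := M.nonempty s
    have hb : ∀ v, BddAbove (Set.range fun a : M.carrier s => φ.eval M (Tuple.cons a v)) :=
      fun v => ⟨C, by rintro _ ⟨a, rfl⟩; exact (abs_le.1 (hC _)).2⟩
    have h1 : ∀ v, 0 ≤ (Formula.sup s φ).eval M v := fun v =>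
      Real.iSup_nonneg fun a => h0 _
    refine (value_supClose_eq_zero_iff M h1).trans ⟨fun h v => ?_, fun h v => ?_⟩
    · have hv : v = Tuple.cons (v (0 : Fin (Γ.length + 1))) fun i => v i.succ :=
        (Fin.cons_self_tail (α := fun i : Fin (Γ.length + 1) => M.carrier ((s :: Γ).get i)) v).symm
      rw [hv]
      exact le_antisymm ((le_ciSup (hb _) _).trans_eq (h _)) (h0 _)
    · change ⨆ a : M.carrier s, φ.eval M (Tuple.cons a v) = 0
      simp only [h, ciSup_const]

variable (u) in
/-- A property of structures that is implied by a computable sequence of sentences true in `M`. -/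
def Axiomatizable (M : Prestructure.{w} L) (Q : Prestructure.{w} L → Prop) : Prop :=
  ∃ σ : ℕ → Sentence L u, Computable (fun n => (σ n).code) ∧ (∀ n, Sentence.value M (σ n) = 0) ∧
    ∀ N : Prestructure.{w} L, (∀ n, Sentence.value N (σ n) = 0) → Q N

/-- Unbounded search for a preimage of `n` halts exactly on the range. -/
theorem rePred_exists_eq {f : ℕ → ℕ} (hf : Computable f) : REPred fun n => ∃ k, f k = n := by
  have h : Partrec fun n : ℕ => Nat.rfind fun k => Part.some (decide (f k = n)) := by
    refine Partrec.rfind (p := fun n k => (Part.some (decide (f k = n)) : Part Bool)) ?_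
    have h1 : Computable fun p : ℕ × ℕ => decide (f p.2 = p.1) :=
      (Primrec.eq (α := ℕ)).decide.to_comp.comp (hf.comp Computable.snd) Computable.fst
    exact h1.partrec
  refine h.dom_re.of_eq fun n => ?_
  refine Nat.rfind_dom.trans ⟨?_, ?_⟩
  · rintro ⟨k, hk, -⟩
    exact ⟨k, of_decide_eq_true (Part.mem_some_iff.1 hk).symm⟩
  · rintro ⟨k, hk⟩
    exact ⟨k, Part.mem_some_iff.2 (decide_eq_true hk).symm, fun _ => trivial⟩

theorem Axiomatizable.embeddingProblem {M : Prestructure.{w} L}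
    (h : Axiomatizable u M fun N => EmbedsInUltrapower N M) : EmbeddingProblem u M := by
  obtain ⟨σ, hσ, hM, hN⟩ := h
  refine ⟨Set.range σ, (rePred_exists_eq hσ).of_eq fun n => ?_, ?_,
    fun N h => hN _ fun n => h _ ⟨n, rfl⟩⟩
  · simp
  · rintro _ ⟨n, rfl⟩
    exact hM n

theorem Axiomatizable.mono {M : Prestructure.{w} L} {Q Q' : Prestructure.{w} L → Prop}
    (h : Axiomatizable u M Q) (hQ : ∀ N, Q N → Q' N) : Axiomatizable u M Q' := by
  obtain ⟨σ, hσ, hM, hN⟩ := h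
  exact ⟨σ, hσ, hM, fun N h => hQ N (hN N h)⟩

theorem Axiomatizable.and {M : Prestructure.{w} L} {Q Q' : Prestructure.{w} L → Prop}
    (h : Axiomatizable u M Q) (h' : Axiomatizable u M Q') :
    Axiomatizable u M fun N => Q N ∧ Q' N := by
  obtain ⟨σ, hσ, hM, hN⟩ := h
  obtain ⟨σ', hσ', hM', hN'⟩ := h'
  -- The two sequences are interleaved at odd and even indices.
  refine ⟨fun n => bif n.bodd then σ n.div2 else σ' n.div2, ?_, fun n => ?_,
    fun N h => ⟨hN N fun n => ?_, hN' N fun n => ?_⟩⟩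
  · refine (Computable.cond Primrec.nat_bodd.to_comp (hσ.comp Primrec.nat_div2.to_comp)
      (hσ'.comp Primrec.nat_div2.to_comp)).of_eq fun n => ?_
    dsimp only
    cases n.bodd <;> rfl
  · cases h : n.bodd <;> simp only [h, cond_true, cond_false, hM, hM']
  · simpa using h (Nat.bit true n)
  · simpa using h (Nat.bit false n)

theorem axiomatizable_of_primrec {α : Type*} [Primcodable α] [Nonempty α] {M : Prestructure.{w} L}
    (σ : α → Sentence L u) (hσ : Primrec fun p => (σ p).code)
    (hM : ∀ p, Sentence.value M (σ p) = 0) :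
    Axiomatizable u M fun N => ∀ p, Sentence.value N (σ p) = 0 := by
  let a := Classical.arbitrary α
  -- Numbers that code no parameter repeat the sentence of the default parameter `a`, which is
  -- harmless.
  refine ⟨fun n => σ ((Encodable.decode n).getD a), ?_, fun n => hM _, fun N h p => ?_⟩
  · exact (hσ.comp (Primrec.option_getD.comp Primrec.decode (Primrec.const a))).to_comp
  · simpa using h (Encodable.encode p)

end Axiomatizable

/-! ### Structures in the language of tracial von Neumann algebras -/

section Ops

/-- A tuple of length one. -/
def tuple₁ {X : ℕ → Type w} {m : ℕ} (x : X m) : Tuple X [m] := fun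
  | ⟨0, _⟩ => x

/-- A tuple of length two. -/
def tuple₂ {X : ℕ → Type w} {m n : ℕ} (x : X m) (y : X n) : Tuple X [m, n] := fun
  | ⟨0, _⟩ => x
  | ⟨1, _⟩ => y

/-- A tuple of length four. -/
def tuple₄ {X : ℕ → Type w} {a b c d : ℕ} (x : X a) (y : X b) (z : X c) (v : X d) :
    Tuple X [a, b, c, d] := fun
  | ⟨0, _⟩ => x
  | ⟨1, _⟩ => y
  | ⟨2, _⟩ => z
  | ⟨3, _⟩ => v

/-- Structures in the language of tracial von Neumann algebras (not necessarily complete). -/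
abbrev TracialPre := Prestructure.{w} tracialLanguage

namespace TracialPre

variable (N : TracialPre.{w}) {m n : ℕ}

/-- A sort. -/
abbrev Sort' (n : ℕ) : Type w := N.carrier (show tracialLanguage.Sorts from n)

/-- The constant `0`. -/
def zero : N.Sort' 1 := N.fnMap TracialFn.zero fun i => i.elim0

/-- The constant `1`. -/
def one : N.Sort' 1 := N.fnMap TracialFn.one fun i => i.elim0

variable {N}

/-- Inclusion of balls. -/
def incl (h : m ≤ n) (x : N.Sort' m) : N.Sort' n := N.fnMap (TracialFn.incl m n h) (tuple₁ x)

/-- Addition. -/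
def add (x : N.Sort' m) (y : N.Sort' n) : N.Sort' (m + n) :=
  N.fnMap (TracialFn.add m n) (tuple₂ x y)

/-- Multiplication. -/
def mul (x : N.Sort' m) (y : N.Sort' n) : N.Sort' (m * n) :=
  N.fnMap (TracialFn.mul m n) (tuple₂ x y)

/-- The adjoint. -/
def adj (x : N.Sort' n) : N.Sort' n := N.fnMap (TracialFn.star n) (tuple₁ x)

/-- Multiplication by `a + b i`. -/
def smul (a b : ℚ) (h : (a ^ 2 + b ^ 2) * (m : ℚ) ^ 2 ≤ (n : ℚ) ^ 2) (x : N.Sort' m) :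
    N.Sort' n :=
  N.fnMap (TracialFn.smul a b m n h) (tuple₁ x)

/-- Multiplication by `i`. -/
def imul (x : N.Sort' n) : N.Sort' n := smul 0 1 (by simp) x

/-- The trace. -/
def tr (x : N.Sort' n) : ℂ :=
  ⟨N.relMap (TracialRel.trRe n) (tuple₁ x), N.relMap (TracialRel.trIm n) (tuple₁ x)⟩

end TracialPre

end Ops

/-! ### Uniformly coded families of terms and formulas -/

section Families

variable {α : Type} [Primcodable α]

/-- A family of terms whose codes are primitive recursive in the parameter. -/
structure TermFam (Γ : α → List ℕ) where
  sort : α → ℕ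
  term : ∀ p, Term tracialLanguage (Γ p) (sort p)
  sort_primrec : Primrec sort
  code_primrec : Primrec fun p => (term p).code

/-- A family of rational numbers whose numerators and denominators are primitive recursive. -/
structure RatFam (α : Type) [Primcodable α] where
  val : α → ℚ
  num_primrec : Primrec fun p => Encodable.encode (val p).num
  den_primrec : Primrec fun p => (val p).den

theorem primrec_natPair {f g : α → ℕ} (hf : Primrec f) (hg : Primrec g) :
    Primrec fun p => Nat.pair (f p) (g p) :=
  Primrec₂.natPair.comp hf hg

theorem primrec_encode_list₁ {f : α → ℕ} (hf : Primrec f) :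
    Primrec fun p => Encodable.encode [f p] :=
  Primrec.encode.comp (Primrec.list_cons.comp hf (Primrec.const []))

theorem primrec_encode_list₂ {f g : α → ℕ} (hf : Primrec f) (hg : Primrec g) :
    Primrec fun p => Encodable.encode [f p, g p] :=
  Primrec.encode.comp (Primrec.list_cons.comp hf (Primrec.list_cons.comp hg (Primrec.const [])))

namespace RatFam

/-- A constant family. -/
def const (q : ℚ) : RatFam α := ⟨fun _ => q, Primrec.const _, Primrec.const _⟩

theorem encode_natCast (k : ℕ) : Encodable.encode (k : ℤ) = 2 * k := rfl

/-- Nonnegative integers have even codes, negative ones odd codes; at `k = 0` truncated subtraction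
gives the code of `0`. -/
theorem encode_neg_natCast (k : ℕ) : Encodable.encode (-(k : ℤ)) = 2 * k - 1 := by
  cases k with
  | zero => rfl
  | succ k => rfl

/-- A family of natural numbers. -/
def ofNat (f : α → ℕ) (hf : Primrec f) : RatFam α where
  val p := f p
  num_primrec := by
    simp only [Rat.num_natCast, encode_natCast]
    exact Primrec.nat_double.comp hf
  den_primrec := by
    simp only [Rat.den_natCast]
    exact Primrec.const 1

/-- The negatives of a family of natural numbers. -/
def negNat (f : α → ℕ) (hf : Primrec f) : RatFam α where
  val p := -(f p : ℚ)
  num_primrec := by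
    simp only [Rat.num_neg_eq_neg_num, Rat.num_natCast, encode_neg_natCast]
    exact Primrec.nat_sub.comp (Primrec.nat_double.comp hf) (Primrec.const 1)
  den_primrec := by
    simp only [Rat.den_neg_eq_den, Rat.den_natCast]
    exact Primrec.const 1

end RatFam

namespace TermFam

variable {Γ : α → List ℕ}

/-- Interpretation of a family of terms. -/
def eval (t : TermFam Γ) (N : TracialPre.{w}) (p : α) (v : Tuple N.carrier (Γ p)) :
    N.Sort' (t.sort p) :=
  (t.term p).eval N v

/-- The constant `0`. -/
def zero : TermFam Γ where
  sort _ := 1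
  term _ := Term.app (L := tracialLanguage) TracialFn.zero fun i => i.elim0
  sort_primrec := Primrec.const 1
  code_primrec := Primrec.const
    (Nat.pair 1 (Nat.pair (TracialFn.code .zero) (Encodable.encode ([] : List ℕ))))

/-- The constant `1`. -/
def one : TermFam Γ where
  sort _ := 1
  term _ := Term.app (L := tracialLanguage) TracialFn.one fun i => i.elim0
  sort_primrec := Primrec.const 1
  code_primrec := Primrec.const
    (Nat.pair 1 (Nat.pair (TracialFn.code .one) (Encodable.encode ([] : List ℕ))))

/-- Sums. -/
def add (t t' : TermFam Γ) : TermFam Γ where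
  sort p := t.sort p + t'.sort p
  term p := Term.app (L := tracialLanguage) (TracialFn.add (t.sort p) (t'.sort p))
    (tuple₂ (X := Term tracialLanguage (Γ p)) (t.term p) (t'.term p))
  sort_primrec := Primrec.nat_add.comp t.sort_primrec t'.sort_primrec
  code_primrec := primrec_natPair (Primrec.const 1) <| primrec_natPair
    (primrec_natPair (Primrec.const 3) (primrec_natPair t.sort_primrec t'.sort_primrec))
    (primrec_encode_list₂ t.code_primrec t'.code_primrec)

/-- Products. -/
def mul (t t' : TermFam Γ) : TermFam Γ where
  sort p := t.sort p * t'.sort p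
  term p := Term.app (L := tracialLanguage) (TracialFn.mul (t.sort p) (t'.sort p))
    (tuple₂ (X := Term tracialLanguage (Γ p)) (t.term p) (t'.term p))
  sort_primrec := Primrec.nat_mul.comp t.sort_primrec t'.sort_primrec
  code_primrec := primrec_natPair (Primrec.const 1) <| primrec_natPair
    (primrec_natPair (Primrec.const 4) (primrec_natPair t.sort_primrec t'.sort_primrec))
    (primrec_encode_list₂ t.code_primrec t'.code_primrec)

/-- Adjoints. -/
def adj (t : TermFam Γ) : TermFam Γ where
  sort p := t.sort p
  term p := Term.app (L := tracialLanguage) (TracialFn.star (t.sort p))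
    (tuple₁ (X := Term tracialLanguage (Γ p)) (t.term p))
  sort_primrec := t.sort_primrec
  code_primrec := primrec_natPair (Primrec.const 1) <| primrec_natPair
    (primrec_natPair (Primrec.const 5) t.sort_primrec)
    (primrec_encode_list₁ t.code_primrec)

/-- Inclusions of balls. -/
def incl (t : TermFam Γ) (n : α → ℕ) (hn : Primrec n) (h : ∀ p, t.sort p ≤ n p) : TermFam Γ where
  sort := n
  term p := Term.app (L := tracialLanguage) (TracialFn.incl (t.sort p) (n p) (h p))
    (tuple₁ (X := Term tracialLanguage (Γ p)) (t.term p))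
  sort_primrec := hn
  code_primrec := primrec_natPair (Primrec.const 1) <| primrec_natPair
    (primrec_natPair (Primrec.const 2) (primrec_natPair t.sort_primrec hn))
    (primrec_encode_list₁ t.code_primrec)

/-- Multiplication by a family of elements of `ℚ(i)`. -/
def smul (a b : RatFam α) (t : TermFam Γ) (n : α → ℕ) (hn : Primrec n)
    (h : ∀ p, (a.val p ^ 2 + b.val p ^ 2) * (t.sort p : ℚ) ^ 2 ≤ (n p : ℚ) ^ 2) : TermFam Γ where
  sort := n
  term p := Term.app (L := tracialLanguage)
    (TracialFn.smul (a.val p) (b.val p) (t.sort p) (n p) (h p))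
    (tuple₁ (X := Term tracialLanguage (Γ p)) (t.term p))
  sort_primrec := hn
  code_primrec := primrec_natPair (Primrec.const 1) <| primrec_natPair
    (primrec_natPair (Primrec.const 6) (primrec_natPair
      (primrec_natPair a.num_primrec a.den_primrec)
      (primrec_natPair (primrec_natPair b.num_primrec b.den_primrec)
        (primrec_natPair t.sort_primrec hn))))
    (primrec_encode_list₁ t.code_primrec)

/-- Multiplication by `i`. -/
def imul (t : TermFam Γ) : TermFam Γ :=
  smul (RatFam.const 0) (RatFam.const 1) t t.sort t.sort_primrec fun p => by simp [RatFam.const]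

variable {N : TracialPre.{w}} {p : α} {v : Tuple N.carrier (Γ p)}

theorem eval_zero : (zero : TermFam Γ).eval N p v = N.zero :=
  congrArg (N.fnMap TracialFn.zero) (funext fun i => i.elim0)

theorem eval_one : (one : TermFam Γ).eval N p v = N.one :=
  congrArg (N.fnMap TracialFn.one) (funext fun i => i.elim0)

theorem eval_add (t t' : TermFam Γ) :
    (add t t').eval N p v = TracialPre.add (t.eval N p v) (t'.eval N p v) :=
  congrArg (N.fnMap (TracialFn.add _ _)) <| funext fun
    | ⟨0, _⟩ => rfl
    | ⟨1, _⟩ => rfl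

theorem eval_mul (t t' : TermFam Γ) :
    (mul t t').eval N p v = TracialPre.mul (t.eval N p v) (t'.eval N p v) :=
  congrArg (N.fnMap (TracialFn.mul _ _)) <| funext fun
    | ⟨0, _⟩ => rfl
    | ⟨1, _⟩ => rfl

theorem eval_adj (t : TermFam Γ) : (adj t).eval N p v = TracialPre.adj (t.eval N p v) :=
  congrArg (N.fnMap (TracialFn.star _)) <| funext fun
    | ⟨0, _⟩ => rfl

theorem eval_incl (t : TermFam Γ) (n : α → ℕ) (hn : Primrec n) (h : ∀ p, t.sort p ≤ n p) :
    (incl t n hn h).eval N p v = TracialPre.incl (h p) (t.eval N p v) :=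
  congrArg (N.fnMap (TracialFn.incl _ _ _)) <| funext fun
    | ⟨0, _⟩ => rfl

theorem eval_smul (a b : RatFam α) (t : TermFam Γ) (n : α → ℕ) (hn : Primrec n)
    (h : ∀ p, (a.val p ^ 2 + b.val p ^ 2) * (t.sort p : ℚ) ^ 2 ≤ (n p : ℚ) ^ 2) :
    (smul a b t n hn h).eval N p v
      = TracialPre.smul (a.val p) (b.val p) (h p) (t.eval N p v) :=
  congrArg (N.fnMap (TracialFn.smul _ _ _ _ _)) <| funext fun
    | ⟨0, _⟩ => rfl

theorem eval_imul (t : TermFam Γ) : (imul t).eval N p v = TracialPre.imul (t.eval N p v) :=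
  eval_smul _ _ _ _ _ _

section Var

variable {s₀ s₁ s₂ s₃ : α → ℕ}

/-- The first of four variables. -/
def var₀ (h : Primrec s₀) : TermFam fun p => [s₀ p, s₁ p, s₂ p, s₃ p] :=
  ⟨s₀, fun p => Term.var (L := tracialLanguage) (Γ := [s₀ p, s₁ p, s₂ p, s₃ p]) (0 : Fin 4), h,
    Primrec.const (Nat.pair 0 0)⟩

/-- The second of four variables. -/
def var₁ (h : Primrec s₁) : TermFam fun p => [s₀ p, s₁ p, s₂ p, s₃ p] :=
  ⟨s₁, fun p => Term.var (L := tracialLanguage) (Γ := [s₀ p, s₁ p, s₂ p, s₃ p]) (1 : Fin 4), h,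
    Primrec.const (Nat.pair 0 1)⟩

/-- The third of four variables. -/
def var₂ (h : Primrec s₂) : TermFam fun p => [s₀ p, s₁ p, s₂ p, s₃ p] :=
  ⟨s₂, fun p => Term.var (L := tracialLanguage) (Γ := [s₀ p, s₁ p, s₂ p, s₃ p]) (2 : Fin 4), h,
    Primrec.const (Nat.pair 0 2)⟩

/-- The fourth of four variables. -/
def var₃ (h : Primrec s₃) : TermFam fun p => [s₀ p, s₁ p, s₂ p, s₃ p] :=
  ⟨s₃, fun p => Term.var (L := tracialLanguage) (Γ := [s₀ p, s₁ p, s₂ p, s₃ p]) (3 : Fin 4), h,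
    Primrec.const (Nat.pair 0 3)⟩

end Var

end TermFam

/-- A family of formulas whose codes are primitive recursive in the parameter. -/
structure FormFam (u : Connectives) (Γ : α → List ℕ) where
  form : ∀ p, Formula tracialLanguage u (Γ p)
  code_primrec : Primrec fun p => (form p).code

namespace FormFam

variable {u : Connectives} {Γ : α → List ℕ}

/-- Interpretation of a family of formulas. -/
def eval (F : FormFam u Γ) (N : TracialPre.{w}) (p : α) (v : Tuple N.carrier (Γ p)) : ℝ :=
  (F.form p).eval N v

/-- The real part of the trace. -/
def re (t : TermFam Γ) : FormFam u Γ where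
  form p := Formula.rel (L := tracialLanguage) (TracialRel.trRe (t.sort p))
    (tuple₁ (X := Term tracialLanguage (Γ p)) (t.term p))
  code_primrec := primrec_natPair (Primrec.const 0) <| primrec_natPair
    (primrec_natPair (Primrec.const 0) t.sort_primrec) (primrec_encode_list₁ t.code_primrec)

/-- The imaginary part of the trace. -/
def im (t : TermFam Γ) : FormFam u Γ where
  form p := Formula.rel (L := tracialLanguage) (TracialRel.trIm (t.sort p))
    (tuple₁ (X := Term tracialLanguage (Γ p)) (t.term p))
  code_primrec := primrec_natPair (Primrec.const 0) <| primrec_natPair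
    (primrec_natPair (Primrec.const 1) t.sort_primrec) (primrec_encode_list₁ t.code_primrec)

/-- The arity of a connective equals `2` only propositionally; this rewrites the list of codes of
its arguments as an explicit two-element list. -/
theorem ofFn_comp_cast {β : Type*} {k : ℕ} (h : 2 = k) (g : Fin 2 → β) :
    List.ofFn (fun i : Fin k => g (Fin.cast h.symm i)) = [g 0, g 1] := by
  subst h
  simp [List.ofFn_succ]

theorem ofFn_comp_cast₁ {β : Type*} {k : ℕ} (h : 1 = k) (g : Fin 1 → β) :
    List.ofFn (fun i : Fin k => g (Fin.cast h.symm i)) = [g 0] := by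
  subst h
  simp [List.ofFn_succ]

/-- Apply a binary connective. -/
def conn₂ (n : ℕ) (h : 2 = u.arity n) (F G : FormFam u Γ) : FormFam u Γ where
  form p := .conn n fun i => ![F.form p, G.form p] (Fin.cast h.symm i)
  code_primrec := by
    have e : (fun p => (Formula.conn n fun i => ![F.form p, G.form p] (Fin.cast h.symm i)).code)
        = fun p =>
          Nat.pair 2 (Nat.pair n (Encodable.encode [(F.form p).code, (G.form p).code])) := by
      funext p
      exact congrArg (fun l : List ℕ => Nat.pair 2 (Nat.pair n (Encodable.encode l)))
        (ofFn_comp_cast h fun i => (![F.form p, G.form p] i).code)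
    rw [e]
    exact primrec_natPair (Primrec.const 2) <| primrec_natPair (Primrec.const n)
      (primrec_encode_list₂ F.code_primrec G.code_primrec)

/-- Apply a unary connective. -/
def conn₁ (n : ℕ) (h : 1 = u.arity n) (F : FormFam u Γ) : FormFam u Γ where
  form p := .conn n fun i => ![F.form p] (Fin.cast h.symm i)
  code_primrec := by
    have e : (fun p => (Formula.conn n fun i => ![F.form p] (Fin.cast h.symm i)).code)
        = fun p => Nat.pair 2 (Nat.pair n (Encodable.encode [(F.form p).code])) := by
      funext p
      exact congrArg (fun l : List ℕ => Nat.pair 2 (Nat.pair n (Encodable.encode l)))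
        (ofFn_comp_cast₁ h fun i => (![F.form p] i).code)
    rw [e]
    exact primrec_natPair (Primrec.const 2) <| primrec_natPair (Primrec.const n)
      (primrec_encode_list₁ F.code_primrec)

/-- Sums. -/
def add (F G : FormFam u Γ) : FormFam u Γ :=
  conn₂ u.has_add.choose u.has_add.choose_spec.choose F G

/-- Products. -/
def mul (F G : FormFam u Γ) : FormFam u Γ :=
  conn₂ u.has_mul.choose u.has_mul.choose_spec.choose F G

/-- Truncated differences. -/
def dotminus (F G : FormFam u Γ) : FormFam u Γ :=
  conn₂ u.has_dotminus.choose u.has_dotminus.choose_spec.choose F G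

/-- The constant `1`. -/
def one (F : FormFam u Γ) : FormFam u Γ :=
  conn₁ u.has_one.choose u.has_one.choose_spec.choose F

/-- The distance of the first two variables. -/
def distForm (s s₂ s₃ : ℕ) : Formula tracialLanguage u [s, s, s₂, s₃] :=
  .dist (L := tracialLanguage) (s := s)
    (Term.var (L := tracialLanguage) (Γ := [s, s, s₂, s₃]) (0 : Fin 4))
    (Term.var (L := tracialLanguage) (Γ := [s, s, s₂, s₃]) (1 : Fin 4))

/-- The family of distances of the first two variables. -/
def dist {s s₂ s₃ : α → ℕ} : FormFam u (fun p => [s p, s p, s₂ p, s₃ p]) where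
  form p := distForm (s p) (s₂ p) (s₃ p)
  code_primrec := Primrec.const (Nat.pair 1 (Nat.pair (Nat.pair 0 0) (Nat.pair 0 1)))

variable {N : TracialPre.{w}} {p : α} {v : Tuple N.carrier (Γ p)}

theorem eval_re (t : TermFam Γ) :
    (re t : FormFam u Γ).eval N p v = (TracialPre.tr (t.eval N p v)).re :=
  congrArg (N.relMap (TracialRel.trRe _)) <| funext fun
    | ⟨0, _⟩ => rfl

theorem eval_im (t : TermFam Γ) :
    (im t : FormFam u Γ).eval N p v = (TracialPre.tr (t.eval N p v)).im :=
  congrArg (N.relMap (TracialRel.trIm _)) <| funext fun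
    | ⟨0, _⟩ => rfl

theorem eval_conn₂ (n : ℕ) (h : 2 = u.arity n) (F G : FormFam u Γ) :
    (conn₂ n h F G).eval N p v
      = u.fn n (![F.eval N p v, G.eval N p v] ∘ Fin.cast h.symm) := by
  refine congrArg (u.fn n) (funext fun i => ?_)
  change (![F.form p, G.form p] (Fin.cast h.symm i)).eval N v = ![_, _] (Fin.cast h.symm i)
  generalize Fin.cast h.symm i = j
  fin_cases j <;> rfl

theorem eval_add (F G : FormFam u Γ) : (add F G).eval N p v = F.eval N p v + G.eval N p v :=
  (eval_conn₂ _ _ F G).trans (u.has_add.choose_spec.choose_spec _)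

theorem eval_mul (F G : FormFam u Γ) : (mul F G).eval N p v = F.eval N p v * G.eval N p v :=
  (eval_conn₂ _ _ F G).trans (u.has_mul.choose_spec.choose_spec _)

theorem eval_dotminus (F G : FormFam u Γ) :
    (dotminus F G).eval N p v = max (F.eval N p v - G.eval N p v) 0 :=
  (eval_conn₂ _ _ F G).trans (u.has_dotminus.choose_spec.choose_spec _)

theorem eval_one (F : FormFam u Γ) : (one F).eval N p v = 1 := by
  refine Eq.trans (congrArg (u.fn _) (funext fun i => ?_))
    (u.has_one.choose_spec.choose_spec fun _ => F.eval N p v)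
  change (![F.form p] (Fin.cast _ i)).eval N v = F.eval N p v
  generalize Fin.cast _ i = j
  fin_cases j
  rfl

end FormFam

/-! ### Axiomatizing identities and inequalities -/

variable [Nonempty α] {u : Connectives} {s₀ s₁ s₂ s₃ : α → ℕ}

/-- `F ≤ G` everywhere means that the supremum of `F ∸ G` is `0`. Fixing four variables makes the
quantifier prefix explicit, so its code is visibly primitive recursive; spare variables do no harm
since sorts are nonempty. -/
theorem axiomatizable_le (h₀ : Primrec s₀) (h₁ : Primrec s₁) (h₂ : Primrec s₂) (h₃ : Primrec s₃)
    {M : TracialPre.{w}} (F G : FormFam u fun p => [s₀ p, s₁ p, s₂ p, s₃ p])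
    (hM : ∀ p v, F.eval M p v ≤ G.eval M p v) :
    Axiomatizable u M fun N => ∀ p v, F.eval N p v ≤ G.eval N p v := by
  have key : ∀ (N : TracialPre.{w}) p, Sentence.value N ((F.dotminus G).form p).supClose = 0 ↔
      ∀ v, F.eval N p v ≤ G.eval N p v := by
    intro N p
    have hd : ∀ v, ((F.dotminus G).form p).eval N v = max (F.eval N p v - G.eval N p v) 0 :=
      fun v => FormFam.eval_dotminus F G
    refine (value_supClose_eq_zero_iff N fun v => (le_max_right _ _).trans_eq (hd v).symm).trans
      (forall_congr' fun v => ?_)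
    rw [← sub_nonpos, ← max_eq_right_iff, ← hd v]
  refine (axiomatizable_of_primrec (fun p => ((F.dotminus G).form p).supClose) ?_
    fun p => (key M p).2 (hM p)).mono fun N h p => (key N p).1 (h p)
  -- `supClose` binds variable `0` first, so the last variable has the outermost quantifier.
  exact primrec_natPair (Primrec.const 3) <| primrec_natPair h₃ <|
    primrec_natPair (Primrec.const 3) <| primrec_natPair h₂ <|
    primrec_natPair (Primrec.const 3) <| primrec_natPair h₁ <|
    primrec_natPair (Primrec.const 3) <| primrec_natPair h₀ (F.dotminus G).code_primrec

theorem axiomatizable_eq (h₀ : Primrec s₀) (h₁ : Primrec s₁) (h₂ : Primrec s₂) (h₃ : Primrec s₃)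
    {M : TracialPre.{w}} (F G : FormFam u fun p => [s₀ p, s₁ p, s₂ p, s₃ p])
    (hM : ∀ p v, F.eval M p v = G.eval M p v) :
    Axiomatizable u M fun N => ∀ p v, F.eval N p v = G.eval N p v :=
  ((axiomatizable_le h₀ h₁ h₂ h₃ F G fun p v => (hM p v).le).and
    (axiomatizable_le h₀ h₁ h₂ h₃ G F fun p v => (hM p v).ge)).mono
    fun _ h p v => le_antisymm (h.1 p v) (h.2 p v)

theorem axiomatizable_tr_eq (h₀ : Primrec s₀) (h₁ : Primrec s₁) (h₂ : Primrec s₂)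
    (h₃ : Primrec s₃) {M : TracialPre.{w}} (t t' : TermFam fun p => [s₀ p, s₁ p, s₂ p, s₃ p])
    (hM : ∀ p v, TracialPre.tr (t.eval M p v) = TracialPre.tr (t'.eval M p v)) :
    Axiomatizable u M fun N => ∀ p v,
      TracialPre.tr (t.eval N p v) = TracialPre.tr (t'.eval N p v) := by
  refine ((axiomatizable_eq h₀ h₁ h₂ h₃ (FormFam.re t) (FormFam.re t') fun p v => ?_).and
    (axiomatizable_eq h₀ h₁ h₂ h₃ (FormFam.im t) (FormFam.im t') fun p v => ?_)).mono
    fun N h p v => Complex.ext ?_ ?_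
  · rw [FormFam.eval_re, FormFam.eval_re, hM]
  · rw [FormFam.eval_im, FormFam.eval_im, hM]
  · simpa only [FormFam.eval_re] using h.1 p v
  · simpa only [FormFam.eval_im] using h.2 p v

end Families

/-! ### Tracial von Neumann algebras as structures -/

namespace TracialVonNeumannAlgebra

variable (A : TracialVonNeumannAlgebra.{w}) {n : ℕ}

/-- The element of the algebra underlying an element of a sort. -/
def elem (x : TracialPre.Sort' A.toPrestructure n) : A.Elem := Ball.val (A := A) (n := n) x

theorem norm_elem_le (x : TracialPre.Sort' A.toPrestructure n) : ‖A.elem x‖ ≤ n :=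
  Ball.norm_le (A := A) (n := n) x

theorem tr_eq (x : TracialPre.Sort' A.toPrestructure n) :
    TracialPre.tr x = A.trace (A.elem x) := rfl

theorem norm₂_sq (x : A.Elem) : A.norm₂ x ^ 2 = (A.trace (star x * x)).re :=
  Real.sq_sqrt (Complex.nonneg_iff.1 (A.trace_star_mul_self_nonneg x)).1

section Eval

variable {α : Type} [Primcodable α] {Γ : α → List ℕ} {p : α}
  {v : Tuple A.toPrestructure.carrier (Γ p)}

theorem elem_zero : A.elem ((TermFam.zero : TermFam Γ).eval A.toPrestructure p v) = 0 :=
  (congrArg A.elem TermFam.eval_zero).trans rfl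

theorem elem_one : A.elem ((TermFam.one : TermFam Γ).eval A.toPrestructure p v) = 1 :=
  (congrArg A.elem TermFam.eval_one).trans rfl

theorem elem_add (t t' : TermFam Γ) : A.elem ((t.add t').eval A.toPrestructure p v)
    = A.elem (t.eval A.toPrestructure p v) + A.elem (t'.eval A.toPrestructure p v) :=
  (congrArg A.elem (TermFam.eval_add t t')).trans rfl

theorem elem_mul (t t' : TermFam Γ) : A.elem ((t.mul t').eval A.toPrestructure p v)
    = A.elem (t.eval A.toPrestructure p v) * A.elem (t'.eval A.toPrestructure p v) :=
  (congrArg A.elem (TermFam.eval_mul t t')).trans rfl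

theorem elem_adj (t : TermFam Γ) : A.elem (t.adj.eval A.toPrestructure p v)
    = star (A.elem (t.eval A.toPrestructure p v)) :=
  (congrArg A.elem (TermFam.eval_adj t)).trans rfl

theorem elem_incl (t : TermFam Γ) (n : α → ℕ) (hn : Primrec n) (h : ∀ p, t.sort p ≤ n p) :
    A.elem ((t.incl n hn h).eval A.toPrestructure p v) = A.elem (t.eval A.toPrestructure p v) :=
  (congrArg A.elem (TermFam.eval_incl t n hn h)).trans rfl

theorem elem_smul (a b : RatFam α) (t : TermFam Γ) (n : α → ℕ) (hn : Primrec n)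
    (h : ∀ p, (a.val p ^ 2 + b.val p ^ 2) * (t.sort p : ℚ) ^ 2 ≤ (n p : ℚ) ^ 2) :
    A.elem ((t.smul a b n hn h).eval A.toPrestructure p v)
      = (⟨a.val p, b.val p⟩ : ℂ) • A.elem (t.eval A.toPrestructure p v) :=
  (congrArg A.elem (TermFam.eval_smul a b t n hn h)).trans rfl

theorem elem_imul (t : TermFam Γ) : A.elem (t.imul.eval A.toPrestructure p v)
    = Complex.I • A.elem (t.eval A.toPrestructure p v) := by
  refine (A.elem_smul _ _ _ _ _ _).trans (congrArg (· • _) (Complex.ext ?_ ?_)) <;>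
    simp [RatFam.const]

end Eval

end TracialVonNeumannAlgebra

/-! ### The list of trace conditions -/

namespace TracialPre

variable {N : TracialPre.{w}} {m n : ℕ}

/-- Writing the target radius as `k * m + r` reaches every `n ≥ k * m` while the parameters range
freely over `ℕ`, without a side condition. -/
theorem natSmul_le (k m r : ℕ) :
    ((k : ℚ) ^ 2 + 0 ^ 2) * (m : ℚ) ^ 2 ≤ ((k * m + r : ℕ) : ℚ) ^ 2 := by
  have h : k * m ≤ k * m + r := Nat.le_add_right _ _
  have h' : (k : ℚ) * m ≤ ((k * m + r : ℕ) : ℚ) := by exact_mod_cast h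
  have h0 : (0 : ℚ) ≤ (k : ℚ) * m := by positivity
  nlinarith

theorem negSmul_le (k m r : ℕ) :
    ((-(k : ℚ)) ^ 2 + 0 ^ 2) * (m : ℚ) ^ 2 ≤ ((k * m + r : ℕ) : ℚ) ^ 2 := by
  rw [neg_sq]; exact natSmul_le k m r

theorem re_le {a b : ℚ} (h : (a ^ 2 + b ^ 2) * (m : ℚ) ^ 2 ≤ (n : ℚ) ^ 2) :
    (a ^ 2 + 0 ^ 2) * (m : ℚ) ^ 2 ≤ (n : ℚ) ^ 2 :=
  le_trans (by nlinarith [mul_nonneg (sq_nonneg b) (sq_nonneg (m : ℚ))]) h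

theorem im_le {a b : ℚ} (h : (a ^ 2 + b ^ 2) * (m : ℚ) ^ 2 ≤ (n : ℚ) ^ 2) :
    (b ^ 2 + 0 ^ 2) * (m : ℚ) ^ 2 ≤ (n : ℚ) ^ 2 :=
  re_le (by rwa [add_comm])

/-- The target is the sort in which `natSmul a.den 0` places `a x`, the other side of `ratSmul`. -/
theorem num_le {a : ℚ} (h : (a ^ 2 + 0 ^ 2) * (m : ℚ) ^ 2 ≤ (n : ℚ) ^ 2) :
    ((a.num : ℚ) ^ 2 + 0 ^ 2) * (m : ℚ) ^ 2 ≤ ((a.den * n + 0 : ℕ) : ℚ) ^ 2 := by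
  have e : (a.num : ℚ) = a * a.den := (Rat.mul_den_eq_num a).symm
  rw [e]
  push_cast
  nlinarith [mul_le_mul_of_nonneg_left h (sq_nonneg (a.den : ℚ))]

/-- Multiplication by a natural number. -/
def natSmul (k r : ℕ) (x : N.Sort' m) : N.Sort' (k * m + r) := smul k 0 (natSmul_le k m r) x

/-- Multiplication by the negative of a natural number. -/
def negSmul (k r : ℕ) (x : N.Sort' m) : N.Sort' (k * m + r) := smul (-k) 0 (negSmul_le k m r) x

/-- The trace identities characterizing substructures of tracial von Neumann algebras. -/
structure IsPretracial (N : TracialPre.{w}) : Prop where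
  tr_add : ∀ {a b} (x : N.Sort' a) (y : N.Sort' b), tr (add x y) = tr x + tr y
  tr_imul : ∀ {a} (x : N.Sort' a), tr (imul x) = Complex.I * tr x
  tr_adj : ∀ {a} (x : N.Sort' a), tr (adj x) = star (tr x)
  tr_one : tr N.one = 1
  nonneg : ∀ {a} (x : N.Sort' a), 0 ≤ (tr (mul (adj x) x)).re
  adj_mul_add : ∀ {a b c} (x : N.Sort' a) (y : N.Sort' b) (z : N.Sort' c),
    tr (mul (adj x) (add y z)) = tr (add (mul (adj x) y) (mul (adj x) z))
  adj_mul_imul : ∀ {a b} (x : N.Sort' a) (y : N.Sort' b),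
    tr (mul (adj x) (imul y)) = tr (imul (mul (adj x) y))
  hermitian : ∀ {a b} (x : N.Sort' a) (y : N.Sort' b), tr (mul (adj y) x) = tr (adj (mul (adj x) y))
  tr_eq : ∀ {a} (x : N.Sort' a), tr (mul (adj N.one) x) = tr x
  mul_left_adjoint : ∀ {a b c} (x : N.Sort' a) (y : N.Sort' b) (z : N.Sort' c),
    tr (mul (adj (mul x y)) z) = tr (mul (adj y) (mul (adj x) z))
  mul_right_adjoint : ∀ {a b c} (x : N.Sort' a) (y : N.Sort' b) (z : N.Sort' c),
    tr (mul (adj (mul x y)) z) = tr (mul (adj x) (mul z (adj y)))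
  assoc : ∀ {a b c d} (w : N.Sort' a) (x : N.Sort' b) (y : N.Sort' c) (z : N.Sort' d),
    tr (mul (adj w) (mul (mul x y) z)) = tr (mul (adj w) (mul x (mul y z)))
  mul_one : ∀ {a b} (w : N.Sort' a) (x : N.Sort' b),
    tr (mul (adj w) (mul x N.one)) = tr (mul (adj w) x)
  one_mul : ∀ {a b} (w : N.Sort' a) (x : N.Sort' b),
    tr (mul (adj w) (mul N.one x)) = tr (mul (adj w) x)
  adj_adj : ∀ {a b} (x : N.Sort' a) (y : N.Sort' b),
    tr (mul (adj (adj x)) (adj y)) = tr (mul (adj y) x)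
  adj_adj_comm : ∀ {a b} (x : N.Sort' a) (y : N.Sort' b),
    tr (mul (adj (adj x)) y) = tr (mul (adj (adj y)) x)
  mul_left_bound : ∀ {a b} (x : N.Sort' a) (y : N.Sort' b),
    (tr (mul (adj (mul x y)) (mul x y))).re ≤ (tr (mul (adj (natSmul a 0 y)) (natSmul a 0 y))).re
  mul_right_bound : ∀ {a b} (x : N.Sort' a) (y : N.Sort' b),
    (tr (mul (adj (mul x y)) (mul x y))).re ≤ (tr (mul (adj (natSmul b 0 x)) (natSmul b 0 x))).re
  dist_mul_dist : ∀ {a} (x y : N.Sort' a), dist x y * dist x y =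
    (tr (mul (adj (add x (imul (imul y)))) (add x (imul (imul y))))).re
  zero : ∀ {a} (w : N.Sort' a), tr (mul (adj w) (add N.zero N.zero)) = tr (mul (adj w) N.zero)
  incl : ∀ {a b} (w : N.Sort' a) (x : N.Sort' b) (r : ℕ),
    tr (mul (adj w) (incl (Nat.le_add_right b r) x)) = tr (mul (adj w) x)
  natSmul_zero : ∀ {a b} (w : N.Sort' a) (x : N.Sort' b) (r : ℕ),
    tr (mul (adj w) (add (natSmul 0 r x) (natSmul 0 r x))) = tr (mul (adj w) (natSmul 0 r x))
  natSmul_succ : ∀ {a b} (w : N.Sort' a) (x : N.Sort' b) (r k : ℕ),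
    tr (mul (adj w) (natSmul (k + 1) r x)) = tr (mul (adj w) (add (natSmul k r x) x))
  negSmul : ∀ {a b} (w : N.Sort' a) (x : N.Sort' b) (r k : ℕ),
    tr (mul (adj w) (negSmul k r x)) = tr (mul (adj w) (imul (imul (natSmul k r x))))
  ratSmul : ∀ {a m n : ℕ} (w : N.Sort' a) (x : N.Sort' m) (q : ℚ)
    (h : (q ^ 2 + 0 ^ 2) * (m : ℚ) ^ 2 ≤ (n : ℚ) ^ 2),
    tr (mul (adj w) (natSmul q.den 0 (smul q 0 h x))) = tr (mul (adj w) (smul q.num 0 (num_le h) x))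
  smul : ∀ {a m n : ℕ} (w : N.Sort' a) (x : N.Sort' m) (q q' : ℚ)
    (h : (q ^ 2 + q' ^ 2) * (m : ℚ) ^ 2 ≤ (n : ℚ) ^ 2),
    tr (mul (adj w) (smul q q' h x))
      = tr (mul (adj w) (add (smul q 0 (re_le h) x) (imul (smul q' 0 (im_le h) x))))

end TracialPre

namespace TermFam

variable {α : Type} [Primcodable α] {Γ : α → List ℕ}

/-- Multiplication by a family of natural numbers. -/
def natSmul (k r : α → ℕ) (hk : Primrec k) (hr : Primrec r) (t : TermFam Γ) : TermFam Γ :=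
  smul (RatFam.ofNat k hk) (RatFam.const 0) t (fun p => k p * t.sort p + r p)
    (Primrec.nat_add.comp (Primrec.nat_mul.comp hk t.sort_primrec) hr)
    fun p => TracialPre.natSmul_le (k p) (t.sort p) (r p)

/-- Multiplication by the negatives of a family of natural numbers. -/
def negSmul (k r : α → ℕ) (hk : Primrec k) (hr : Primrec r) (t : TermFam Γ) : TermFam Γ :=
  smul (RatFam.negNat k hk) (RatFam.const 0) t (fun p => k p * t.sort p + r p)
    (Primrec.nat_add.comp (Primrec.nat_mul.comp hk t.sort_primrec) hr)
    fun p => TracialPre.negSmul_le (k p) (t.sort p) (r p)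

/-- Inclusion into a ball with larger radius. -/
def inclAdd (r : α → ℕ) (hr : Primrec r) (t : TermFam Γ) : TermFam Γ :=
  incl t (fun p => t.sort p + r p) (Primrec.nat_add.comp t.sort_primrec hr)
    fun p => Nat.le_add_right (t.sort p) (r p)

variable {N : TracialPre.{w}} {p : α} {v : Tuple N.carrier (Γ p)} {k r : α → ℕ}

theorem eval_inclAdd (hr : Primrec r) (t : TermFam Γ) : (inclAdd r hr t).eval N p v
    = TracialPre.incl (Nat.le_add_right (t.sort p) (r p)) (t.eval N p v) :=
  eval_incl _ _ _ _

theorem eval_natSmul (hk : Primrec k) (hr : Primrec r) (t : TermFam Γ) :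
    (natSmul k r hk hr t).eval N p v = TracialPre.natSmul (k p) (r p) (t.eval N p v) :=
  eval_smul _ _ _ _ _ _

theorem eval_negSmul (hk : Primrec k) (hr : Primrec r) (t : TermFam Γ) :
    (negSmul k r hk hr t).eval N p v = TracialPre.negSmul (k p) (r p) (t.eval N p v) :=
  eval_smul _ _ _ _ _ _

end TermFam

namespace TracialVonNeumannAlgebra

variable (A : TracialVonNeumannAlgebra.{w}) {α : Type} [Primcodable α] {Γ : α → List ℕ} {p : α}
  {v : Tuple A.toPrestructure.carrier (Γ p)} {k r : α → ℕ}

theorem elem_inclAdd (hr : Primrec r) (t : TermFam Γ) :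
    A.elem ((t.inclAdd r hr).eval A.toPrestructure p v)
      = A.elem (t.eval A.toPrestructure p v) :=
  A.elem_incl _ _ _ _

theorem elem_natSmul (hk : Primrec k) (hr : Primrec r) (t : TermFam Γ) :
    A.elem ((t.natSmul k r hk hr).eval A.toPrestructure p v)
      = (k p : ℂ) • A.elem (t.eval A.toPrestructure p v) := by
  refine (A.elem_smul _ _ _ _ _ _).trans (congrArg (· • _) (Complex.ext ?_ ?_)) <;>
    simp [RatFam.const, RatFam.ofNat]

theorem elem_negSmul (hk : Primrec k) (hr : Primrec r) (t : TermFam Γ) :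
    A.elem ((t.negSmul k r hk hr).eval A.toPrestructure p v)
      = -(k p : ℂ) • A.elem (t.eval A.toPrestructure p v) := by
  refine (A.elem_smul _ _ _ _ _ _).trans (congrArg (· • _) (Complex.ext ?_ ?_)) <;>
    simp [RatFam.const, RatFam.negNat]

theorem norm₂_mul_sq_le {x : A.Elem} {c : ℝ} (hx : ‖x‖ ≤ c) (y : A.Elem) :
    A.norm₂ (x * y) ^ 2 ≤ (c * A.norm₂ y) ^ 2 :=
  pow_le_pow_left₀ (A.norm₂_nonneg _)
    ((A.norm₂_mul_le x y).trans (mul_le_mul_of_nonneg_right hx (A.norm₂_nonneg y))) 2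

theorem norm₂_mul_sq_le' {y : A.Elem} {c : ℝ} (hy : ‖y‖ ≤ c) (x : A.Elem) :
    A.norm₂ (x * y) ^ 2 ≤ (c * A.norm₂ x) ^ 2 := by
  refine pow_le_pow_left₀ (A.norm₂_nonneg _) ((A.norm₂_mul_le' x y).trans ?_) 2
  rw [mul_comm]
  exact mul_le_mul_of_nonneg_right hy (A.norm₂_nonneg x)

end TracialVonNeumannAlgebra

namespace TracialPre

/-! ### Each condition holds in tracial von Neumann algebras and is axiomatizable -/

section Axioms

variable (u : Connectives) (A : TracialVonNeumannAlgebra.{w})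

/-- The context with four variables of arbitrary sorts. -/
abbrev Γ₄ (p : ℕ × ℕ × ℕ × ℕ) : List ℕ := [p.1, p.2.1, p.2.2.1, p.2.2.2]

theorem primrec₀ : Primrec fun p : ℕ × ℕ × ℕ × ℕ => p.1 := Primrec.fst

theorem primrec₁ : Primrec fun p : ℕ × ℕ × ℕ × ℕ => p.2.1 := Primrec.fst.comp Primrec.snd

theorem primrec₂ : Primrec fun p : ℕ × ℕ × ℕ × ℕ => p.2.2.1 :=
  Primrec.fst.comp (Primrec.snd.comp Primrec.snd)

theorem primrec₃ : Primrec fun p : ℕ × ℕ × ℕ × ℕ => p.2.2.2 :=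
  Primrec.snd.comp (Primrec.snd.comp Primrec.snd)

/-- The first variable. -/
abbrev X₀ : TermFam Γ₄ := TermFam.var₀ primrec₀

/-- The second variable. -/
abbrev X₁ : TermFam Γ₄ := TermFam.var₁ primrec₁

/-- The third variable. -/
abbrev X₂ : TermFam Γ₄ := TermFam.var₂ primrec₂

/-- The fourth variable. -/
abbrev X₃ : TermFam Γ₄ := TermFam.var₃ primrec₃

theorem axiomatizable_identity {t t' : TermFam Γ₄}
    (h : ∀ p v, A.trace (A.elem (t.eval A.toPrestructure p v))
      = A.trace (A.elem (t'.eval A.toPrestructure p v))) :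
    Axiomatizable u A.toPrestructure fun N => ∀ p v,
      tr (t.eval N p v) = tr (t'.eval N p v) :=
  axiomatizable_tr_eq primrec₀ primrec₁ primrec₂ primrec₃ t t' h

theorem axiomatizable_inequality {F G : FormFam u Γ₄}
    (h : ∀ p v, F.eval A.toPrestructure p v ≤ G.eval A.toPrestructure p v) :
    Axiomatizable u A.toPrestructure fun N => ∀ p v, F.eval N p v ≤ G.eval N p v :=
  axiomatizable_le primrec₀ primrec₁ primrec₂ primrec₃ F G h

theorem axiomatizable_equality {F G : FormFam u Γ₄}
    (h : ∀ p v, F.eval A.toPrestructure p v = G.eval A.toPrestructure p v) :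
    Axiomatizable u A.toPrestructure fun N => ∀ p v, F.eval N p v = G.eval N p v :=
  axiomatizable_eq primrec₀ primrec₁ primrec₂ primrec₃ F G h

/-- An element of a sort. -/
def someElem (N : TracialPre.{w}) (n : ℕ) : N.Sort' n := (N.nonempty n).some

theorem axiomatizable_tr_add : Axiomatizable u A.toPrestructure fun N : TracialPre.{w} =>
    ∀ {a b} (x : N.Sort' a) (y : N.Sort' b), tr (add x y) = tr x + tr y := by
  refine ((axiomatizable_equality u A (F := FormFam.re (X₀.add X₁))
      (G := (FormFam.re X₀).add (FormFam.re X₁)) fun p v => ?_).and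
    (axiomatizable_equality u A (F := FormFam.im (X₀.add X₁))
      (G := (FormFam.im X₀).add (FormFam.im X₁)) fun p v => ?_)).mono
    fun N h a b x y => ?_
  · simp only [FormFam.eval_re, FormFam.eval_add, A.tr_eq, A.elem_add, map_add, Complex.add_re]
  · simp only [FormFam.eval_im, FormFam.eval_add, A.tr_eq, A.elem_add, map_add, Complex.add_im]
  · simp only [FormFam.eval_re, FormFam.eval_im, FormFam.eval_add, TermFam.eval_add] at h
    let v := tuple₄ (X := N.carrier) x y (someElem N 0) (someElem N 0)
    exact Complex.ext (h.1 (a, b, 0, 0) v) (h.2 (a, b, 0, 0) v)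

/-- The relation `Re τ(ix) = -Im τ(x)` is stated without negation or the constant `0`, by adding `Im
τ(x)` on both sides of `Re τ(ix) + Im τ(x) = 0`. The adjoint is treated the same way. -/
theorem axiomatizable_tr_imul : Axiomatizable u A.toPrestructure fun N : TracialPre.{w} =>
    ∀ {a} (x : N.Sort' a), tr (imul x) = Complex.I * tr x := by
  refine ((axiomatizable_equality u A
      (F := ((FormFam.re X₀.imul).add (FormFam.im X₀)).add (FormFam.im X₀))
      (G := FormFam.im X₀) fun p v => ?_).and
    (axiomatizable_equality u A (F := FormFam.im X₀.imul) (G := FormFam.re X₀) fun p v => ?_)).mono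
    fun N h a x => ?_
  · simp [FormFam.eval_re, FormFam.eval_im, FormFam.eval_add, A.tr_eq, A.elem_imul]
  · simp [FormFam.eval_re, FormFam.eval_im, A.tr_eq, A.elem_imul]
  · simp only [FormFam.eval_re, FormFam.eval_im, FormFam.eval_add, TermFam.eval_imul,
      add_eq_right] at h
    let v := tuple₄ (X := N.carrier) x (someElem N 0) (someElem N 0) (someElem N 0)
    refine Complex.ext ?_ ?_
    · rw [Complex.I_mul_re]
      exact eq_neg_of_add_eq_zero_left (h.1 (a, 0, 0, 0) v)
    · rw [Complex.I_mul_im]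
      exact h.2 (a, 0, 0, 0) v

theorem axiomatizable_tr_adj : Axiomatizable u A.toPrestructure fun N : TracialPre.{w} =>
    ∀ {a} (x : N.Sort' a), tr (adj x) = star (tr x) := by
  refine ((axiomatizable_equality u A
      (F := ((FormFam.im X₀.adj).add (FormFam.im X₀)).add (FormFam.im X₀))
      (G := FormFam.im X₀) fun p v => ?_).and
    (axiomatizable_equality u A (F := FormFam.re X₀.adj) (G := FormFam.re X₀) fun p v => ?_)).mono
    fun N h a x => ?_
  · simp [FormFam.eval_im, FormFam.eval_add, A.tr_eq, A.elem_adj, A.trace_star]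
  · simp [FormFam.eval_re, A.tr_eq, A.elem_adj, A.trace_star]
  · simp only [FormFam.eval_re, FormFam.eval_im, FormFam.eval_add, TermFam.eval_adj,
      add_eq_right] at h
    let v := tuple₄ (X := N.carrier) x (someElem N 0) (someElem N 0) (someElem N 0)
    exact Complex.ext (h.2 (a, 0, 0, 0) v) (eq_neg_of_add_eq_zero_left (h.1 (a, 0, 0, 0) v))

/-- Vanishing of the imaginary part is expressed as `b + b = b`. The constant `1` is a unary
connective and takes a dummy argument. -/
theorem axiomatizable_tr_one : Axiomatizable u A.toPrestructure fun N : TracialPre.{w} =>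
    tr N.one = 1 := by
  refine ((axiomatizable_equality u A (F := (FormFam.im TermFam.one).add (FormFam.im TermFam.one))
      (G := FormFam.im TermFam.one) fun p v => ?_).and
    (axiomatizable_equality u A (F := FormFam.re TermFam.one)
      (G := FormFam.one (FormFam.re TermFam.one)) fun p v => ?_)).mono
    fun N h => ?_
  · simp [FormFam.eval_im, FormFam.eval_add, A.tr_eq, A.elem_one, A.trace_one]
  · simp [FormFam.eval_re, FormFam.eval_one, A.tr_eq, A.elem_one, A.trace_one]
  · simp only [FormFam.eval_re, FormFam.eval_im, FormFam.eval_add, TermFam.eval_one,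
      FormFam.eval_one, add_eq_right] at h
    let v := tuple₄ (X := N.carrier) (someElem N 0) (someElem N 0) (someElem N 0) (someElem N 0)
    exact Complex.ext (h.2 (0, 0, 0, 0) v) (h.1 (0, 0, 0, 0) v)

/-- Nonnegativity of `r` is expressed as `r ≤ r + r`. -/
theorem axiomatizable_nonneg : Axiomatizable u A.toPrestructure fun N : TracialPre.{w} =>
    ∀ {a} (x : N.Sort' a), 0 ≤ (tr (mul (adj x) x)).re := by
  refine (axiomatizable_inequality u A (F := FormFam.re (X₀.adj.mul X₀))
    (G := (FormFam.re (X₀.adj.mul X₀)).add (FormFam.re (X₀.adj.mul X₀))) fun p v => ?_).mono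
    fun N h a x => ?_
  · simp only [FormFam.eval_re, FormFam.eval_add, A.tr_eq, A.elem_mul, A.elem_adj, ← A.norm₂_sq]
    exact le_add_of_nonneg_left (sq_nonneg _)
  · simp only [FormFam.eval_re, FormFam.eval_add, TermFam.eval_mul, TermFam.eval_adj,
      le_add_iff_nonneg_left] at h
    exact h (a, 0, 0, 0)
      (tuple₄ (X := N.carrier) x (someElem N 0) (someElem N 0) (someElem N 0))

theorem axiomatizable_adj_mul_add : Axiomatizable u A.toPrestructure fun N : TracialPre.{w} =>
    ∀ {a b c} (x : N.Sort' a) (y : N.Sort' b) (z : N.Sort' c),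
      tr (mul (adj x) (add y z)) = tr (add (mul (adj x) y) (mul (adj x) z)) := by
  refine (axiomatizable_identity u A (t := X₀.adj.mul (X₁.add X₂))
    (t' := (X₀.adj.mul X₁).add (X₀.adj.mul X₂)) fun p v => ?_).mono
    fun N h a b c x y z => ?_
  · simp only [A.elem_add, A.elem_mul, A.elem_adj, mul_add]
  · simp only [TermFam.eval_add, TermFam.eval_mul, TermFam.eval_adj] at h
    exact h (a, b, c, 0) (tuple₄ (X := N.carrier) x y z (someElem N 0))

theorem axiomatizable_adj_mul_imul : Axiomatizable u A.toPrestructure fun N : TracialPre.{w} =>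
    ∀ {a b} (x : N.Sort' a) (y : N.Sort' b),
      tr (mul (adj x) (imul y)) = tr (imul (mul (adj x) y)) := by
  refine (axiomatizable_identity u A (t := X₀.adj.mul X₁.imul)
    (t' := (X₀.adj.mul X₁).imul) fun p v => ?_).mono
    fun N h a b x y => ?_
  · simp only [A.elem_imul, A.elem_mul, A.elem_adj, mul_smul_comm]
  · simp only [TermFam.eval_imul, TermFam.eval_mul, TermFam.eval_adj] at h
    exact h (a, b, 0, 0) (tuple₄ (X := N.carrier) x y (someElem N 0) (someElem N 0))

theorem axiomatizable_hermitian : Axiomatizable u A.toPrestructure fun N : TracialPre.{w} =>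
    ∀ {a b} (x : N.Sort' a) (y : N.Sort' b),
      tr (mul (adj y) x) = tr (adj (mul (adj x) y)) := by
  refine (axiomatizable_identity u A (t := X₁.adj.mul X₀)
    (t' := (X₀.adj.mul X₁).adj) fun p v => ?_).mono
    fun N h a b x y => ?_
  · simp only [A.elem_mul, A.elem_adj, star_mul, star_star]
  · simp only [TermFam.eval_mul, TermFam.eval_adj] at h
    exact h (a, b, 0, 0) (tuple₄ (X := N.carrier) x y (someElem N 0) (someElem N 0))

theorem axiomatizable_tr_eq : Axiomatizable u A.toPrestructure fun N : TracialPre.{w} =>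
    ∀ {a} (x : N.Sort' a),
      tr (mul (adj N.one) x) = tr x := by
  refine (axiomatizable_identity u A (t := TermFam.one.adj.mul X₀)
    (t' := X₀) fun p v => ?_).mono
    fun N h a x => ?_
  · simp only [A.elem_mul, A.elem_adj, A.elem_one, star_one, _root_.one_mul]
  · simp only [TermFam.eval_mul, TermFam.eval_adj, TermFam.eval_one] at h
    exact h (a, 0, 0, 0) (tuple₄ (X := N.carrier) x (someElem N 0) (someElem N 0) (someElem N 0))

theorem axiomatizable_mul_left_adjoint : Axiomatizable u A.toPrestructure fun N : TracialPre.{w} =>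
    ∀ {a b c} (x : N.Sort' a) (y : N.Sort' b) (z : N.Sort' c),
      tr (mul (adj (mul x y)) z) = tr (mul (adj y) (mul (adj x) z)) := by
  refine (axiomatizable_identity u A (t := (X₀.mul X₁).adj.mul X₂)
    (t' := X₁.adj.mul (X₀.adj.mul X₂)) fun p v => ?_).mono
    fun N h a b c x y z => ?_
  · simp only [A.elem_mul, A.elem_adj, star_mul, mul_assoc]
  · simp only [TermFam.eval_mul, TermFam.eval_adj] at h
    exact h (a, b, c, 0) (tuple₄ (X := N.carrier) x y z (someElem N 0))

theorem axiomatizable_mul_right_adjoint : Axiomatizable u A.toPrestructure fun N : TracialPre.{w} =>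
    ∀ {a b c} (x : N.Sort' a) (y : N.Sort' b) (z : N.Sort' c),
      tr (mul (adj (mul x y)) z) = tr (mul (adj x) (mul z (adj y))) := by
  refine (axiomatizable_identity u A (t := (X₀.mul X₁).adj.mul X₂)
    (t' := X₀.adj.mul (X₂.mul X₁.adj)) fun p v => ?_).mono
    fun N h a b c x y z => ?_
  · simp only [A.elem_mul, A.elem_adj, star_mul]
    -- Cyclicity of the trace moves `y*` from the front to the end.
    rw [mul_assoc, A.trace_mul_comm, mul_assoc]
  · simp only [TermFam.eval_mul, TermFam.eval_adj] at h
    exact h (a, b, c, 0) (tuple₄ (X := N.carrier) x y z (someElem N 0))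

theorem axiomatizable_assoc : Axiomatizable u A.toPrestructure fun N : TracialPre.{w} =>
    ∀ {a b c d} (w : N.Sort' a) (x : N.Sort' b) (y : N.Sort' c) (z : N.Sort' d),
      tr (mul (adj w) (mul (mul x y) z)) = tr (mul (adj w) (mul x (mul y z))) := by
  refine (axiomatizable_identity u A (t := X₀.adj.mul ((X₁.mul X₂).mul X₃))
    (t' := X₀.adj.mul (X₁.mul (X₂.mul X₃))) fun p v => ?_).mono
    fun N h a b c d w x y z => ?_
  · simp only [A.elem_mul, A.elem_adj, mul_assoc]
  · simp only [TermFam.eval_mul, TermFam.eval_adj] at h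
    exact h (a, b, c, d) (tuple₄ (X := N.carrier) w x y z)

theorem axiomatizable_mul_one : Axiomatizable u A.toPrestructure fun N : TracialPre.{w} =>
    ∀ {a b} (w : N.Sort' a) (x : N.Sort' b),
      tr (mul (adj w) (mul x N.one)) = tr (mul (adj w) x) := by
  refine (axiomatizable_identity u A (t := X₀.adj.mul (X₁.mul TermFam.one))
    (t' := X₀.adj.mul X₁) fun p v => ?_).mono
    fun N h a b w x => ?_
  · simp only [A.elem_mul, A.elem_adj, A.elem_one, _root_.mul_one]
  · simp only [TermFam.eval_mul, TermFam.eval_adj, TermFam.eval_one] at h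
    exact h (a, b, 0, 0) (tuple₄ (X := N.carrier) w x (someElem N 0) (someElem N 0))

theorem axiomatizable_one_mul : Axiomatizable u A.toPrestructure fun N : TracialPre.{w} =>
    ∀ {a b} (w : N.Sort' a) (x : N.Sort' b),
      tr (mul (adj w) (mul N.one x)) = tr (mul (adj w) x) := by
  refine (axiomatizable_identity u A (t := X₀.adj.mul (TermFam.one.mul X₁))
    (t' := X₀.adj.mul X₁) fun p v => ?_).mono
    fun N h a b w x => ?_
  · simp only [A.elem_mul, A.elem_adj, A.elem_one, _root_.one_mul]
  · simp only [TermFam.eval_mul, TermFam.eval_adj, TermFam.eval_one] at h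
    exact h (a, b, 0, 0) (tuple₄ (X := N.carrier) w x (someElem N 0) (someElem N 0))

/-- This and the next condition encode traciality in the form used for the bilinear form of
`exists_conjForm`: the first gives boundedness, the second symmetry. -/
theorem axiomatizable_adj_adj : Axiomatizable u A.toPrestructure fun N : TracialPre.{w} =>
    ∀ {a b} (x : N.Sort' a) (y : N.Sort' b),
      tr (mul (adj (adj x)) (adj y)) = tr (mul (adj y) x) := by
  refine (axiomatizable_identity u A (t := X₀.adj.adj.mul X₁.adj)
    (t' := X₁.adj.mul X₀) fun p v => ?_).mono
    fun N h a b x y => ?_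
  · simp only [A.elem_mul, A.elem_adj, star_star]
    exact A.trace_mul_comm _ _
  · simp only [TermFam.eval_mul, TermFam.eval_adj] at h
    exact h (a, b, 0, 0) (tuple₄ (X := N.carrier) x y (someElem N 0) (someElem N 0))

theorem axiomatizable_adj_adj_comm : Axiomatizable u A.toPrestructure fun N : TracialPre.{w} =>
    ∀ {a b} (x : N.Sort' a) (y : N.Sort' b),
      tr (mul (adj (adj x)) y) = tr (mul (adj (adj y)) x) := by
  refine (axiomatizable_identity u A (t := X₀.adj.adj.mul X₁)
    (t' := X₁.adj.adj.mul X₀) fun p v => ?_).mono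
    fun N h a b x y => ?_
  · simp only [A.elem_mul, A.elem_adj, star_star]
    exact A.trace_mul_comm _ _
  · simp only [TermFam.eval_mul, TermFam.eval_adj] at h
    exact h (a, b, 0, 0) (tuple₄ (X := N.carrier) x y (someElem N 0) (someElem N 0))

theorem axiomatizable_zero : Axiomatizable u A.toPrestructure fun N : TracialPre.{w} =>
    ∀ {a} (w : N.Sort' a),
      tr (mul (adj w) (add N.zero N.zero)) = tr (mul (adj w) N.zero) := by
  refine (axiomatizable_identity u A (t := X₀.adj.mul (TermFam.zero.add TermFam.zero))
    (t' := X₀.adj.mul TermFam.zero) fun p v => ?_).mono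
    fun N h a w => ?_
  · simp only [A.elem_mul, A.elem_adj, A.elem_add, A.elem_zero, add_zero]
  · simp only [TermFam.eval_mul, TermFam.eval_adj, TermFam.eval_add, TermFam.eval_zero] at h
    exact h (a, 0, 0, 0) (tuple₄ (X := N.carrier) w (someElem N 0) (someElem N 0) (someElem N 0))

/-- The sort of the third variable serves only to carry the number `r`; the variable itself does not
occur. The conditions on `natSmul` and `negSmul` use the sorts of spare variables similarly. -/
theorem axiomatizable_incl : Axiomatizable u A.toPrestructure fun N : TracialPre.{w} =>
    ∀ {a b} (w : N.Sort' a) (x : N.Sort' b) (r : ℕ),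
      tr (mul (adj w) (incl (Nat.le_add_right b r) x)) = tr (mul (adj w) x) := by
  refine (axiomatizable_identity u A (t := X₀.adj.mul (X₁.inclAdd _ primrec₂))
    (t' := X₀.adj.mul X₁) fun p v => ?_).mono
    fun N h a b w x r => ?_
  · simp only [A.elem_mul, A.elem_adj, A.elem_inclAdd]
  · simp only [TermFam.eval_mul, TermFam.eval_adj, TermFam.eval_inclAdd] at h
    exact h (a, b, r, 0) (tuple₄ (X := N.carrier) w x (someElem N r) (someElem N 0))

theorem axiomatizable_natSmul_zero : Axiomatizable u A.toPrestructure fun N : TracialPre.{w} =>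
    ∀ {a b} (w : N.Sort' a) (x : N.Sort' b) (r : ℕ),
      tr (mul (adj w) (add (natSmul 0 r x) (natSmul 0 r x)))
        = tr (mul (adj w) (natSmul 0 r x)) := by
  refine (axiomatizable_identity u A
    (t := X₀.adj.mul (X₁.natSmul (fun _ => 0) _ (Primrec.const 0) primrec₂ |>.add
      (X₁.natSmul (fun _ => 0) _ (Primrec.const 0) primrec₂)))
    (t' := X₀.adj.mul (X₁.natSmul (fun _ => 0) _ (Primrec.const 0) primrec₂)) fun p v => ?_).mono
    fun N h a b w x r => ?_
  · simp only [A.elem_mul, A.elem_adj, A.elem_add, A.elem_natSmul, Nat.cast_zero, zero_smul,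
      add_zero]
  · simp only [TermFam.eval_mul, TermFam.eval_adj, TermFam.eval_add, TermFam.eval_natSmul] at h
    exact h (a, b, r, 0) (tuple₄ (X := N.carrier) w x (someElem N r) (someElem N 0))

theorem axiomatizable_natSmul_succ : Axiomatizable u A.toPrestructure fun N : TracialPre.{w} =>
    ∀ {a b} (w : N.Sort' a) (x : N.Sort' b) (r k : ℕ),
      tr (mul (adj w) (natSmul (k + 1) r x)) = tr (mul (adj w) (add (natSmul k r x) x)) := by
  refine (axiomatizable_identity u A (t := X₀.adj.mul
      (X₁.natSmul (fun p => p.2.2.2 + 1) _ (Primrec.succ.comp primrec₃) primrec₂))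
    (t' := X₀.adj.mul (X₁.natSmul _ _ primrec₃ primrec₂ |>.add X₁)) fun p v => ?_).mono
    fun N h a b w x r k => ?_
  · simp only [A.elem_mul, A.elem_adj, A.elem_add, A.elem_natSmul, Nat.cast_succ, add_smul,
      one_smul]
  · simp only [TermFam.eval_mul, TermFam.eval_adj, TermFam.eval_add, TermFam.eval_natSmul] at h
    exact h (a, b, r, k) (tuple₄ (X := N.carrier) w x (someElem N r) (someElem N k))

theorem axiomatizable_negSmul : Axiomatizable u A.toPrestructure fun N : TracialPre.{w} =>
    ∀ {a b} (w : N.Sort' a) (x : N.Sort' b) (r k : ℕ),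
      tr (mul (adj w) (negSmul k r x)) = tr (mul (adj w) (imul (imul (natSmul k r x)))) := by
  refine (axiomatizable_identity u A (t := X₀.adj.mul (X₁.negSmul _ _ primrec₃ primrec₂))
    (t' := X₀.adj.mul (X₁.natSmul _ _ primrec₃ primrec₂).imul.imul) fun p v => ?_).mono
    fun N h a b w x r k => ?_
  · simp only [A.elem_mul, A.elem_adj, A.elem_imul, A.elem_natSmul, A.elem_negSmul, smul_smul,
      ← mul_assoc, Complex.I_mul_I,
      neg_one_mul]
  · simp only [TermFam.eval_mul, TermFam.eval_adj, TermFam.eval_imul, TermFam.eval_natSmul,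
      TermFam.eval_negSmul] at h
    exact h (a, b, r, k) (tuple₄ (X := N.carrier) w x (someElem N r) (someElem N k))

/-- This is `‖xy‖₂ ≤ a ‖y‖₂` for `x` in the ball of radius `a`. The factor `a` enters through a
term, because the index of the connective `x ↦ qx` is not assumed computable from `q`. -/
theorem axiomatizable_mul_left_bound : Axiomatizable u A.toPrestructure fun N : TracialPre.{w} =>
    ∀ {a b} (x : N.Sort' a) (y : N.Sort' b),
      (tr (mul (adj (mul x y)) (mul x y))).re
        ≤ (tr (mul (adj (natSmul a 0 y)) (natSmul a 0 y))).re := by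
  let t := X₁.natSmul _ (fun _ => 0) primrec₀ (Primrec.const 0)
  refine (axiomatizable_inequality u A (F := FormFam.re ((X₀.mul X₁).adj.mul (X₀.mul X₁)))
    (G := FormFam.re (t.adj.mul t)) fun p v => ?_).mono fun N h a b x y => ?_
  · simp only [t, FormFam.eval_re, A.tr_eq, A.elem_mul, A.elem_adj, A.elem_natSmul]
    rw [← A.norm₂_sq, ← A.norm₂_sq, A.norm₂_smul, Complex.norm_natCast]
    exact A.norm₂_mul_sq_le (A.norm_elem_le _) _
  · simp only [t, FormFam.eval_re, TermFam.eval_mul, TermFam.eval_adj, TermFam.eval_natSmul] at h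
    exact h (a, b, 0, 0) (tuple₄ (X := N.carrier) x y (someElem N 0) (someElem N 0))

theorem axiomatizable_mul_right_bound : Axiomatizable u A.toPrestructure fun N : TracialPre.{w} =>
    ∀ {a b} (x : N.Sort' a) (y : N.Sort' b),
      (tr (mul (adj (mul x y)) (mul x y))).re
        ≤ (tr (mul (adj (natSmul b 0 x)) (natSmul b 0 x))).re := by
  let t := X₀.natSmul _ (fun _ => 0) primrec₁ (Primrec.const 0)
  refine (axiomatizable_inequality u A (F := FormFam.re ((X₀.mul X₁).adj.mul (X₀.mul X₁)))
    (G := FormFam.re (t.adj.mul t)) fun p v => ?_).mono fun N h a b x y => ?_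
  · simp only [t, FormFam.eval_re, A.tr_eq, A.elem_mul, A.elem_adj, A.elem_natSmul]
    rw [← A.norm₂_sq, ← A.norm₂_sq, A.norm₂_smul, Complex.norm_natCast]
    exact A.norm₂_mul_sq_le' (A.norm_elem_le _) _
  · simp only [t, FormFam.eval_re, TermFam.eval_mul, TermFam.eval_adj, TermFam.eval_natSmul] at h
    exact h (a, b, 0, 0) (tuple₄ (X := N.carrier) x y (someElem N 0) (someElem N 0))

/-- Squaring avoids the root in `‖x - y‖₂`, and `i²` supplies the sign. Both variables must share a
sort, so the parameter is one natural number and the two spare variables have sort `0`. -/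
theorem axiomatizable_dist_mul_dist : Axiomatizable u A.toPrestructure fun N : TracialPre.{w} =>
    ∀ {a} (x y : N.Sort' a), dist x y * dist x y =
      (tr (mul (adj (add x (imul (imul y)))) (add x (imul (imul y))))).re := by
  have h0 : Primrec fun _ : ℕ => 0 := Primrec.const 0
  let x : TermFam fun p : ℕ => [p, p, 0, 0] := TermFam.var₀ Primrec.id
  let y : TermFam fun p : ℕ => [p, p, 0, 0] := TermFam.var₁ Primrec.id
  let t := x.add y.imul.imul
  refine (axiomatizable_eq Primrec.id Primrec.id h0 h0 (FormFam.mul FormFam.dist FormFam.dist)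
    (FormFam.re (t.adj.mul t)) fun p v => ?_).mono fun N h a x y => ?_
  · simp only [t, FormFam.eval_re, FormFam.eval_mul, A.tr_eq, A.elem_mul, A.elem_adj, A.elem_add,
      A.elem_imul, smul_smul, Complex.I_mul_I, neg_one_smul]
    rw [← A.norm₂_sq, ← sub_eq_add_neg, sq]
    rfl
  · simp only [t, FormFam.eval_re, FormFam.eval_mul, TermFam.eval_mul, TermFam.eval_adj,
      TermFam.eval_add, TermFam.eval_imul] at h
    exact h a (tuple₄ (X := N.carrier) x y (someElem N 0) (someElem N 0))

end Axioms

end TracialPre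

/-! ### Axioms for multiplication by elements of `ℚ(i)` -/

/-- Codes of rational numbers: a code `c` of the numerator, the denominator `d`, and two numbers
witnessing that numerator and denominator are coprime. -/
abbrev IsRatCode (q : ℕ × ℕ × ℕ × ℕ) : Prop := q.2.1 * q.2.2.2 = (q.1 + 1) / 2 * q.2.2.1 + 1

theorem primrecPred_isRatCode : PrimrecPred IsRatCode :=
  Primrec.eq.comp
    (Primrec.nat_mul.comp TracialPre.primrec₁ TracialPre.primrec₃)
    (Primrec.succ.comp (Primrec.nat_mul.comp
      (Primrec.nat_div.comp (Primrec.succ.comp TracialPre.primrec₀) (Primrec.const 2))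
      TracialPre.primrec₂))

/-- Codes of rational numbers. -/
abbrev RatCode : Type := {q : ℕ × ℕ × ℕ × ℕ // IsRatCode q}

instance : Primcodable RatCode := Primcodable.subtype primrecPred_isRatCode

theorem primrec_ratCode_val : Primrec fun q : RatCode => q.1 :=
  Primrec.subtype_val (hp := primrecPred_isRatCode)

theorem natAbs_ofNat (c : ℕ) : (Denumerable.ofNat ℤ c).natAbs = (c + 1) / 2 := by
  obtain ⟨z, rfl⟩ : ∃ z : ℤ, Encodable.encode z = c := ⟨_, Denumerable.encode_ofNat c⟩
  rw [Denumerable.ofNat_encode]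
  cases z with
  | ofNat k => change k = (2 * k + 1) / 2; omega
  | negSucc k => change k + 1 = (2 * k + 1 + 1) / 2; omega

/-- Bézout's identity with natural coefficients and a fixed sign. It turns coprimality into an
equation between witnesses, which is visibly primitive recursive. For `m ≤ 1` there is no inverse of
`n` modulo `m` with remainder `1`. -/
theorem exists_mul_eq_mul_add_one {m n : ℕ} (hn : n ≠ 0) (h : m.Coprime n) :
    ∃ u v : ℕ, n * v = m * u + 1 := by
  rcases lt_or_ge 1 m with hm | hm
  · obtain ⟨v, -, hv⟩ := Nat.exists_mul_mod_eq_one_of_coprime h.symm hm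
    exact ⟨n * v / m, v, by rw [← hv, Nat.div_add_mod]⟩
  · interval_cases m
    · exact ⟨0, 1, by simpa using h⟩
    · exact ⟨n - 1, 1, by omega⟩

namespace RatCode

/-- The absolute value of the numerator. -/
abbrev absNum (q : RatCode) : ℕ := (q.1.1 + 1) / 2

/-- The denominator. -/
abbrev den (q : RatCode) : ℕ := q.1.2.1

theorem den_ne_zero (q : RatCode) : q.den ≠ 0 := fun h => by
  have h' : q.den * q.1.2.2.2 = q.absNum * q.1.2.2.1 + 1 := q.2
  simp [h] at h'

theorem coprime (q : RatCode) : Nat.Coprime (Denumerable.ofNat ℤ q.1.1).natAbs q.den := by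
  rw [natAbs_ofNat]
  have h : q.den * q.1.2.2.2 = q.absNum * q.1.2.2.1 + 1 := q.2
  refine Nat.eq_one_of_dvd_one ((Nat.dvd_add_right
    ((Nat.gcd_dvd_left q.absNum q.den).mul_right q.1.2.2.1)).1 ?_)
  rw [← h]
  exact (Nat.gcd_dvd_right _ _).mul_right _

/-- The rational number with a given code. -/
def val (q : RatCode) : ℚ := ⟨Denumerable.ofNat ℤ q.1.1, q.den, q.den_ne_zero, q.coprime⟩

theorem val_den (q : RatCode) : q.val.den = q.den := rfl

theorem encode_num (q : RatCode) : Encodable.encode q.val.num = q.1.1 :=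
  Denumerable.encode_ofNat (α := ℤ) q.1.1

theorem exists_val_eq (x : ℚ) : ∃ q : RatCode, q.val = x := by
  obtain ⟨u, v, h⟩ := exists_mul_eq_mul_add_one x.den_ne_zero x.reduced
  refine ⟨⟨(Encodable.encode x.num, x.den, u, v), ?_⟩, ?_⟩
  · change x.den * v = (Encodable.encode x.num + 1) / 2 * u + 1
    rw [← natAbs_ofNat, Denumerable.ofNat_encode, h]
  · exact Rat.ext (Denumerable.ofNat_encode x.num) rfl

theorem primrec_num : Primrec fun q : RatCode => q.1.1 :=
  TracialPre.primrec₀.comp primrec_ratCode_val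

theorem primrec_den : Primrec den := TracialPre.primrec₁.comp primrec_ratCode_val

theorem primrec_absNum : Primrec absNum :=
  Primrec.nat_div.comp (Primrec.succ.comp primrec_num) (Primrec.const 2)

theorem val_sq (q : RatCode) : q.val ^ 2 = (q.absNum : ℚ) ^ 2 / (q.den : ℚ) ^ 2 := by
  have h : q.val = (Denumerable.ofNat ℤ q.1.1 : ℚ) / q.den := (Rat.num_div_den q.val).symm
  rw [h, div_pow, absNum, ← natAbs_ofNat]
  congr 1
  rw [Nat.cast_natAbs, Int.cast_abs, sq_abs]

attribute [irreducible] val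

end RatCode

/-- Codes of two rational numbers `a` and `b`, followed by the sort of a variable and two sorts `m`
and `n`. -/
abbrev ScalarData : Type := (RatCode × RatCode) × ℕ × ℕ × ℕ

/-- Multiplication by `a + b i` maps the sort `m` to the sort `n`. -/
abbrev IsScalarCode (p : ScalarData) : Prop :=
  ((p.1.1.absNum * p.1.2.den) * (p.1.1.absNum * p.1.2.den)
    + (p.1.2.absNum * p.1.1.den) * (p.1.2.absNum * p.1.1.den)) * (p.2.2.1 * p.2.2.1)
    ≤ (p.2.2.2 * (p.1.1.den * p.1.2.den)) * (p.2.2.2 * (p.1.1.den * p.1.2.den))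

/-- Clearing the squared denominators leaves an inequality in `ℕ`; signs of numerators disappear
under squaring. -/
theorem isScalarCode_iff (p : ScalarData) : IsScalarCode p ↔
    (p.1.1.val ^ 2 + p.1.2.val ^ 2) * (p.2.2.1 : ℚ) ^ 2 ≤ (p.2.2.2 : ℚ) ^ 2 := by
  obtain ⟨⟨a, b⟩, k, m, n⟩ := p
  have ha : (0 : ℚ) < (a.den : ℚ) ^ 2 :=
    pow_pos (Nat.cast_pos.2 (Nat.pos_of_ne_zero a.den_ne_zero)) 2
  have hb : (0 : ℚ) < (b.den : ℚ) ^ 2 :=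
    pow_pos (Nat.cast_pos.2 (Nat.pos_of_ne_zero b.den_ne_zero)) 2
  rw [RatCode.val_sq, RatCode.val_sq, div_add_div _ _ ha.ne' hb.ne', div_mul_eq_mul_div,
    div_le_iff₀ (mul_pos ha hb), IsScalarCode, ← Nat.cast_le (α := ℚ)]
  push_cast
  ring_nf

theorem primrecPred_isScalarCode : PrimrecPred IsScalarCode := by
  have hm {f g : ScalarData → ℕ} (hf : Primrec f) (hg : Primrec g) :
      Primrec fun p => f p * g p := Primrec.nat_mul.comp hf hg
  have ha : Primrec fun p : ScalarData => p.1.1 := Primrec.fst.comp Primrec.fst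
  have hb : Primrec fun p : ScalarData => p.1.2 := Primrec.snd.comp Primrec.fst
  have hs : Primrec fun p : ScalarData => p.2 := Primrec.snd
  have hs2 : Primrec fun p : ScalarData => p.2.2.1 := Primrec.fst.comp (Primrec.snd.comp hs)
  have hs3 : Primrec fun p : ScalarData => p.2.2.2 := Primrec.snd.comp (Primrec.snd.comp hs)
  have h1 := hm (RatCode.primrec_absNum.comp ha) (RatCode.primrec_den.comp hb)
  have h2 := hm (RatCode.primrec_absNum.comp hb) (RatCode.primrec_den.comp ha)
  have h3 := hm hs3 (hm (RatCode.primrec_den.comp ha) (RatCode.primrec_den.comp hb))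
  exact Primrec.nat_le.comp
    (hm (Primrec.nat_add.comp (hm h1 h1) (hm h2 h2)) (hm hs2 hs2)) (hm h3 h3)

/-- Codes of function symbols for multiplication by scalars, together with the sort of a further
variable. -/
abbrev ScalarCode : Type := {p : ScalarData // IsScalarCode p}

instance : Primcodable ScalarCode := Primcodable.subtype primrecPred_isScalarCode

namespace ScalarCode

theorem primrec_val : Primrec fun p : ScalarCode => p.1 :=
  Primrec.subtype_val (hp := primrecPred_isScalarCode)

theorem exists_eq {k m n : ℕ} {a b : ℚ} (h : (a ^ 2 + b ^ 2) * (m : ℚ) ^ 2 ≤ (n : ℚ) ^ 2) :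
    ∃ a' b' : RatCode, ∃ _ : IsScalarCode ((a', b'), k, m, n), a'.val = a ∧ b'.val = b := by
  obtain ⟨a', rfl⟩ := RatCode.exists_val_eq a
  obtain ⟨b', rfl⟩ := RatCode.exists_val_eq b
  exact ⟨a', b', (isScalarCode_iff _).2 h, rfl, rfl⟩

instance : Nonempty ScalarCode :=
  let ⟨a, b, h', _⟩ := exists_eq (k := 0) (m := 0) (n := 0) (a := 0) (b := 0) (by simp)
  ⟨⟨_, h'⟩⟩

/-- The family of rational numbers given by a primitive recursive family of codes. -/
def ratFam (f : ScalarCode → RatCode) (hf : Primrec f) : RatFam ScalarCode where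
  val p := (f p).val
  num_primrec := (RatCode.primrec_num.comp hf).of_eq fun _ => (RatCode.encode_num _).symm
  den_primrec := (RatCode.primrec_den.comp hf).of_eq fun _ => (RatCode.val_den _).symm

/-- The numerators of the rational numbers given by a primitive recursive family of codes. -/
def numFam (f : ScalarCode → RatCode) (hf : Primrec f) : RatFam ScalarCode where
  val p := (f p).val.num
  num_primrec := (RatCode.primrec_num.comp hf).of_eq fun p => by
    rw [Rat.num_intCast]
    exact (RatCode.encode_num _).symm
  den_primrec := (Primrec.const 1).of_eq fun _ => (Rat.den_intCast _).symm

theorem primrec_re : Primrec fun p : ScalarCode => p.1.1.1 :=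
  Primrec.fst.comp (Primrec.fst.comp primrec_val)

theorem primrec_val_den : Primrec fun p : ScalarCode => p.1.1.1.val.den :=
  (RatCode.primrec_den.comp primrec_re).of_eq fun _ => (RatCode.val_den _).symm

theorem primrec_im : Primrec fun p : ScalarCode => p.1.1.2 :=
  Primrec.snd.comp (Primrec.fst.comp primrec_val)

theorem primrec_dom₀ : Primrec fun p : ScalarCode => p.1.2.1 :=
  Primrec.fst.comp (Primrec.snd.comp primrec_val)

theorem primrec_dom : Primrec fun p : ScalarCode => p.1.2.2.1 :=
  Primrec.fst.comp (Primrec.snd.comp (Primrec.snd.comp primrec_val))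

theorem primrec_cod : Primrec fun p : ScalarCode => p.1.2.2.2 :=
  Primrec.snd.comp (Primrec.snd.comp (Primrec.snd.comp primrec_val))

/-- The context of the axioms for a function symbol. -/
abbrev ctx (p : ScalarCode) : List ℕ := [p.1.2.1, p.1.2.2.1, 0, 0]

abbrev X₀ : TermFam ctx := TermFam.var₀ primrec_dom₀

abbrev X₁ : TermFam ctx := TermFam.var₁ primrec_dom

theorem le (p : ScalarCode) : (p.1.1.1.val ^ 2 + p.1.1.2.val ^ 2) * (p.1.2.2.1 : ℚ) ^ 2
    ≤ (p.1.2.2.2 : ℚ) ^ 2 := (isScalarCode_iff p.1).1 p.2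

/-- Multiplication of the second variable by `a + b i`. -/
def smulTerm : TermFam ctx :=
  X₁.smul (ratFam _ primrec_re) (ratFam _ primrec_im) _ primrec_cod fun p => by
    exact le p

/-- Multiplication of the second variable by `a`. -/
def reTerm : TermFam ctx :=
  X₁.smul (ratFam _ primrec_re) (RatFam.const 0) _ primrec_cod fun p => TracialPre.re_le p.le

/-- Multiplication of the second variable by `b`. -/
def imTerm : TermFam ctx :=
  X₁.smul (ratFam _ primrec_im) (RatFam.const 0) _ primrec_cod fun p => TracialPre.im_le p.le

/-- Multiplication of the second variable by the numerator of `a`. -/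
def numTerm : TermFam ctx :=
  X₁.smul (numFam _ primrec_re) (RatFam.const 0) (fun p => p.1.1.1.val.den * p.1.2.2.2 + 0)
    (Primrec.nat_mul.comp primrec_val_den primrec_cod) fun p => by
    exact TracialPre.num_le (TracialPre.re_le p.le)

/-- Multiplication of the second variable by `a` and its denominator. -/
def denTerm : TermFam ctx :=
  reTerm.natSmul (fun p => p.1.1.1.val.den) (fun _ => 0) primrec_val_den (Primrec.const 0)

end ScalarCode

namespace TracialPre

open ScalarCode

variable {u : Connectives} (A : TracialVonNeumannAlgebra.{w})

/-- Scalar symbols exist only under the norm condition on `q`, `q'`, `m`, `n`. Since that condition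
is primitive recursive on codes, the admissible codes form a `Primcodable` parameter type, and every
admissible symbol has a code. -/
theorem axiomatizable_smul : Axiomatizable u A.toPrestructure fun N : TracialPre.{w} =>
    ∀ {a m n : ℕ} (w : N.Sort' a) (x : N.Sort' m) (q q' : ℚ)
      (h : (q ^ 2 + q' ^ 2) * (m : ℚ) ^ 2 ≤ (n : ℚ) ^ 2),
      tr (mul (adj w) (smul q q' h x))
        = tr (mul (adj w) (add (smul q 0 (re_le h) x) (imul (smul q' 0 (im_le h) x)))) := by
  refine (ContLogic.axiomatizable_tr_eq primrec_dom₀ primrec_dom (Primrec.const 0) (Primrec.const 0)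
    (ScalarCode.X₀.adj.mul smulTerm) (ScalarCode.X₀.adj.mul (reTerm.add imTerm.imul))
    fun p v => ?_).mono fun N h a m n w x q q' hq => ?_
  · have h1 : A.elem (smulTerm.eval A.toPrestructure p v)
        = (⟨p.1.1.1.val, p.1.1.2.val⟩ : ℂ) • A.elem (ScalarCode.X₁.eval A.toPrestructure p v) :=
      A.elem_smul _ _ _ _ _ _
    have h2 : A.elem (reTerm.eval A.toPrestructure p v)
        = (⟨p.1.1.1.val, (0 : ℚ)⟩ : ℂ) • A.elem (ScalarCode.X₁.eval A.toPrestructure p v) :=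
      A.elem_smul _ _ _ _ _ _
    have h3 : A.elem (imTerm.eval A.toPrestructure p v)
        = (⟨p.1.1.2.val, (0 : ℚ)⟩ : ℂ) • A.elem (ScalarCode.X₁.eval A.toPrestructure p v) :=
      A.elem_smul _ _ _ _ _ _
    rw [A.tr_eq, A.tr_eq]
    simp only [A.elem_mul, A.elem_adj, A.elem_add, A.elem_imul, h1, h2, h3, smul_smul, ← add_smul]
    congr 3
    apply Complex.ext <;> simp
  · obtain ⟨b, b', hb, rfl, rfl⟩ := exists_eq (k := a) hq
    simp only [TermFam.eval_mul, TermFam.eval_adj, TermFam.eval_add, TermFam.eval_imul] at h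
    let p : ScalarCode := ⟨((b, b'), a, m, n), hb⟩
    let v : Tuple N.carrier (ctx p) :=
      tuple₄ (X := N.carrier) w x (someElem N 0) (someElem N 0)
    have h1 : smulTerm.eval N p v = smul b.val b'.val hq x := TermFam.eval_smul _ _ _ _ _ _
    have h2 : reTerm.eval N p v = smul b.val 0 (re_le hq) x := TermFam.eval_smul _ _ _ _ _ _
    have h3 : imTerm.eval N p v = smul b'.val 0 (im_le hq) x := TermFam.eval_smul _ _ _ _ _ _
    have := h p v
    rw [h1, h2, h3] at this
    exact this

theorem axiomatizable_ratSmul : Axiomatizable u A.toPrestructure fun N : TracialPre.{w} =>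
    ∀ {a m n : ℕ} (w : N.Sort' a) (x : N.Sort' m) (q : ℚ)
      (h : (q ^ 2 + 0 ^ 2) * (m : ℚ) ^ 2 ≤ (n : ℚ) ^ 2),
      tr (mul (adj w) (natSmul q.den 0 (smul q 0 h x)))
        = tr (mul (adj w) (smul q.num 0 (num_le h) x)) := by
  refine (ContLogic.axiomatizable_tr_eq primrec_dom₀ primrec_dom (Primrec.const 0) (Primrec.const 0)
    (ScalarCode.X₀.adj.mul denTerm) (ScalarCode.X₀.adj.mul numTerm)
    fun p v => ?_).mono fun N h a m n w x q hq => ?_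
  · have h1 : A.elem (denTerm.eval A.toPrestructure p v)
        = (p.1.1.1.val.den : ℂ) • A.elem (reTerm.eval A.toPrestructure p v) :=
      A.elem_natSmul _ _ _
    have h2 : A.elem (reTerm.eval A.toPrestructure p v)
        = (⟨p.1.1.1.val, (0 : ℚ)⟩ : ℂ) • A.elem (ScalarCode.X₁.eval A.toPrestructure p v) :=
      A.elem_smul _ _ _ _ _ _
    have h3 : A.elem (numTerm.eval A.toPrestructure p v)
        = (⟨(p.1.1.1.val.num : ℚ), (0 : ℚ)⟩ : ℂ)
          • A.elem (ScalarCode.X₁.eval A.toPrestructure p v) :=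
      A.elem_smul _ _ _ _ _ _
    have h4 : (p.1.1.1.val.den : ℝ) * (p.1.1.1.val : ℚ) = (p.1.1.1.val.num : ℚ) := by
      exact_mod_cast Rat.den_mul_eq_num p.1.1.1.val
    rw [A.tr_eq, A.tr_eq]
    simp only [A.elem_mul, A.elem_adj, h1, h2, h3, smul_smul]
    congr 4
    apply Complex.ext
    · simpa using h4
    · simp
  -- The codes carry an imaginary part that these terms ignore; with the value `0` for it,
  -- admissibility is exactly `hq`.
  · obtain ⟨b, b', hb, rfl, hb'⟩ := exists_eq (k := a) hq
    simp only [TermFam.eval_mul, TermFam.eval_adj] at h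
    let p : ScalarCode := ⟨((b, b'), a, m, n), hb⟩
    let v : Tuple N.carrier (ctx p) :=
      tuple₄ (X := N.carrier) w x (someElem N 0) (someElem N 0)
    have h1 : denTerm.eval N p v = natSmul b.val.den 0 (reTerm.eval N p v) :=
      TermFam.eval_natSmul _ _ _
    have h2 : reTerm.eval N p v = smul b.val 0 hq x := TermFam.eval_smul _ _ _ _ _ _
    have h3 : numTerm.eval N p v = smul b.val.num 0 (num_le hq) x :=
      TermFam.eval_smul _ _ _ _ _ _
    have := h p v
    rw [h1, h2, h3] at this
    exact this

theorem axiomatizable_isPretracial : Axiomatizable u A.toPrestructure IsPretracial := by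
  refine ((axiomatizable_tr_add u A).and <| (axiomatizable_tr_imul u A).and <|
    (axiomatizable_tr_adj u A).and <| (axiomatizable_tr_one u A).and <|
    (axiomatizable_nonneg u A).and <| (axiomatizable_adj_mul_add u A).and <|
    (axiomatizable_adj_mul_imul u A).and <| (axiomatizable_hermitian u A).and <|
    (TracialPre.axiomatizable_tr_eq u A).and <| (axiomatizable_mul_left_adjoint u A).and <|
    (axiomatizable_mul_right_adjoint u A).and <| (axiomatizable_assoc u A).and <|
    (axiomatizable_mul_one u A).and <| (axiomatizable_one_mul u A).and <|
    (axiomatizable_adj_adj u A).and <| (axiomatizable_adj_adj_comm u A).and <|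
    (axiomatizable_mul_left_bound u A).and <| (axiomatizable_mul_right_bound u A).and <|
    (axiomatizable_dist_mul_dist u A).and <| (axiomatizable_zero u A).and <|
    (axiomatizable_incl u A).and <| (axiomatizable_natSmul_zero u A).and <|
    (axiomatizable_natSmul_succ u A).and <| (axiomatizable_negSmul u A).and <|
    (axiomatizable_ratSmul A).and <| axiomatizable_smul A).mono fun N h => ?_
  obtain ⟨h1, h2, h3, h4, h5, h6, h7, h8, h9, h10, h11, h12, h13, h14, h15, h16, h17, h18, h19,
    h20, h21, h22, h23, h24, h25, h26⟩ := h
  exact ⟨h1, h2, h3, h4, h5, h6, h7, h8, h9, h10, h11, h12, h13, h14, h15, h16, h17, h18, h19,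
    h20, h21, h22, h23, h24, h25, h26⟩

end TracialPre

/-! ### From structures to tracial von Neumann algebras -/

/-- The composition of two embeddings. -/
def Embedding.comp {L : Language} {N M K : Prestructure.{w} L} (g : Embedding M K)
    (f : Embedding N M) : Embedding N K where
  toFun s := g.toFun s ∘ f.toFun s
  isometry s := (g.isometry s).comp (f.isometry s)
  map_fn F x := (congrArg (g.toFun _) (f.map_fn F x)).trans (g.map_fn F _)
  map_rel R x := (g.map_rel R _).trans (f.map_rel R x)

namespace TracialPre

/-! ### Linearity under the trace, and the embedding in the GNS algebra -/

namespace IsPretracial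

variable {N : TracialPre.{w}} {a m n : ℕ}

theorem tr_adj_mul_imul (hN : IsPretracial N) (w : N.Sort' a) (x : N.Sort' m) :
    tr (mul (adj w) (imul x)) = Complex.I * tr (mul (adj w) x) :=
  (hN.adj_mul_imul w x).trans (hN.tr_imul _)

theorem tr_adj_mul_add (hN : IsPretracial N) (w : N.Sort' a) (x : N.Sort' m) (y : N.Sort' n) :
    tr (mul (adj w) (add x y)) = tr (mul (adj w) x) + tr (mul (adj w) y) :=
  (hN.adj_mul_add w x y).trans (hN.tr_add _ _)

theorem tr_hermitian (hN : IsPretracial N) (x : N.Sort' a) (y : N.Sort' m) :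
    tr (mul (adj y) x) = star (tr (mul (adj x) y)) :=
  (hN.hermitian x y).trans (hN.tr_adj _)

/-- The base case uses the law `z + z = z` for `z = 0 · x`, which forces the trace to vanish; the
successor law does the rest. -/
theorem tr_adj_mul_natSmul (hN : IsPretracial N) (w : N.Sort' a) (x : N.Sort' m) (k r : ℕ) :
    tr (mul (adj w) (natSmul k r x)) = k * tr (mul (adj w) x) := by
  induction k with
  | zero =>
    have h := hN.natSmul_zero w x r
    rw [hN.tr_adj_mul_add, add_eq_right] at h
    rw [h, Nat.cast_zero, zero_mul]
  | succ k ih => rw [hN.natSmul_succ, hN.tr_adj_mul_add, ih, Nat.cast_succ, add_mul, _root_.one_mul]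

theorem tr_natSmul_self (hN : IsPretracial N) (x : N.Sort' m) (k : ℕ) :
    (tr (mul (adj (natSmul k 0 x)) (natSmul k 0 x))).re
      = (k : ℝ) ^ 2 * (tr (mul (adj x) x)).re := by
  rw [hN.tr_adj_mul_natSmul, hN.tr_hermitian x, hN.tr_adj_mul_natSmul]
  rw [Complex.star_def, map_mul, Complex.conj_natCast, ← mul_assoc, ← Nat.cast_mul,
    ← Complex.ofReal_natCast, Complex.re_ofReal_mul, Complex.conj_re, Nat.cast_mul, sq]

theorem tr_adj_mul_negSmul (hN : IsPretracial N) (w : N.Sort' a) (x : N.Sort' m) (k r : ℕ) :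
    tr (mul (adj w) (TracialPre.negSmul k r x)) = -k * tr (mul (adj w) x) := by
  rw [hN.negSmul, hN.tr_adj_mul_imul, hN.tr_adj_mul_imul, hN.tr_adj_mul_natSmul, ← mul_assoc,
    Complex.I_mul_I]
  ring

theorem tr_adj_mul_intSmul (hN : IsPretracial N) (w : N.Sort' a) (x : N.Sort' m) (z : ℤ)
    (q : ℚ) (hq : q = z) (h : (q ^ 2 + 0 ^ 2) * (m : ℚ) ^ 2 ≤ (n : ℚ) ^ 2) :
    tr (mul (adj w) (TracialPre.smul q 0 h x)) = z * tr (mul (adj w) x) := by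
  obtain ⟨k, hz⟩ := Int.eq_nat_or_neg z
  -- The norm condition forces `n = k * m + r`, so the given symbol is that of `natSmul` or
  -- `negSmul`.
  have hk : k * m ≤ n := by
    refine (Nat.pow_le_pow_iff_left two_ne_zero).1 ?_
    have h' : q ^ 2 = (k : ℚ) ^ 2 := by
      rcases hz with rfl | rfl <;> simp [hq]
    rw [h', zero_pow two_ne_zero, add_zero, ← mul_pow] at h
    exact_mod_cast h
  obtain ⟨r, rfl⟩ := Nat.exists_eq_add_of_le hk
  rcases hz with rfl | rfl
  · obtain rfl : q = (k : ℚ) := hq.trans (Int.cast_natCast k)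
    refine (hN.tr_adj_mul_natSmul w x k r).trans ?_
    rw [Int.cast_natCast]
  · obtain rfl : q = -(k : ℚ) := hq.trans (by rw [Int.cast_neg, Int.cast_natCast])
    refine (hN.tr_adj_mul_negSmul w x k r).trans ?_
    rw [Int.cast_neg, Int.cast_natCast]

/-- Multiplying by the denominator reduces to the integer case, and the nonzero denominator cancels.
-/
theorem tr_adj_mul_ratSmul (hN : IsPretracial N) (w : N.Sort' a) (x : N.Sort' m) (q : ℚ)
    (h : (q ^ 2 + 0 ^ 2) * (m : ℚ) ^ 2 ≤ (n : ℚ) ^ 2) :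
    tr (mul (adj w) (TracialPre.smul q 0 h x)) = q * tr (mul (adj w) x) := by
  have h1 := hN.ratSmul w x q h
  rw [hN.tr_adj_mul_natSmul, hN.tr_adj_mul_intSmul w x q.num q.num rfl] at h1
  have hd : (q.den : ℂ) ≠ 0 := Nat.cast_ne_zero.2 q.den_ne_zero
  have h2 : (q : ℂ) * q.den = q.num := by exact_mod_cast Rat.mul_den_eq_num q
  refine mul_left_cancel₀ hd (h1.trans ?_)
  rw [← h2]
  ring

theorem tr_adj_mul_smul (hN : IsPretracial N) (w : N.Sort' a) (x : N.Sort' m) (q q' : ℚ)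
    (h : (q ^ 2 + q' ^ 2) * (m : ℚ) ^ 2 ≤ (n : ℚ) ^ 2) :
    tr (mul (adj w) (TracialPre.smul q q' h x)) = (⟨q, q'⟩ : ℂ) * tr (mul (adj w) x) := by
  rw [hN.smul, hN.tr_adj_mul_add, hN.tr_adj_mul_imul, hN.tr_adj_mul_ratSmul,
    hN.tr_adj_mul_ratSmul, ← mul_assoc, ← add_mul]
  congr 1
  apply Complex.ext <;> simp

/-- The elements of all sorts of a structure. -/
def toAlgebra (hN : IsPretracial N) : PretracialAlgebra (Σ n : ℕ, N.Sort' n) where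
  one := ⟨1, N.one⟩
  add x y := ⟨_, add x.2 y.2⟩
  mul x y := ⟨_, mul x.2 y.2⟩
  adj x := ⟨_, adj x.2⟩
  imul x := ⟨_, imul x.2⟩
  trace x := tr x.2
  radius x := x.1
  radius_nonneg x := Nat.cast_nonneg x.1
  adj_mul_add w x y := hN.tr_adj_mul_add w.2 x.2 y.2
  adj_mul_imul w x := hN.tr_adj_mul_imul w.2 x.2
  hermitian x y := hN.tr_hermitian x.2 y.2
  nonneg x := hN.nonneg x.2
  trace_one := hN.tr_one
  trace_eq x := hN.tr_eq x.2
  mul_left_adjoint x y z := hN.mul_left_adjoint x.2 y.2 z.2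
  mul_right_adjoint x y z := hN.mul_right_adjoint x.2 y.2 z.2
  trace_assoc w x y z := hN.assoc w.2 x.2 y.2 z.2
  trace_mul_one w x := hN.mul_one w.2 x.2
  trace_one_mul w x := hN.one_mul w.2 x.2
  adj_adj x y := hN.adj_adj x.2 y.2
  adj_adj_comm x y := hN.adj_adj_comm x.2 y.2
  mul_left_bound x y := (hN.mul_left_bound x.2 y.2).trans_eq (hN.tr_natSmul_self y.2 x.1)
  mul_right_bound x y := (hN.mul_right_bound x.2 y.2).trans_eq (hN.tr_natSmul_self x.2 y.1)

/-- The tracial von Neumann algebra generated by a structure. -/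
abbrev algebra (hN : IsPretracial N) : TracialVonNeumannAlgebra.{w} := hN.toAlgebra.toTracial

/-- The canonical map to the generated tracial von Neumann algebra. -/
def toBall (hN : IsPretracial N) (x : N.Sort' n) : hN.algebra.Ball n :=
  ⟨hN.toAlgebra.toElem ⟨n, x⟩, hN.toAlgebra.norm_toElem_le ⟨n, x⟩⟩

theorem toBall_zero (hN : IsPretracial N) : (hN.toBall N.zero).val = 0 := by
  have h := hN.toAlgebra.toElem_congr (x := hN.toAlgebra.add ⟨1, N.zero⟩ ⟨1, N.zero⟩)
    (y := ⟨1, N.zero⟩) fun w => hN.zero w.2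
  rwa [PretracialAlgebra.toElem_add, add_eq_right] at h

theorem toBall_incl (hN : IsPretracial N) (h : m ≤ n) (x : N.Sort' m) :
    (hN.toBall (TracialPre.incl h x)).val = (hN.toBall x).val := by
  obtain ⟨r, rfl⟩ := Nat.exists_eq_add_of_le h
  exact hN.toAlgebra.toElem_congr fun w => hN.incl w.2 x r

theorem toBall_smul (hN : IsPretracial N) (q q' : ℚ)
    (h : (q ^ 2 + q' ^ 2) * (m : ℚ) ^ 2 ≤ (n : ℚ) ^ 2) (x : N.Sort' m) :
    (hN.toBall (TracialPre.smul q q' h x)).val = (⟨q, q'⟩ : ℂ) • (hN.toBall x).val :=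
  hN.toAlgebra.toElem_eq_smul fun w => hN.tr_adj_mul_smul w.2 x q q' h

/-- The difference of the images is the image of `x + i(iy)`, and its squared `2`-norm is the trace
that `dist_mul_dist` equates with the squared distance. In particular points at positive distance
are not identified. -/
theorem dist_toBall (hN : IsPretracial N) (x y : N.Sort' n) :
    dist (hN.toBall x) (hN.toBall y) = dist x y := by
  have h : (hN.toBall x).val - (hN.toBall y).val
      = hN.toAlgebra.toElem ⟨_, add x (imul (imul y))⟩ := by
    refine Eq.trans ?_ (hN.toAlgebra.toElem_add ⟨n, x⟩ ⟨n, imul (imul y)⟩).symm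
    rw [sub_eq_add_neg]
    refine congrArg (hN.toAlgebra.toElem ⟨n, x⟩ + ·) (Eq.symm ?_)
    refine (hN.toAlgebra.toElem_imul ⟨n, imul y⟩).trans ?_
    refine (congrArg (Complex.I • ·) (hN.toAlgebra.toElem_imul ⟨n, y⟩)).trans ?_
    change Complex.I • Complex.I • hN.toAlgebra.toElem ⟨n, y⟩ = -hN.toAlgebra.toElem ⟨n, y⟩
    rw [smul_smul, Complex.I_mul_I, neg_one_smul]
  refine (sq_eq_sq₀ dist_nonneg dist_nonneg).1 ?_
  rw [TracialVonNeumannAlgebra.Ball.dist_def, TracialVonNeumannAlgebra.norm₂_sq, h,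
    ← PretracialAlgebra.toElem_star, ← PretracialAlgebra.toElem_mul,
    PretracialAlgebra.trace_toElem, sq, hN.dist_mul_dist]
  rfl

/-- The embedding in the generated tracial von Neumann algebra. -/
def embedding (hN : IsPretracial N) : Embedding N hN.algebra.toPrestructure where
  toFun n := hN.toBall (n := n)
  isometry n := Isometry.of_dist_eq fun x y => hN.dist_toBall (n := n) x y
  map_fn f v := by
    refine TracialVonNeumannAlgebra.Ball.ext ?_
    cases f with
    | zero =>
      have h : N.fnMap TracialFn.zero v = N.zero := congrArg _ (funext fun i => i.elim0)
      rw [h]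
      exact hN.toBall_zero
    | one =>
      have h : N.fnMap TracialFn.one v = N.one := congrArg _ (funext fun i => i.elim0)
      rw [h]
      exact hN.toAlgebra.toElem_one
    | incl m n h =>
      have e : v = tuple₁ (v (0 : Fin 1)) := funext fun | ⟨0, _⟩ => rfl
      rw [e]
      exact hN.toBall_incl h _
    | add m n =>
      have e : v = tuple₂ (v (0 : Fin 2)) (v (1 : Fin 2)) := funext fun
        | ⟨0, _⟩ => rfl
        | ⟨1, _⟩ => rfl
      rw [e]
      exact hN.toAlgebra.toElem_add ⟨m, v (0 : Fin 2)⟩ ⟨n, v (1 : Fin 2)⟩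
    | mul m n =>
      have e : v = tuple₂ (v (0 : Fin 2)) (v (1 : Fin 2)) := funext fun
        | ⟨0, _⟩ => rfl
        | ⟨1, _⟩ => rfl
      rw [e]
      exact hN.toAlgebra.toElem_mul ⟨m, v (0 : Fin 2)⟩ ⟨n, v (1 : Fin 2)⟩
    | star n =>
      have e : v = tuple₁ (v (0 : Fin 1)) := funext fun | ⟨0, _⟩ => rfl
      rw [e]
      exact hN.toAlgebra.toElem_star ⟨n, v (0 : Fin 1)⟩
    | smul q q' m n h =>
      have e : v = tuple₁ (v (0 : Fin 1)) := funext fun | ⟨0, _⟩ => rfl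
      rw [e]
      exact hN.toBall_smul q q' h _
  map_rel R v := by
    have e : v = tuple₁ (v (0 : Fin 1)) := funext fun | ⟨0, _⟩ => rfl
    cases R with
    | trRe n =>
      rw [e]
      exact congrArg Complex.re (hN.toAlgebra.trace_toElem ⟨n, v (0 : Fin 1)⟩)
    | trIm n =>
      rw [e]
      exact congrArg Complex.im (hN.toAlgebra.trace_toElem ⟨n, v (0 : Fin 1)⟩)

end IsPretracial

end TracialPre

end ContLogic

end

theorem mainTheorem11 (u : ContLogic.Connectives) (S : ContLogic.TracialVonNeumannAlgebra.{w})
    (hS : S.IsLocallyUniversal) : ContLogic.EmbeddingProblem u S.toPrestructure :=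
  ((ContLogic.TracialPre.axiomatizable_isPretracial S).mono fun _ hN =>
    -- Local universality is applied to the GNS algebra of the model `N`.
    let ⟨ι, U, ⟨f⟩⟩ := hS hN.algebra
    ⟨ι, U, ⟨f.comp hN.embedding⟩⟩).embeddingProblem
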